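/- Let $N\ge 1$ and $1<p<\infty$; functions are complex-valued on $\mathbb R^N$ (real-valued data are included). With $\widehat f(\xi)=\int_{\mathbb R^N}e^{-i x\cdot\xi}f(x)\,dx$, extended to tempered distributions, define $\log(I-\Delta)$ and, for $\sigma\in\mathbb R$, $(I-\Delta)^{\sigma/2}$ as the Fourier multipliers with symbols $\log(1+|\xi|^2)$ and $(1+|\xi|^2)^{\sigma/2}$. For $\sigma\ge0$ let $L^p_\sigma(\mathbb R^N)=\{f\in L^p(\mathbb R^N):(I-\Delta)^{\sigma/2}f\in L^p(\mathbb R^N)\}$, with $\|f\|_{L^p_\sigma}=\|(I-\Delta)^{\sigma/2}f\|_{L^p}$. For $u_0\in L^p(\mathbb R^N)$, a solution of $$\partial_tu+\log(I-\Delta)u=0\ \text{ in }\mathbb R^N\times(0,\infty),\qquad u(\cdot,0)=u_0,$$ is a $u\in\mathcal C([0,\infty);L^p(\mathbb R^N))$ with $u(0)=u_0$ and $$-\int_0^\infty\!\!\int_{\mathbb R^N}u\,\partial_t\varphi\,dx\,dt+\int_0^\infty\!\!\int_{\mathbb R^N}u\,\log(I-\Delta)\varphi\,dx\,dt=0\quad\text{for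 all }\varphi\in \mathcal C_c^\infty(\mathbb R^N\times(0,\infty)).$$ For $t>0$ let $$H_t(x)=\frac1{(4\pi)^{N/2}\Gamma(t)}\int_0^\infty s^{t-\frac N2-1}e^{-s}e^{-\frac{|x|^2}{4s}}\,ds .$$ Then: 1. For every $t>0$, $H_t\in L^1(\mathbb R^N)$ and $\widehat{H_t}(\xi)=e^{-t\log(1+|\xi|^2)}=(1+|\xi|^2)^{-t}$. 2. For every $u_0\in L^p(\mathbb R^N)$ a solution exists, and every solution $u$ satisfies, for all $t>0$: the convolution $H_t*u_0$ converges absolutely almost everywhere, $$u(t)=H_t*u_0=(I-\Delta)^{-t}u_0\in L^p(\mathbb R^N)\cap L^p_{2t}(\mathbb R^N),\qquad \|u(t)\|_{L^p_{2t}}=\|u_0\|_{L^p},\qquad \|u(t)\|_{L^p}\le\|u_0\|_{L^p},$$ and $$u(t)\in L^p(\mathbb R^N)\cap\begin{cases}L^{\frac{Np}{N-2pt}}(\mathbb R^N),&0<t<\frac N{2p},\\ L^q(\mathbb R^N)\ \text{for all }q\in[p,\infty),&t=\frac N{2p},\\ \mathcal C_0(\mathbb R^N),&t>\frac N{2p}\end{cases}$$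 (in the last case, up to equality almost everywhere). 3. The time required to get from $L^p$ into $L^q$, $q\ge p$, is $$t_p^q=\frac N2\Big(\frac1p-\frac1q\Big),$$ in the following sense. For $p\le q<\infty$, the times $t\ge0$ such that $u(t)\in L^q(\mathbb R^N)$ for every $u_0\in L^p(\mathbb R^N)$ and every solution $u$ with initial datum $u_0$ are exactly those with $t\ge t_p^q$. For $q=\infty$, the infimum of the times $t\ge 0$ such that $u(t)\in L^\infty(\mathbb R^N)$ for every such $u_0$ and $u$ is $t_p^\infty=\frac N{2p}$. -/

import Mathlib

open MeasureTheory Set Filter Topology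
open scoped ENNReal FourierTransform SchwartzMap ContDiff Convolution ZeroAtInfty

namespace LogHeat

noncomputable section

/-- The Euclidean space `ℝ^N`. -/
abbrev Sp (N : ℕ) : Type := EuclideanSpace ℝ (Fin N)

/-- Complex-valued `L^p(ℝ^N)` for Lebesgue measure. -/
abbrev LpSp (N : ℕ) (p : ℝ≥0∞) : Type := Lp ℂ p (volume : Measure (Sp N))

/-- Symbol of `log(I - Δ)`. Mathlib's Fourier transform is `𝓕 f ξ = ∫ e^{-2πi⟨x,ξ⟩} f x dx`, for which
`-Δ` has the symbol `(2π‖ξ‖)²`. -/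
def logSymbol (N : ℕ) (ξ : Sp N) : ℝ := Real.log (1 + (2 * Real.pi * ‖ξ‖) ^ 2)

/-- `log(I - Δ) f`, for a test function `f`, through the Fourier transform. -/
def logOp (N : ℕ) (f : Sp N → ℂ) : Sp N → ℂ :=
  𝓕⁻ (fun ξ : Sp N => (logSymbol N ξ : ℂ) * 𝓕 f ξ)

/-- Symbol of `(I - Δ)^{σ/2}`, of any real order `σ`. -/
def besselSymbol (N : ℕ) (σ : ℝ) (ξ : Sp N) : ℂ :=
  (((1 + (2 * Real.pi * ‖ξ‖) ^ 2) ^ (σ / 2) : ℝ) : ℂ)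

/-- The symbol has temperate growth, so that it acts on tempered distributions. -/
theorem besselSymbol_hasTemperateGrowth (N : ℕ) (σ : ℝ) :
    (besselSymbol N σ).HasTemperateGrowth := by
  have h1 : (fun ξ : Sp N => (1 + ‖ξ‖ ^ 2) ^ (σ / 2)).HasTemperateGrowth :=
    Function.hasTemperateGrowth_one_add_norm_sq_rpow (Sp N) (σ / 2)
  have h2 : (fun ξ : Sp N => (2 * Real.pi) • ξ).HasTemperateGrowth :=
    ((2 * Real.pi) • ContinuousLinearMap.id ℝ (Sp N)).hasTemperateGrowth
  have h3 := Function.HasTemperateGrowth.comp Function.Complex.hasTemperateGrowth_ofReal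
    (Function.HasTemperateGrowth.comp h1 h2)
  have h4 : besselSymbol N σ = Complex.ofReal ∘ (fun ξ : Sp N => (1 + ‖ξ‖ ^ 2) ^ (σ / 2)) ∘
      fun ξ : Sp N => (2 * Real.pi) • ξ := by
    funext ξ
    have hpi : |Real.pi| = Real.pi := abs_of_pos Real.pi_pos
    simp [besselSymbol, Function.comp_def, norm_smul, mul_pow, hpi]
  rw [h4]
  exact h3

/-- The operator `(I - Δ)^{σ/2}` on tempered distributions, as a Fourier multiplier: the Bessel
operator for `σ ≥ 0`, the Bessel potential of order `-σ` for `σ < 0`. -/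
def besselOp (N : ℕ) (σ : ℝ) : 𝓢'(Sp N, ℂ) →L[ℂ] 𝓢'(Sp N, ℂ) :=
  TemperedDistribution.fourierMultiplierCLM ℂ (besselSymbol N σ)

/-- Membership of `f ∈ L^p(ℝ^N)` in the Bessel potential space `L^p_σ(ℝ^N)`: the tempered
distribution `(I - Δ)^{σ/2} f` is an `L^p` function. -/
def MemBessel (N : ℕ) (σ : ℝ) {p : ℝ≥0∞} [Fact (1 ≤ p)] (f : LpSp N p) : Prop :=
  ∃ g : LpSp N p, besselOp N σ (f : 𝓢'(Sp N, ℂ)) = (g : 𝓢'(Sp N, ℂ))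

/-- The norm `‖f‖_{L^p_σ} = ‖(I - Δ)^{σ/2} f‖_p`, infinite when `f ∉ L^p_σ(ℝ^N)`. There is at most
one `g` as below. -/
def besselNorm (N : ℕ) (σ : ℝ) {p : ℝ≥0∞} [Fact (1 ≤ p)] (f : LpSp N p) : ℝ≥0∞ :=
  ⨅ (g : LpSp N p) (_ : besselOp N σ (f : 𝓢'(Sp N, ℂ)) = (g : 𝓢'(Sp N, ℂ))), ‖g‖ₑ

/-- The kernel `H_t(x) = (4π)^{-N/2} Γ(t)⁻¹ ∫_0^∞ s^{t-N/2-1} e^{-s} e^{-|x|²/(4s)} ds`. -/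
def kernelH (N : ℕ) (t : ℝ) (x : Sp N) : ℝ :=
  1 / ((4 * Real.pi) ^ ((N : ℝ) / 2) * Real.Gamma t) *
    ∫ s in Ioi (0 : ℝ),
      s ^ (t - (N : ℝ) / 2 - 1) * Real.exp (-s) * Real.exp (-‖x‖ ^ 2 / (4 * s))

/-- The solutions of `∂ₜu + log(I - Δ)u = 0` in `ℝ^N × (0,∞)`, `u(·,0) = u₀ ∈ L^p(ℝ^N)`: curves in
`C([0,∞); L^p(ℝ^N))` that start at `u₀` and solve the equation in the very weak sense. -/
structure IsSolution {N : ℕ} {p : ℝ≥0∞} [Fact (1 ≤ p)] (u₀ : LpSp N p) (u : ℝ → LpSp N p) :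
    Prop where
  continuousOn : ContinuousOn u (Ici 0)
  initial : u 0 = u₀
  veryWeak : ∀ φ : ℝ → Sp N → ℂ,
    ContDiff ℝ ∞ (fun z : ℝ × Sp N => φ z.1 z.2) →
    HasCompactSupport (fun z : ℝ × Sp N => φ z.1 z.2) →
    tsupport (fun z : ℝ × Sp N => φ z.1 z.2) ⊆ Ioi (0 : ℝ) ×ˢ (univ : Set (Sp N)) →
    -(∫ t in Ioi (0 : ℝ), ∫ x, u t x * deriv (fun s => φ s x) t)
      + ∫ t in Ioi (0 : ℝ), ∫ x, u t x * logOp N (φ t) x = 0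

/-- The times at which the solution belongs to `L^q(ℝ^N)`, whatever its initial datum in
`L^p(ℝ^N)`. -/
def timesInto (N : ℕ) (p q : ℝ≥0∞) [Fact (1 ≤ p)] : Set ℝ :=
  {t | 0 ≤ t ∧ ∀ (u₀ : LpSp N p) (u : ℝ → LpSp N p), IsSolution u₀ u → MemLp (u t) q volume}

/-- The time `t_p^q = (N/2) (1/p - 1/q)`, with `1/∞ = 0`. -/
def timeFromTo (N : ℕ) (p q : ℝ≥0∞) : ℝ :=
  (N : ℝ) / 2 * ((p⁻¹).toReal - (q⁻¹).toReal)

end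

end LogHeat

namespace LogHeat

noncomputable section

/-! The kernel is a Gamma average of Gaussians: integrating the transforms of the Gaussians against
`s ^ (t - 1) * exp (-s) / Γ(t)` gives the symbol `(1+|ξ|²)^{-t}` (`fourier_kernelH`). In particular
`H_t` is nonnegative with integral one, so Young's inequality makes convolution with it a
contraction of `L^p`. The convolution is the multiplier on Schwartz functions, and by density and
continuity on all of `L^p` (`coe_toLp_heatConv`). The `L^p_{2t}` statements are then the composition
law of multipliers.

That the semigroup is a solution is checked on Schwartz data by differentiating the symbol under the
integral and is carried to `L^p` by the contraction, which makes all limits uniform in time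
(`hasDerivAt_pairing_logSemigroup`). The fundamental theorem of calculus then gives the very weak
formulation.

Uniqueness is a duality argument. Product test functions and the du Bois-Reymond lemma show that a
solution `u` paired with a fixed Schwartz function is differentiable in time. For fixed `T` and `ψ`,
the pairing of `u s` with the dual evolution of `ψ` at time `T - s` has derivative zero; its values
at `s = 0` and `s = T` identify `u T` with the semigroup (`IsSolution.eq_logSemigroup`).

Smoothing into `L^q` follows from domination of `H_t` by the Riesz kernel of order `α = N(1/p - 1/q)
≤ 2t` and the Hardy–Littlewood–Sobolev theorem, proved here by Hedberg's method from the maximal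
function. Above `N/(2p)`, Hölder's inequality on each Gaussian bounds the sup norm by the `L^p`
norm, and density of Schwartz functions puts the image in `C₀`.

Sharpness comes from scaling. Near the origin `H_t` is at least a multiple of `‖x‖^{2t-N}`, so it
improves the singularity `‖x‖^{-a}` to no better than `‖x‖^{-(a-2t)}`. For `t < t_p^q` there is an
`a < N/p` with `a - 2t > N/q`, hence a datum in `L^p` whose solution is not in `L^q` at time `t`. -/

/-- **Young's inequality** `‖k * f‖_p ≤ ‖k‖_1 ‖f‖_p` for nonnegative functions. -/
theorem lintegral_conv_rpow_le {E : Type*} [AddGroup E] [MeasurableSpace E] [MeasurableAdd₂ E]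
    [MeasurableNeg E] {μ : Measure E} [SFinite μ] [μ.IsAddRightInvariant] {k f : E → ℝ≥0∞}
    (hk : Measurable k) (hf : Measurable f) {p : ℝ} (hp : 1 < p) :
    ∫⁻ x, (∫⁻ y, k y * f (x - y) ∂μ) ^ p ∂μ ≤ (∫⁻ y, k y ∂μ) ^ p * ∫⁻ x, f x ^ p ∂μ := by
  have hp0 : 0 < p := by linarith
  have hpq := Real.HolderConjugate.conjExponent hp
  set q := p.conjExponent with hq
  have hq0 : 0 < q := hpq.symm.pos
  have hmeas : Measurable fun z : E × E => k z.2 * f (z.1 - z.2) ^ p := by fun_prop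
  have key : ∀ x, (∫⁻ y, k y * f (x - y) ∂μ) ^ p ≤
      (∫⁻ y, k y ∂μ) ^ (p - 1) * ∫⁻ y, k y * f (x - y) ^ p ∂μ := by
    intro x
    have h1 : ∫⁻ y, k y * f (x - y) ∂μ =
        ∫⁻ y, ((fun y => k y ^ (1 / q)) * fun y => k y ^ (1 / p) * f (x - y)) y ∂μ := by
      refine lintegral_congr fun y => ?_
      have : k y = k y ^ (1 / q) * k y ^ (1 / p) := by
        rw [← ENNReal.rpow_add_of_nonneg _ _ (by positivity) (by positivity)]
        have : 1 / q + 1 / p = 1 := by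
          have := hpq.symm.inv_add_inv_eq_one
          simpa using this
        rw [this, ENNReal.rpow_one]
      simp only [Pi.mul_apply]
      rw [← mul_assoc, ← this]
    have h2 := ENNReal.lintegral_mul_le_Lp_mul_Lq μ hpq.symm
      (f := fun y => k y ^ (1 / q)) (g := fun y => k y ^ (1 / p) * f (x - y))
      (by fun_prop) (by fun_prop)
    rw [← h1] at h2
    have h3 : ∀ y, (k y ^ (1 / q)) ^ q = k y := fun y => by
      rw [← ENNReal.rpow_mul, one_div_mul_cancel hq0.ne', ENNReal.rpow_one]
    have h4 : ∀ y, (k y ^ (1 / p) * f (x - y)) ^ p = k y * f (x - y) ^ p := fun y => by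
      rw [ENNReal.mul_rpow_of_nonneg _ _ hp0.le, ← ENNReal.rpow_mul, one_div_mul_cancel hp0.ne',
        ENNReal.rpow_one]
    simp_rw [h3, h4] at h2
    calc (∫⁻ y, k y * f (x - y) ∂μ) ^ p
        ≤ ((∫⁻ y, k y ∂μ) ^ (1 / q) * (∫⁻ y, k y * f (x - y) ^ p ∂μ) ^ (1 / p)) ^ p := by gcongr
      _ = _ := by
        rw [ENNReal.mul_rpow_of_nonneg _ _ hp0.le, ← ENNReal.rpow_mul, ← ENNReal.rpow_mul,
          one_div_mul_cancel hp0.ne', ENNReal.rpow_one]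
        congr 2
        rw [one_div, inv_mul_eq_div, hpq.div_conj_eq_sub_one]
  calc ∫⁻ x, (∫⁻ y, k y * f (x - y) ∂μ) ^ p ∂μ
      ≤ ∫⁻ x, (∫⁻ y, k y ∂μ) ^ (p - 1) * ∫⁻ y, k y * f (x - y) ^ p ∂μ ∂μ := lintegral_mono key
    _ = (∫⁻ y, k y ∂μ) ^ (p - 1) * ∫⁻ x, ∫⁻ y, k y * f (x - y) ^ p ∂μ ∂μ :=
        lintegral_const_mul _ hmeas.lintegral_prod_right'
    _ = (∫⁻ y, k y ∂μ) ^ (p - 1) * ∫⁻ y, k y * ∫⁻ x, f x ^ p ∂μ ∂μ := by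
        rw [lintegral_lintegral_swap hmeas.aemeasurable]
        congr 1
        refine lintegral_congr fun y => ?_
        rw [lintegral_const_mul _ (by fun_prop)]
        congr 1
        simpa [sub_eq_add_neg] using lintegral_add_right_eq_self (fun x => f x ^ p) (-y)
    _ = _ := by
        rw [lintegral_mul_const _ hk, ← mul_assoc]
        congr 1
        nth_rewrite 2 [← ENNReal.rpow_one (∫⁻ y, k y ∂μ)]
        rw [← ENNReal.rpow_add_of_nonneg _ _ (by linarith) zero_le_one, sub_add_cancel]

/-! ### The Hardy–Littlewood maximal function -/

section Maximal

theorem measurable_setLIntegral_closedBall {E : Type*} [PseudoMetricSpace E]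
    [SecondCountableTopology E] [MeasurableSpace E] [OpensMeasurableSpace E] {μ : Measure E}
    [SFinite μ]
    {f : E → ℝ≥0∞} (hf : Measurable f) (r : ℝ) :
    Measurable fun x => ∫⁻ y in Metric.closedBall x r, f y ∂μ := by
  have h : ∀ x, ∫⁻ y in Metric.closedBall x r, f y ∂μ =
      ∫⁻ y, {z : E × E | dist z.2 z.1 ≤ r}.indicator (fun z => f z.2) (x, y) ∂μ := fun x => by
    rw [← lintegral_indicator Metric.isClosed_closedBall.measurableSet]
    rfl
  simp_rw [h]
  refine Measurable.lintegral_prod_right' (f := {z : E × E | dist z.2 z.1 ≤ r}.indicator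
    (fun z => f z.2)) ?_
  refine (hf.comp measurable_snd).indicator ?_
  exact measurableSet_le (by fun_prop) measurable_const

variable {E : Type*} [NormedAddCommGroup E] [NormedSpace ℝ E] [FiniteDimensional ℝ E]
  [MeasurableSpace E] [BorelSpace E] {μ : Measure E} [μ.IsAddHaarMeasure]

/-- The average of `f` over the ball of centre `x` and radius `2^k`. -/
def dyadicAverage (μ : Measure E) (f : E → ℝ≥0∞) (k : ℤ) (x : E) : ℝ≥0∞ :=
  (μ (Metric.closedBall (0 : E) ((2 : ℝ) ^ k)))⁻¹ *
    ∫⁻ y in Metric.closedBall x ((2 : ℝ) ^ k), f y ∂μ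

/-- The dyadic Hardy–Littlewood maximal function. -/
def maximalFunction (μ : Measure E) (f : E → ℝ≥0∞) (x : E) : ℝ≥0∞ :=
  ⨆ k : ℤ, dyadicAverage μ f k x

theorem measurable_maximalFunction {f : E → ℝ≥0∞} (hf : Measurable f) :
    Measurable (maximalFunction μ f) :=
  .iSup fun _ => (measurable_setLIntegral_closedBall hf _).const_mul _

/-- The maximal function is of weak type `(1,1)`. -/
theorem measure_lt_maximalFunction_le {f : E → ℝ≥0∞} {c : ℝ≥0∞} (hc : c ≠ 0) (hc' : c ≠ ⊤) :
    μ {x | c < maximalFunction μ f x} ≤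
      ENNReal.ofReal (5 ^ Module.finrank ℝ E) * c⁻¹ * ∫⁻ x, f x ∂μ := by
  set B : ℝ≥0∞ := ENNReal.ofReal (5 ^ Module.finrank ℝ E) * c⁻¹ * ∫⁻ x, f x ∂μ
  -- The covering lemma needs bounded radii, so the level set is exhausted by points having a large
  -- average at radius at most `2 ^ n`.
  let S : ℕ → Set E := fun n => {x | ∃ k : ℤ, k ≤ n ∧ c < dyadicAverage μ f k x}
  have hS : {x | c < maximalFunction μ f x} = ⋃ n, S n := by
    ext x
    simp only [maximalFunction, mem_ofPred_eq, lt_iSup_iff, mem_iUnion, S]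
    exact ⟨fun ⟨k, hk⟩ => ⟨k.toNat, k, k.self_le_toNat, hk⟩, fun ⟨_, k, _, hk⟩ => ⟨k, hk⟩⟩
  have hmono : Monotone S := fun m n hmn x ⟨k, hk, hx⟩ =>
    ⟨k, hk.trans (by exact_mod_cast hmn), hx⟩
  rw [hS, hmono.measure_iUnion]
  refine iSup_le fun n => ?_
  have hex : ∀ x : E, ∃ k : ℤ, x ∈ S n → k ≤ n ∧ c < dyadicAverage μ f k x := fun x => by
    by_cases hx : x ∈ S n
    · obtain ⟨k, hk⟩ := hx
      exact ⟨k, fun _ => hk⟩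
    · exact ⟨0, fun h => absurd h hx⟩
  choose k hk using hex
  -- Vitali: a disjoint subfamily whose fivefold enlargements still cover. This is the source of the
  -- factor `5 ^ finrank`, and disjointness lets the integrals of `f` be summed.
  obtain ⟨u, hu, hdisj, hcov⟩ := Vitali.exists_disjoint_subfamily_covering_enlargement_closedBall
    (S n) (fun x : E => x) (fun x => (2 : ℝ) ^ k x) ((2 : ℝ) ^ (n : ℤ))
    (fun x hx => zpow_le_zpow_right₀ one_le_two (hk x hx).1) 5 (by norm_num)
  have hucount : u.Countable := by
    refine hdisj.countable_of_nonempty_interior fun x _ => ?_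
    exact ⟨x, Metric.ball_subset_interior_closedBall (Metric.mem_ball_self (by positivity))⟩
  have hsub : S n ⊆ ⋃ x ∈ u, Metric.closedBall x (5 * (2 : ℝ) ^ k x) := fun x hx => by
    obtain ⟨b, hb, hsub⟩ := hcov x hx
    exact mem_biUnion hb (hsub (Metric.mem_closedBall_self (by positivity)))
  have hball : ∀ x ∈ u, μ (Metric.closedBall x (5 * (2 : ℝ) ^ k x)) ≤
      ENNReal.ofReal (5 ^ Module.finrank ℝ E) * c⁻¹ *
        ∫⁻ y in Metric.closedBall x ((2 : ℝ) ^ k x), f y ∂μ := by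
    intro x hx
    have h1 := (hk x (hu hx)).2
    set m := μ (Metric.closedBall (0 : E) ((2 : ℝ) ^ k x)) with hm
    have hm0 : m ≠ 0 :=
      (Metric.measure_closedBall_pos μ (0 : E) (show (0 : ℝ) < 2 ^ k x by positivity)).ne'
    have hmt : m ≠ ⊤ := measure_closedBall_lt_top.ne
    rw [dyadicAverage, ← hm] at h1
    rw [Measure.addHaar_closedBall_mul μ x (by norm_num) (by positivity), mul_assoc,
      ← hm]
    gcongr
    rw [← ENNReal.div_eq_inv_mul, ENNReal.le_div_iff_mul_le (.inl hc) (.inl hc'), mul_comm]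
    calc c * m ≤ (m⁻¹ * ∫⁻ y in Metric.closedBall x ((2 : ℝ) ^ k x), f y ∂μ) * m := by gcongr
      _ = _ := by
        rw [mul_comm, ← mul_assoc, ENNReal.mul_inv_cancel hm0 hmt, one_mul]
  calc μ (S n) ≤ μ (⋃ x ∈ u, Metric.closedBall x (5 * (2 : ℝ) ^ k x)) := measure_mono hsub
    _ ≤ ∑' x : u, μ (Metric.closedBall (x : E) (5 * (2 : ℝ) ^ k x)) :=
        measure_biUnion_le μ hucount _
    _ ≤ ∑' x : u, ENNReal.ofReal (5 ^ Module.finrank ℝ E) * c⁻¹ *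
          ∫⁻ y in Metric.closedBall (x : E) ((2 : ℝ) ^ k x), f y ∂μ :=
        ENNReal.tsum_le_tsum fun x => hball x x.2
    _ = ENNReal.ofReal (5 ^ Module.finrank ℝ E) * c⁻¹ *
          ∫⁻ y in ⋃ x ∈ u, Metric.closedBall x ((2 : ℝ) ^ k x), f y ∂μ := by
        rw [ENNReal.tsum_mul_left, lintegral_biUnion hucount
          (fun x _ => Metric.isClosed_closedBall.measurableSet) hdisj]
    _ ≤ B := by
        exact mul_le_mul_right (setLIntegral_le_lintegral _ _) _

/-- Pointwise `f ≤ f·1_{f > c} + c`, and averages preserve constants. This truncation is what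
upgrades the weak type `(1,1)` bound to `L^p`. -/
theorem maximalFunction_le_add_half (f : E → ℝ≥0∞) (c : ℝ≥0∞) (x : E) :
    maximalFunction μ f x ≤ maximalFunction μ ({y | c < f y}.indicator f) x + c := by
  refine iSup_le fun k => ?_
  have hm0 := (Metric.measure_closedBall_pos μ (0 : E) (show (0 : ℝ) < 2 ^ k by positivity)).ne'
  have hmt : μ (Metric.closedBall (0 : E) ((2 : ℝ) ^ k)) ≠ ⊤ := measure_closedBall_lt_top.ne
  have h1 : ∫⁻ y in Metric.closedBall x ((2 : ℝ) ^ k), f y ∂μ ≤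
      ∫⁻ y in Metric.closedBall x ((2 : ℝ) ^ k), {y | c < f y}.indicator f y ∂μ +
        c * μ (Metric.closedBall (0 : E) ((2 : ℝ) ^ k)) := by
    calc _ ≤ ∫⁻ y in Metric.closedBall x ((2 : ℝ) ^ k), ({y | c < f y}.indicator f y + c) ∂μ := by
          refine lintegral_mono fun y => ?_
          by_cases hy : c < f y
          · simp [hy]
          · simpa [hy] using not_lt.mp hy
      _ = _ := by
          rw [lintegral_add_right _ measurable_const, lintegral_const, Measure.restrict_apply_univ,
            Measure.addHaar_closedBall_center]
  calc dyadicAverage μ f k x ≤ dyadicAverage μ ({y | c < f y}.indicator f) k x + c := by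
        unfold dyadicAverage
        refine (mul_le_mul_right h1 _).trans_eq ?_
        rw [mul_add, mul_comm c, ← mul_assoc _ _ c, ENNReal.inv_mul_cancel hm0 hmt, one_mul]
    _ ≤ _ := by
        gcongr
        exact le_iSup (fun k => dyadicAverage μ ({y | c < f y}.indicator f) k x) k

/-- The maximal function is bounded on `L^p`, `p > 1`. -/
theorem lintegral_maximalFunction_rpow_lt_top {F : E → ℝ} (hF : Measurable F) (hF0 : ∀ x, 0 ≤ F x)
    {p : ℝ} (hp : 1 < p) (hfin : ∫⁻ x, ENNReal.ofReal (F x) ^ p ∂μ < ⊤) :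
    ∫⁻ x, maximalFunction μ (fun y => ENNReal.ofReal (F y)) x ^ p ∂μ < ⊤ := by
  have hp0 : 0 < p := by linarith
  set f : E → ℝ≥0∞ := fun y => ENNReal.ofReal (F y) with hf
  have hfm : Measurable f := hF.ennreal_ofReal
  set C : ℝ≥0∞ := ENNReal.ofReal (5 ^ Module.finrank ℝ E) * 2
  have hC : C ≠ ⊤ := ENNReal.mul_ne_top ENNReal.ofReal_ne_top (by simp)
  have hMm := measurable_maximalFunction (μ := μ) hfm
  -- Truncation at height `n` gives real-valued functions, to which the layer cake formula applies;
  -- monotone convergence removes it at the end.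
  let h : ℕ → E → ℝ := fun n x => (min (maximalFunction μ f x) n).toReal
  have hhm : ∀ n, Measurable (h n) := fun n => (hMm.min measurable_const).ennreal_toReal
  -- With density `f`, the integral of `f` over `{2F > t}` becomes a `ν`-measure, so the weak-type
  -- bound can be integrated by a second layer cake formula, for `ν` and exponent `p - 1`.
  set ν := μ.withDensity f
  have hlevel : ∀ n, ∀ t ∈ Ioi (0 : ℝ), μ {a | t < h n a} * ENNReal.ofReal (t ^ (p - 1)) ≤
      C * (ν {a | t < 2 * F a} * ENNReal.ofReal (t ^ (p - 1 - 1))) := by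
    intro n t ht
    have ht : 0 < t := ht
    -- Truncating at half the level: `Mf > t` forces the maximal function of `f·1_{f > t/2}` above
    -- `t/2`.
    set c : ℝ≥0∞ := ENNReal.ofReal (t / 2)
    have hc0 : c ≠ 0 := by simpa [c] using ht
    have hcc : c + c = ENNReal.ofReal t := by
      rw [← ENNReal.ofReal_add (by positivity) (by positivity)]; simp
    have hset : {y | c < f y} = {a | t < 2 * F a} := by
      ext y
      simp only [c, hf, mem_ofPred_eq]
      rw [ENNReal.ofReal_lt_ofReal_iff_of_nonneg (by positivity), div_lt_iff₀' two_pos]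
    have h1 : {a | t < h n a} ⊆ {a | c < maximalFunction μ ({y | c < f y}.indicator f) a} := by
      intro a ha
      have ha : t < h n a := ha
      have hfin : min (maximalFunction μ f a) n ≠ ⊤ := by simp
      have h2 : ENNReal.ofReal t < maximalFunction μ f a :=
        ((ENNReal.ofReal_lt_iff_lt_toReal ht.le hfin).2 ha).trans_le (min_le_left _ _)
      by_contra hcon
      have hcon : _ ≤ c := not_lt.mp (by simpa using hcon)
      have h3 := h2.trans_le (maximalFunction_le_add_half (μ := μ) f c a)
      rw [← hcc] at h3
      exact absurd h3 (not_lt.mpr (by gcongr))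
    have h2 : ∫⁻ x, {y | c < f y}.indicator f x ∂μ = ν {a | t < 2 * F a} := by
      have hms : MeasurableSet {a | t < 2 * F a} :=
        measurableSet_lt measurable_const (hF.const_mul _)
      rw [hset, lintegral_indicator hms, withDensity_apply _ hms]
    have h3 : c⁻¹ * ENNReal.ofReal (t ^ (p - 1)) = 2 * ENNReal.ofReal (t ^ (p - 1 - 1)) := by
      rw [← ENNReal.ofReal_inv_of_pos (by positivity), ← ENNReal.ofReal_mul (by positivity),
        show (2 : ℝ≥0∞) = ENNReal.ofReal 2 by simp, ← ENNReal.ofReal_mul (by positivity),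
        Real.rpow_sub_one ht.ne' (p - 1)]
      congr 1
      field_simp
    calc μ {a | t < h n a} * ENNReal.ofReal (t ^ (p - 1))
        ≤ (ENNReal.ofReal (5 ^ Module.finrank ℝ E) * c⁻¹ * ν {a | t < 2 * F a}) *
            ENNReal.ofReal (t ^ (p - 1)) := by
          gcongr
          exact (measure_mono h1).trans
            ((measure_lt_maximalFunction_le hc0 ENNReal.ofReal_ne_top).trans_eq (by rw [h2]))
      _ = ENNReal.ofReal (5 ^ Module.finrank ℝ E) * ν {a | t < 2 * F a} *
            (c⁻¹ * ENNReal.ofReal (t ^ (p - 1))) := by ring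
      _ = _ := by rw [h3]; ring
  have h2F : ∫⁻ x, ENNReal.ofReal ((2 * F x) ^ (p - 1)) ∂ν ≤
      ENNReal.ofReal (2 ^ (p - 1)) * ∫⁻ x, f x ^ p ∂μ := by
    rw [lintegral_withDensity_eq_lintegral_mul _ hfm (by fun_prop),
      ← lintegral_const_mul _ (by fun_prop)]
    refine lintegral_mono fun x => le_of_eq ?_
    simp only [Pi.mul_apply, hf]
    rw [Real.mul_rpow zero_le_two (hF0 x), ENNReal.ofReal_mul (by positivity),
      ← ENNReal.ofReal_rpow_of_nonneg (hF0 x) (by linarith : 0 ≤ p - 1), mul_left_comm]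
    congr 1
    nth_rewrite 1 [← ENNReal.rpow_one (ENNReal.ofReal (F x))]
    rw [← ENNReal.rpow_add_of_nonneg _ _ zero_le_one (by linarith)]
    congr 1; ring
  -- This equals `(p - 1) * J`. Since `p > 1` the factor is nonzero, so `J` inherits finiteness from
  -- the integral of `f ^ p`.
  have hlayer := lintegral_rpow_eq_lintegral_meas_lt_mul ν (f := fun x => 2 * F x)
    (ae_of_all _ fun x => by simpa using hF0 x) (by fun_prop) (p := p - 1) (by linarith)
  set J := ∫⁻ (t : ℝ) in Ioi 0, ν {a | t < 2 * F a} * ENNReal.ofReal (t ^ (p - 1 - 1))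
  have hJ : J < ⊤ := by
    rw [hlayer] at h2F
    have h3 := h2F.trans_lt (ENNReal.mul_lt_top ENNReal.ofReal_lt_top hfin)
    by_contra hJ
    rw [not_lt_top_iff.mp hJ, ENNReal.mul_top (by simpa using hp)] at h3
    exact lt_irrefl _ h3
  have hbound : ∀ n, ∫⁻ x, ENNReal.ofReal (h n x ^ p) ∂μ ≤ ENNReal.ofReal p * (C * J) := by
    intro n
    rw [lintegral_rpow_eq_lintegral_meas_lt_mul μ (ae_of_all _ fun x => ENNReal.toReal_nonneg)
      (hhm n).aemeasurable hp0, ← lintegral_const_mul' _ _ hC]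
    gcongr ENNReal.ofReal p * ?_
    exact setLIntegral_mono' measurableSet_Ioi (hlevel n)
  have heq : ∀ n x, ENNReal.ofReal (h n x ^ p) = (min (maximalFunction μ f x) n) ^ p :=
    fun n x => by
      rw [← ENNReal.ofReal_rpow_of_nonneg ENNReal.toReal_nonneg hp0.le, ENNReal.ofReal_toReal]
      simp
  have hsup : ∀ x, maximalFunction μ f x ^ p = ⨆ n : ℕ, ENNReal.ofReal (h n x ^ p) := by
    intro x
    simp_rw [heq]
    have h1 : maximalFunction μ f x = ⨆ n : ℕ, min (maximalFunction μ f x) n := by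
      rw [← inf_iSup_eq, ENNReal.iSup_natCast, inf_top_eq]
    nth_rewrite 1 [h1]
    exact (ENNReal.orderIsoRpow p hp0).map_iSup _
  simp_rw [hsup]
  rw [lintegral_iSup (fun n => by have := hhm n; fun_prop)]
  · exact (iSup_le hbound).trans_lt
      (ENNReal.mul_lt_top ENNReal.ofReal_lt_top (ENNReal.mul_lt_top hC.lt_top hJ))
  · intro m n hmn x
    simp_rw [heq]
    gcongr

end Maximal

/-! ### Riesz potentials and the Hardy–Littlewood–Sobolev theorem -/

section Riesz

variable {E : Type*} [NormedAddCommGroup E] [NormedSpace ℝ E] [FiniteDimensional ℝ E]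
  [MeasurableSpace E] [BorelSpace E] {μ : Measure E} [μ.IsAddHaarMeasure]

theorem lintegral_Ioi_rpow {a c : ℝ} (ha : a < 0) (hc : 0 < c) :
    ∫⁻ r in Ioi c, ENNReal.ofReal (r ^ (a - 1)) = ENNReal.ofReal (c ^ a / (-a)) := by
  rw [← ofReal_integral_eq_lintegral_ofReal (integrableOn_Ioi_rpow_of_lt (by linarith) hc)
    ((ae_restrict_iff' measurableSet_Ioi).2
      (ae_of_all _ fun r (hr : c < r) => Real.rpow_nonneg (hc.trans hr).le _)),
    integral_Ioi_rpow_of_lt (by linarith) hc, sub_add_cancel, div_neg, neg_div]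

theorem lintegral_Ioc_rpow {a c : ℝ} (ha : 0 < a) (hc : 0 < c) :
    ∫⁻ r in Ioc 0 c, ENNReal.ofReal (r ^ (a - 1)) = ENNReal.ofReal (c ^ a / a) := by
  have hint : IntervalIntegrable (fun r : ℝ => r ^ (a - 1)) volume 0 c :=
    intervalIntegral.intervalIntegrable_rpow' (by linarith)
  rw [← ofReal_integral_eq_lintegral_ofReal
    ((intervalIntegrable_iff_integrableOn_Ioc_of_le hc.le).1 hint)
    ((ae_restrict_iff' measurableSet_Ioc).2
      (ae_of_all _ fun r hr => Real.rpow_nonneg hr.1.le _)),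
    ← intervalIntegral.integral_of_le hc.le, integral_rpow (.inl (by linarith)), sub_add_cancel,
    Real.zero_rpow ha.ne', sub_zero]

/-- The Riesz potential is an integral of the means of `f` over the balls of centre `x`. -/
theorem lintegral_norm_rpow_mul_le [Nontrivial E] {f : E → ℝ≥0∞} (hf : Measurable f) {b : ℝ}
    (hb : b < 0) (x : E) :
    ∫⁻ y, ENNReal.ofReal (‖y‖ ^ b) * f (x - y) ∂μ ≤ ENNReal.ofReal (-b) *
      ∫⁻ r in Ioi (0 : ℝ), ENNReal.ofReal (r ^ (b - 1)) *
        ∫⁻ y in Metric.closedBall x r, f y ∂μ := by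
  have h1 : ∫⁻ y, ENNReal.ofReal (‖y‖ ^ b) * f (x - y) ∂μ =
      ∫⁻ y, ENNReal.ofReal (‖x - y‖ ^ b) * f y ∂μ := by
    rw [← lintegral_sub_left_eq_self (fun y => ENNReal.ofReal (‖x - y‖ ^ b) * f y) x]
    simp
  -- For `b < 0`, a positive `ρ` satisfies `ρ ^ b = -b ∫_ρ^∞ r ^ (b-1) dr`. Tonelli's theorem then
  -- turns the potential into integrals over balls.
  have h2 : ∀ y ∈ ({x}ᶜ : Set E), ENNReal.ofReal (‖x - y‖ ^ b) * f y = ENNReal.ofReal (-b) *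
      ∫⁻ r in Ioi (0 : ℝ), ENNReal.ofReal (r ^ (b - 1)) * (Metric.ball x r).indicator f y := by
    intro y hy
    have hpos : 0 < ‖x - y‖ := norm_pos_iff.2 (sub_ne_zero.2 (Ne.symm hy))
    have h3 : ∀ r, ENNReal.ofReal (r ^ (b - 1)) * (Metric.ball x r).indicator f y =
        (Ioi ‖x - y‖).indicator (fun r => ENNReal.ofReal (r ^ (b - 1)) * f y) r := by
      intro r
      by_cases hr : ‖x - y‖ < r
      · have : y ∈ Metric.ball x r := by rwa [Metric.mem_ball, dist_eq_norm, norm_sub_rev]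
        simp [this, hr]
      · have : y ∉ Metric.ball x r := by rwa [Metric.mem_ball, dist_eq_norm, norm_sub_rev]
        simp [this, hr]
    simp_rw [h3]
    rw [lintegral_indicator measurableSet_Ioi, Measure.restrict_restrict measurableSet_Ioi,
      inter_eq_left.2 (Ioi_subset_Ioi hpos.le), lintegral_mul_const _ (by fun_prop),
      lintegral_Ioi_rpow hb hpos, ← mul_assoc, ← ENNReal.ofReal_mul (by linarith),
      mul_div_cancel₀ _ (by linarith)]
  have h4 : ∀ᵐ y ∂μ, y ∈ ({x}ᶜ : Set E) := by
    rw [ae_iff]; simp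
  have hmeas : Measurable fun z : E × ℝ =>
      ENNReal.ofReal (z.2 ^ (b - 1)) * (Metric.ball x z.2).indicator f z.1 := by
    have : (fun z : E × ℝ => (Metric.ball x z.2).indicator f z.1) =
        {z : E × ℝ | dist z.1 x < z.2}.indicator fun z => f z.1 := by
      ext z; simp [indicator]
    have h5 : Measurable fun z : E × ℝ => (Metric.ball x z.2).indicator f z.1 := by
      rw [this]
      exact (hf.comp measurable_fst).indicator (measurableSet_lt (by fun_prop) measurable_snd)
    exact (by fun_prop : Measurable fun z : E × ℝ => ENNReal.ofReal (z.2 ^ (b - 1))).mul h5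
  rw [h1, lintegral_congr_ae (h4.mono h2), lintegral_const_mul' _ _ ENNReal.ofReal_ne_top,
    lintegral_lintegral_swap hmeas.aemeasurable]
  gcongr with r
  rw [lintegral_const_mul' _ _ ENNReal.ofReal_ne_top, lintegral_indicator measurableSet_ball]
  gcongr
  exact Metric.ball_subset_closedBall

/-- The next dyadic radius is at most `2 * r`, which costs the factor `2 ^ finrank`. This is the
bound used at small radii. -/
theorem setLIntegral_closedBall_le_maximalFunction (f : E → ℝ≥0∞) (x : E) {r : ℝ} (hr : 0 < r) :
    ∫⁻ y in Metric.closedBall x r, f y ∂μ ≤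
      ENNReal.ofReal (2 ^ Module.finrank ℝ E) * μ (Metric.closedBall 0 1) *
        (ENNReal.ofReal (r ^ (Module.finrank ℝ E : ℝ)) * maximalFunction μ f x) := by
  obtain ⟨k, hk1, hk2⟩ := exists_mem_Ioc_zpow hr one_lt_two
  have hm0 := (Metric.measure_closedBall_pos μ (0 : E)
    (show (0 : ℝ) < 2 ^ (k + 1) by positivity)).ne'
  have hmt : μ (Metric.closedBall (0 : E) ((2 : ℝ) ^ (k + 1))) ≠ ⊤ := measure_closedBall_lt_top.ne
  calc ∫⁻ y in Metric.closedBall x r, f y ∂μ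
      ≤ ∫⁻ y in Metric.closedBall x ((2 : ℝ) ^ (k + 1)), f y ∂μ :=
        lintegral_mono_set (Metric.closedBall_subset_closedBall hk2)
    _ = μ (Metric.closedBall (0 : E) ((2 : ℝ) ^ (k + 1))) * dyadicAverage μ f (k + 1) x := by
        rw [dyadicAverage, ← mul_assoc, ENNReal.mul_inv_cancel hm0 hmt, one_mul]
    _ ≤ μ (Metric.closedBall (0 : E) (2 * r)) * maximalFunction μ f x := by
        gcongr
        · rw [zpow_add_one₀ two_ne_zero, mul_comm]; gcongr
        · exact le_iSup (fun k => dyadicAverage μ f k x) (k + 1)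
    _ = _ := by
        rw [Measure.addHaar_closedBall' μ 0 (by positivity), mul_pow,
          ENNReal.ofReal_mul (by positivity), Real.rpow_natCast]
        ring

/-- Hölder's inequality against the constant `1` on the ball. This is the bound used at large radii,
where the maximal function is too weak. -/
theorem setLIntegral_closedBall_le_rpow {f : E → ℝ≥0∞} (hf : Measurable f) {p : ℝ} (hp : 1 < p)
    (x : E) {r : ℝ} (hr : 0 < r) :
    ∫⁻ y in Metric.closedBall x r, f y ∂μ ≤ (∫⁻ y, f y ^ p ∂μ) ^ (1 / p) *
      (μ (Metric.closedBall 0 1)) ^ (1 - 1 / p) *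
        ENNReal.ofReal (r ^ (Module.finrank ℝ E * (1 - 1 / p))) := by
  have hpq := Real.HolderConjugate.conjExponent hp
  have hp0 : 0 < p := by linarith
  have hq : 1 / p.conjExponent = 1 - 1 / p := by simpa using hpq.one_sub_inv.symm
  have hq0 : 0 ≤ 1 - 1 / p := by rw [← hq]; have := hpq.symm.pos; positivity
  have h := ENNReal.lintegral_mul_le_Lp_mul_Lq (μ.restrict (Metric.closedBall x r)) hpq
    hf.aemeasurable (aemeasurable_const (b := 1))
  simp only [Pi.mul_apply, mul_one, ENNReal.one_rpow, lintegral_const, one_mul,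
    Measure.restrict_apply_univ] at h
  rw [hq] at h
  refine h.trans ?_
  rw [Measure.addHaar_closedBall' μ x hr.le, ENNReal.mul_rpow_of_nonneg _ _ hq0,
    ENNReal.ofReal_rpow_of_nonneg (by positivity) hq0, Real.rpow_mul hr.le, Real.rpow_natCast,
    mul_assoc, mul_comm (μ _ ^ _)]
  gcongr
  exact Measure.restrict_le_self

/-- The pointwise inequality behind the Hardy–Littlewood–Sobolev theorem: a constant serves for all
points `x` and all `δ > 0`. -/
theorem exists_lintegral_norm_rpow_mul_le [Nontrivial E] {f : E → ℝ≥0∞} (hf : Measurable f)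
    {p α : ℝ} (hp : 1 < p) (hfin : ∫⁻ x, f x ^ p ∂μ < ⊤) (hα : 0 < α)
    (hα' : α * p < Module.finrank ℝ E) :
    ∃ C : ℝ≥0∞, C ≠ ⊤ ∧ ∀ (x : E) (δ : ℝ), 0 < δ →
      ∫⁻ y, ENNReal.ofReal (‖y‖ ^ (α - Module.finrank ℝ E)) * f (x - y) ∂μ ≤
        C * (ENNReal.ofReal (δ ^ α) * maximalFunction μ f x +
          ENNReal.ofReal (δ ^ (α - Module.finrank ℝ E / p))) := by
  set n : ℝ := (Module.finrank ℝ E : ℝ) with hn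
  have hp0 : 0 < p := by linarith
  have hαn : α < n := by nlinarith
  have hγ : α - n / p < 0 := by rw [sub_neg, lt_div_iff₀ hp0]; exact hα'
  set K₁ : ℝ≥0∞ := ENNReal.ofReal (2 ^ Module.finrank ℝ E) * μ (Metric.closedBall 0 1)
  set K₂ : ℝ≥0∞ := (∫⁻ y, f y ^ p ∂μ) ^ (1 / p) * (μ (Metric.closedBall 0 1)) ^ (1 - 1 / p)
  have h1p : 0 ≤ 1 - 1 / p := by
    rw [sub_nonneg, div_le_one hp0]; exact hp.le
  have hK₁ : K₁ ≠ ⊤ := ENNReal.mul_ne_top ENNReal.ofReal_ne_top measure_closedBall_lt_top.ne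
  have hK₂ : K₂ ≠ ⊤ := ENNReal.mul_ne_top (ENNReal.rpow_ne_top_of_nonneg (by positivity) hfin.ne)
    (ENNReal.rpow_ne_top_of_nonneg h1p measure_closedBall_lt_top.ne)
  set C₁ := K₁ * ENNReal.ofReal (1 / α)
  set C₂ := K₂ * ENNReal.ofReal (1 / (n / p - α))
  have hC₁ : C₁ ≠ ⊤ := ENNReal.mul_ne_top hK₁ ENNReal.ofReal_ne_top
  have hC₂ : C₂ ≠ ⊤ := ENNReal.mul_ne_top hK₂ ENNReal.ofReal_ne_top
  refine ⟨ENNReal.ofReal (n - α) * (C₁ + C₂),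
    ENNReal.mul_ne_top ENNReal.ofReal_ne_top (ENNReal.add_ne_top.2 ⟨hC₁, hC₂⟩), fun x δ hδ => ?_⟩
  have h1 := lintegral_norm_rpow_mul_le (μ := μ) hf (b := α - n) (by linarith) x
  rw [neg_sub] at h1
  refine h1.trans ?_
  rw [mul_assoc]
  gcongr
  -- Hedberg's splitting at radius `δ`: the maximal function leaves `r ^ (α - 1)`, integrable at
  -- `0`; Hölder leaves `r ^ (α - n/p - 1)`, integrable at infinity because `α < n/p`.
  rw [← Ioc_union_Ioi_eq_Ioi hδ.le,
    lintegral_union measurableSet_Ioi (Ioc_disjoint_Ioi le_rfl)]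
  have hA : ∫⁻ r in Ioc 0 δ, ENNReal.ofReal (r ^ (α - n - 1)) *
      ∫⁻ y in Metric.closedBall x r, f y ∂μ ≤
      C₁ * (ENNReal.ofReal (δ ^ α) * maximalFunction μ f x) := by
    calc _ ≤ ∫⁻ r in Ioc 0 δ, ENNReal.ofReal (r ^ (α - 1)) * (K₁ * maximalFunction μ f x) := by
          refine setLIntegral_mono' measurableSet_Ioc fun r hr => ?_
          calc _ ≤ ENNReal.ofReal (r ^ (α - n - 1)) * (K₁ * (ENNReal.ofReal (r ^ n) *
                maximalFunction μ f x)) := by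
                gcongr
                exact setLIntegral_closedBall_le_maximalFunction f x hr.1
            _ = (ENNReal.ofReal (r ^ (α - n - 1)) * ENNReal.ofReal (r ^ n)) *
                (K₁ * maximalFunction μ f x) := by ring
            _ = _ := by
                have := hr.1
                rw [← ENNReal.ofReal_mul (by positivity), ← Real.rpow_add hr.1]
                congr 3; ring_nf
      _ = _ := by
          rw [lintegral_mul_const _ (by fun_prop), lintegral_Ioc_rpow hα hδ, div_eq_mul_one_div,
            ENNReal.ofReal_mul (by positivity)]
          simp only [C₁]; ring
  have hB : ∫⁻ r in Ioi δ, ENNReal.ofReal (r ^ (α - n - 1)) *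
      ∫⁻ y in Metric.closedBall x r, f y ∂μ ≤ C₂ * ENNReal.ofReal (δ ^ (α - n / p)) := by
    calc _ ≤ ∫⁻ r in Ioi δ, ENNReal.ofReal (r ^ (α - n / p - 1)) * K₂ := by
          refine setLIntegral_mono' measurableSet_Ioi fun r (hr : δ < r) => ?_
          have hr0 := hδ.trans hr
          calc _ ≤ ENNReal.ofReal (r ^ (α - n - 1)) *
                (K₂ * ENNReal.ofReal (r ^ (n * (1 - 1 / p)))) := by
                gcongr
                exact setLIntegral_closedBall_le_rpow hf hp x hr0
            _ = (ENNReal.ofReal (r ^ (α - n - 1)) * ENNReal.ofReal (r ^ (n * (1 - 1 / p)))) *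
                K₂ := by ring
            _ = _ := by
                rw [← ENNReal.ofReal_mul (by positivity), ← Real.rpow_add hr0]
                congr 3; ring_nf
      _ = _ := by
          rw [lintegral_mul_const _ (by fun_prop), lintegral_Ioi_rpow hγ hδ, div_eq_mul_one_div,
            ENNReal.ofReal_mul (by positivity), neg_sub]
          simp only [C₂]; ring
  calc _ ≤ C₁ * (ENNReal.ofReal (δ ^ α) * maximalFunction μ f x) +
        C₂ * ENNReal.ofReal (δ ^ (α - n / p)) := add_le_add hA hB
    _ ≤ _ := by
      rw [mul_add]
      gcongr
      · exact le_self_add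
      · exact le_add_self

/-- The **Hardy–Littlewood–Sobolev theorem**: the Riesz potential of order `α` maps `L^p` into `L^q`
when `1/q = 1/p - α/n`. -/
theorem lintegral_riesz_rpow_lt_top [Nontrivial E] {F : E → ℝ} (hF : Measurable F)
    (hF0 : ∀ x, 0 ≤ F x) {p q α : ℝ} (hp : 1 < p) (hq : 0 < q)
    (hfin : ∫⁻ x, ENNReal.ofReal (F x) ^ p ∂μ < ⊤) (hα : 0 < α)
    (hα' : α * p < Module.finrank ℝ E) (hpq : q * (1 - α * p / Module.finrank ℝ E) = p) :
    ∫⁻ x, (∫⁻ y, ENNReal.ofReal (‖y‖ ^ (α - Module.finrank ℝ E)) *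
      ENNReal.ofReal (F (x - y)) ∂μ) ^ q ∂μ < ⊤ := by
  set n : ℝ := (Module.finrank ℝ E : ℝ) with hn
  have hp0 : 0 < p := by linarith
  have hn0 : 0 < n := by nlinarith
  set f : E → ℝ≥0∞ := fun y => ENNReal.ofReal (F y) with hf
  have hfm : Measurable f := hF.ennreal_ofReal
  obtain ⟨C, hC, hle⟩ := exists_lintegral_norm_rpow_mul_le (μ := μ) hfm hp hfin hα hα'
  have hθ : 0 < 1 - α * p / n := by rw [sub_pos, div_lt_one hn0]; exact hα'
  have key : ∀ x, ∫⁻ y, ENNReal.ofReal (‖y‖ ^ (α - n)) * f (x - y) ∂μ ≤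
      C * 2 * maximalFunction μ f x ^ (1 - α * p / n) := by
    intro x
    -- The optimal radius is a negative power of the maximal function, so its values `0` and `⊤` are
    -- treated apart. At `0` every ball integral vanishes.
    rcases eq_or_ne (maximalFunction μ f x) 0 with hM0 | hM0
    · refine (lintegral_norm_rpow_mul_le (μ := μ) hfm (b := α - n) (by nlinarith) x).trans ?_
      have : ∫⁻ r in Ioi (0 : ℝ), ENNReal.ofReal (r ^ (α - n - 1)) *
          ∫⁻ y in Metric.closedBall x r, f y ∂μ = ∫⁻ r in Ioi (0 : ℝ), 0 := by
        refine setLIntegral_congr_fun measurableSet_Ioi fun r hr => ?_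
        have := setLIntegral_closedBall_le_maximalFunction (μ := μ) f x hr
        rw [hM0, mul_zero, mul_zero] at this
        simp only [nonpos_iff_eq_zero.1 this, mul_zero]
      rw [this]
      simp
    rcases eq_or_ne (maximalFunction μ f x) ⊤ with hMt | hMt
    · rcases eq_or_ne C 0 with hC0 | hC0
      · have := hle x 1 one_pos
        rw [hC0, zero_mul] at this
        exact this.trans zero_le
      · rw [hMt, ENNReal.top_rpow_of_pos hθ, ENNReal.mul_top (by simp [hC0])]
        exact le_top
    set m := (maximalFunction μ f x).toReal with hm
    have hm0 : 0 < m := ENNReal.toReal_pos hM0 hMt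
    have hMm : maximalFunction μ f x = ENNReal.ofReal m := (ENNReal.ofReal_toReal hMt).symm
    -- This `δ` makes the two terms equal, both being `m ^ (1 - α p / n)`; their sum is the factor
    -- `2`.
    refine (hle x (m ^ (-p / n)) (by positivity)).trans_eq ?_
    rw [hMm, ← ENNReal.ofReal_mul (by positivity), ← Real.rpow_mul hm0.le, ← Real.rpow_mul hm0.le,
      ENNReal.ofReal_rpow_of_pos hm0, mul_assoc, two_mul]
    have e1 : m ^ (-p / n * α) * m = m ^ (1 - α * p / n) := by
      nth_rewrite 2 [← Real.rpow_one m]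
      rw [← Real.rpow_add hm0]
      congr 1; ring
    have e2 : -p / n * (α - n / p) = 1 - α * p / n := by field_simp; ring
    rw [e1, e2]
  calc _ ≤ ∫⁻ x, (C * 2) ^ q * maximalFunction μ f x ^ p ∂μ := by
        refine lintegral_mono fun x => ?_
        calc _ ≤ (C * 2 * maximalFunction μ f x ^ (1 - α * p / n)) ^ q := by
              gcongr; exact key x
          _ = _ := by
              rw [ENNReal.mul_rpow_of_nonneg _ _ hq.le, ← ENNReal.rpow_mul, mul_comm _ q, hpq]
    _ < ⊤ := by
      rw [lintegral_const_mul' _ _ (ENNReal.rpow_ne_top_of_nonneg hq.le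
        (ENNReal.mul_ne_top hC (by simp)))]
      exact ENNReal.mul_lt_top (ENNReal.rpow_lt_top_of_nonneg hq.le
        (ENNReal.mul_ne_top hC (by simp))) (lintegral_maximalFunction_rpow_lt_top hF hF0 hp hfin)

end Riesz

/-! ### The kernel `H_t`: transform, upper bounds, lower bound at the origin -/

section Kernel

/-- The integrand of the kernel `H_t`. -/
def heatWeight (N : ℕ) (t s : ℝ) (x : Sp N) : ℝ :=
  s ^ (t - (N : ℝ) / 2 - 1) * Real.exp (-s) * Real.exp (-‖x‖ ^ 2 / (4 * s))

theorem kernelH_eq (N : ℕ) (t : ℝ) (x : Sp N) :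
    kernelH N t x = 1 / ((4 * Real.pi) ^ ((N : ℝ) / 2) * Real.Gamma t) *
      ∫ s in Ioi (0 : ℝ), heatWeight N t s x := rfl

theorem kernelH_const_pos (N : ℕ) {t : ℝ} (ht : 0 < t) :
    0 < 1 / ((4 * Real.pi) ^ ((N : ℝ) / 2) * Real.Gamma t) := by
  have := Real.Gamma_pos_of_pos ht
  have := Real.pi_pos
  positivity

theorem heatWeight_nonneg (N : ℕ) (t : ℝ) {s : ℝ} (hs : 0 < s) (x : Sp N) :
    0 ≤ heatWeight N t s x := by unfold heatWeight; positivity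

theorem kernelH_nonneg {N : ℕ} {t : ℝ} (ht : 0 < t) (x : Sp N) : 0 ≤ kernelH N t x :=
  mul_nonneg (kernelH_const_pos N ht).le
    (setIntegral_nonneg measurableSet_Ioi fun _ hs => heatWeight_nonneg N t hs x)

theorem measurable_heatWeight (N : ℕ) (t : ℝ) :
    Measurable fun z : ℝ × Sp N => heatWeight N t z.1 z.2 := by
  unfold heatWeight; fun_prop

theorem measurable_kernelH (N : ℕ) (t : ℝ) : Measurable (kernelH N t) := by
  refine Measurable.const_mul (StronglyMeasurable.measurable ?_) _
  exact StronglyMeasurable.integral_prod_right' (f := fun z : Sp N × ℝ => heatWeight N t z.2 z.1)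
    ((measurable_heatWeight N t).comp measurable_swap).stronglyMeasurable

theorem integral_gaussian_heat (N : ℕ) {s : ℝ} (hs : 0 < s) :
    ∫ x : Sp N, Real.exp (-‖x‖ ^ 2 / (4 * s)) = (4 * Real.pi * s) ^ ((N : ℝ) / 2) := by
  have h := GaussianFourier.integral_rexp_neg_mul_sq_norm (V := Sp N) (b := 1 / (4 * s))
    (by positivity)
  rw [finrank_euclideanSpace_fin] at h
  convert h using 1
  · refine integral_congr_ae (ae_of_all _ fun x => ?_)
    simp only
    congr 1; ring
  · congr 1; field_simp

theorem integrable_gaussian_heat (N : ℕ) {s : ℝ} (hs : 0 < s) :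
    Integrable fun x : Sp N => Real.exp (-‖x‖ ^ 2 / (4 * s)) := by
  refine Integrable.of_integral_ne_zero ?_
  rw [integral_gaussian_heat N hs]
  have := Real.pi_pos
  positivity

/-- The mass `(4πs)^{N/2}` of the Gaussian absorbs `s ^ (-N/2)` and leaves the integrand of `Γ(t)`;
this accounts for the normalisation of the kernel. -/
theorem heatWeight_rpow_mul (N : ℕ) (t : ℝ) {s : ℝ} (hs : 0 < s) :
    s ^ (t - (N : ℝ) / 2 - 1) * Real.exp (-s) * (4 * Real.pi * s) ^ ((N : ℝ) / 2) =
      (4 * Real.pi) ^ ((N : ℝ) / 2) * (Real.exp (-s) * s ^ (t - 1)) := by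
  have := Real.pi_pos
  rw [Real.mul_rpow (by positivity) hs.le,
    show t - 1 = t - (N : ℝ) / 2 - 1 + (N : ℝ) / 2 by ring, Real.rpow_add hs]
  ring

theorem integrable_heatWeight (N : ℕ) {t : ℝ} (ht : 0 < t) :
    Integrable (fun z : ℝ × Sp N => heatWeight N t z.1 z.2)
      ((volume.restrict (Ioi 0)).prod volume) := by
  rw [integrable_prod_iff (measurable_heatWeight N t).aestronglyMeasurable]
  constructor
  · filter_upwards [ae_restrict_mem measurableSet_Ioi] with s hs
    exact (integrable_gaussian_heat N hs).const_mul _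
  · have h := (Real.GammaIntegral_convergent ht).const_mul ((4 * Real.pi) ^ ((N : ℝ) / 2))
    refine h.congr ?_
    filter_upwards [ae_restrict_mem measurableSet_Ioi] with s hs
    simp_rw [Real.norm_of_nonneg (heatWeight_nonneg N t hs _)]
    unfold heatWeight
    rw [integral_const_mul, integral_gaussian_heat N hs, heatWeight_rpow_mul N t hs]

theorem integrable_kernelH (N : ℕ) {t : ℝ} (ht : 0 < t) : Integrable (kernelH N t) :=
  (integrable_heatWeight N ht).integral_prod_right.const_mul _

theorem fourier_gaussian_heat (N : ℕ) {s : ℝ} (hs : 0 < s) (ξ : Sp N) :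
    𝓕 (fun x : Sp N => ((Real.exp (-‖x‖ ^ 2 / (4 * s)) : ℝ) : ℂ)) ξ =
      (((4 * Real.pi * s) ^ ((N : ℝ) / 2) * Real.exp (-(2 * Real.pi * ‖ξ‖) ^ 2 * s) : ℝ) : ℂ) := by
  have hb : (1 / (4 * s) : ℂ) = ((1 / (4 * s) : ℝ) : ℂ) := by push_cast; ring
  have h := fourier_gaussian_innerProductSpace (V := Sp N) (b := (1 / (4 * s) : ℂ))
    (by rw [hb, Complex.ofReal_re]; positivity) ξ
  rw [finrank_euclideanSpace_fin] at h
  have hsc : (s : ℂ) ≠ 0 := by exact_mod_cast hs.ne'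
  convert h using 1
  · refine congrArg (fun g : Sp N → ℂ => 𝓕 g ξ) (funext fun x => ?_)
    push_cast
    congr 1; field_simp
  · push_cast
    rw [Complex.ofReal_cpow (by have := Real.pi_pos; positivity)]
    push_cast
    congr 2
    · field_simp
    · field_simp; ring

/-- The Fourier transform of `H_t` is `e^{-t log(1+|ξ|²)}`. -/
theorem fourier_kernelH (N : ℕ) {t : ℝ} (ht : 0 < t) (ξ : Sp N) :
    𝓕 (fun x : Sp N => (kernelH N t x : ℂ)) ξ = ((Real.exp (-t * logSymbol N ξ) : ℝ) : ℂ) := by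
  set c := 1 / ((4 * Real.pi) ^ ((N : ℝ) / 2) * Real.Gamma t) with hc
  set r := 1 + (2 * Real.pi * ‖ξ‖) ^ 2 with hr
  have hr0 : 0 < r := by positivity
  have hG := Real.Gamma_pos_of_pos ht
  have hpi := Real.pi_pos
  have hint : Integrable (Function.uncurry fun (x : Sp N) (s : ℝ) =>
      Complex.exp (↑(-2 * Real.pi * inner ℝ x ξ) * Complex.I) * (heatWeight N t s x : ℂ))
      (volume.prod (volume.restrict (Ioi 0))) := by
    have h1 : Integrable (fun z : Sp N × ℝ => (heatWeight N t z.2 z.1 : ℂ))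
        (volume.prod (volume.restrict (Ioi 0))) := (integrable_heatWeight N ht).swap.ofReal
    refine h1.bdd_mul (c := 1) (Continuous.aestronglyMeasurable (by fun_prop))
      (ae_of_all _ fun z => ?_)
    rw [Complex.norm_exp_ofReal_mul_I]
  rw [Real.fourier_eq']
  calc ∫ x, Complex.exp (↑(-2 * Real.pi * inner ℝ x ξ) * Complex.I) • (kernelH N t x : ℂ)
      = ∫ x, (c : ℂ) * ∫ s in Ioi (0 : ℝ), Complex.exp (↑(-2 * Real.pi * inner ℝ x ξ) * Complex.I) *
          (heatWeight N t s x : ℂ) := by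
        refine integral_congr_ae (ae_of_all _ fun x => ?_)
        simp only
        rw [kernelH_eq, ← hc, integral_const_mul, integral_complex_ofReal, smul_eq_mul]
        push_cast
        ring
    _ = (c : ℂ) * ∫ s in Ioi (0 : ℝ), ∫ x : Sp N,
          Complex.exp (↑(-2 * Real.pi * inner ℝ x ξ) * Complex.I) * (heatWeight N t s x : ℂ) := by
        rw [integral_const_mul, integral_integral_swap hint]
    _ = (c : ℂ) * ∫ s in Ioi (0 : ℝ),
          (((4 * Real.pi) ^ ((N : ℝ) / 2) * (s ^ (t - 1) * Real.exp (-(r * s))) : ℝ) : ℂ) := by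
        congr 1
        refine setIntegral_congr_fun measurableSet_Ioi fun s hs => ?_
        have h1 := fourier_gaussian_heat N hs ξ
        rw [Real.fourier_eq'] at h1
        calc ∫ x : Sp N, Complex.exp (↑(-2 * Real.pi * inner ℝ x ξ) * Complex.I) *
              (heatWeight N t s x : ℂ)
            = ∫ x : Sp N, ((s ^ (t - (N : ℝ) / 2 - 1) * Real.exp (-s) : ℝ) : ℂ) *
              (Complex.exp (↑(-2 * Real.pi * inner ℝ x ξ) * Complex.I) •
                ((Real.exp (-‖x‖ ^ 2 / (4 * s)) : ℝ) : ℂ)) := by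
              refine integral_congr_ae (ae_of_all _ fun x => ?_)
              simp only [heatWeight, smul_eq_mul]
              push_cast; ring
          _ = _ := by
              rw [integral_const_mul, h1, ← Complex.ofReal_mul]
              congr 1
              rw [← mul_assoc, heatWeight_rpow_mul N t hs, hr, add_mul, neg_add, Real.exp_add]
              ring_nf
    -- What remains is `∫ s ^ (t-1) e^{-rs} ds = Γ(t) r ^ (-t)`, where the term `1` in `r` comes
    -- from `e^{-s}` and the rest from the Gaussian's transform.
    _ = _ := by
        rw [integral_complex_ofReal, integral_const_mul,
          Real.integral_rpow_mul_exp_neg_mul_Ioi ht hr0,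
          ← Complex.ofReal_mul]
        congr 1
        rw [logSymbol, ← hr, neg_mul, mul_comm t, ← mul_neg, ← Real.rpow_def_of_pos hr0,
          one_div, Real.inv_rpow hr0.le, Real.rpow_neg hr0.le, hc]
        have : (4 * Real.pi) ^ ((N : ℝ) / 2) ≠ 0 := by positivity
        field_simp

theorem integral_kernelH (N : ℕ) {t : ℝ} (ht : 0 < t) : ∫ x, kernelH N t x = 1 := by
  have h := fourier_kernelH N ht 0
  rw [Real.fourier_eq'] at h
  simp only [inner_zero_right, mul_zero, Complex.ofReal_zero, zero_mul, Complex.exp_zero,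
    one_smul, logSymbol, norm_zero, ne_eq, OfNat.ofNat_ne_zero, not_false_eq_true, zero_pow,
    add_zero, Real.log_one, Real.exp_zero, integral_complex_ofReal] at h
  exact_mod_cast h

theorem lintegral_kernelH (N : ℕ) {t : ℝ} (ht : 0 < t) :
    ∫⁻ x, ENNReal.ofReal (kernelH N t x) = 1 := by
  rw [← ofReal_integral_eq_lintegral_ofReal (integrable_kernelH N ht)
    (ae_of_all _ (kernelH_nonneg ht)), integral_kernelH N ht, ENNReal.ofReal_one]

/-- Raise `y / γ ≤ exp (y / γ)` to the power `γ`. It trades Gaussian decay for a power of `‖x‖` of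
any chosen order. -/
theorem exp_neg_le_rpow {γ y : ℝ} (hγ : 0 < γ) (hy : 0 < y) :
    Real.exp (-y) ≤ γ ^ γ * y ^ (-γ) := by
  have h1 : y / γ ≤ Real.exp (y / γ) := by linarith [Real.add_one_le_exp (y / γ)]
  have h2 : (y / γ) ^ γ ≤ Real.exp y := by
    calc (y / γ) ^ γ ≤ Real.exp (y / γ) ^ γ := by gcongr
      _ = Real.exp y := by rw [← Real.exp_mul, div_mul_cancel₀ _ hγ.ne']
  rw [Real.exp_neg, Real.rpow_neg hy.le, ← div_eq_mul_inv, ← inv_div, ← Real.div_rpow hy.le hγ.le]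
  gcongr

theorem exp_neg_sq_div_le {N : ℕ} {γ s : ℝ} (hγ : 0 < γ) (hs : 0 < s) {x : Sp N} (hx : x ≠ 0) :
    Real.exp (-‖x‖ ^ 2 / (4 * s)) ≤ (4 * γ) ^ γ * ‖x‖ ^ (-(2 * γ)) * s ^ γ := by
  have hx0 : 0 < ‖x‖ := norm_pos_iff.2 hx
  rw [neg_div]
  refine (exp_neg_le_rpow hγ (show 0 < ‖x‖ ^ 2 / (4 * s) by positivity)).trans_eq ?_
  rw [Real.rpow_neg (by positivity), ← Real.inv_rpow (by positivity), inv_div,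
    Real.div_rpow (by positivity) (by positivity), Real.mul_rpow (by norm_num) hs.le,
    Real.mul_rpow (by norm_num) hγ.le, ← Real.rpow_natCast, ← Real.rpow_mul hx0.le,
    Real.rpow_neg hx0.le]
  push_cast
  field_simp

theorem heatWeight_le {N : ℕ} {t γ s : ℝ} (hγ : 0 < γ) (hs : 0 < s) {x : Sp N} (hx : x ≠ 0) :
    heatWeight N t s x ≤ (4 * γ) ^ γ * ‖x‖ ^ (-(2 * γ)) *
      (Real.exp (-s) * s ^ (t - (N : ℝ) / 2 + γ - 1)) := by
  unfold heatWeight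
  calc _ ≤ s ^ (t - (N : ℝ) / 2 - 1) * Real.exp (-s) *
        ((4 * γ) ^ γ * ‖x‖ ^ (-(2 * γ)) * s ^ γ) := by
        gcongr
        exact exp_neg_sq_div_le hγ hs hx
    _ = _ := by
        rw [show t - (N : ℝ) / 2 + γ - 1 = (t - (N : ℝ) / 2 - 1) + γ by ring, Real.rpow_add hs]
        ring

theorem integrableOn_heatWeight {N : ℕ} (hN : 0 < N) {t : ℝ} (ht : 0 < t) {x : Sp N} (hx : x ≠ 0) :
    IntegrableOn (fun s => heatWeight N t s x) (Ioi 0) := by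
  have hN' : (0 : ℝ) < N := by exact_mod_cast hN
  have h := (Real.GammaIntegral_convergent ht).const_mul
    ((4 * ((N : ℝ) / 2)) ^ ((N : ℝ) / 2) * ‖x‖ ^ (-(2 * ((N : ℝ) / 2))))
  refine h.mono' ?_ ?_
  · exact ((measurable_heatWeight N t).comp
      (by fun_prop : Measurable fun s => (s, x))).aestronglyMeasurable
  · filter_upwards [ae_restrict_mem measurableSet_Ioi] with s hs
    rw [Real.norm_of_nonneg (heatWeight_nonneg N t hs _)]
    have := heatWeight_le (N := N) (t := t) (γ := (N : ℝ) / 2) (by positivity) hs hx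
    rwa [sub_add_cancel] at this

theorem ofReal_integral_le_lintegral {α : Type*} [MeasurableSpace α] {μ : Measure α} {f : α → ℝ}
    (hf : 0 ≤ᵐ[μ] f) : ENNReal.ofReal (∫ x, f x ∂μ) ≤ ∫⁻ x, ENNReal.ofReal (f x) ∂μ := by
  by_cases h : Integrable f μ
  · exact (ofReal_integral_eq_lintegral_ofReal h hf).le
  · simp [integral_undef h]

/-- Only an inequality, so that no convergence is needed: the Bochner integral in `kernelH` is `0`
where it diverges, as can happen at the origin. -/
theorem ofReal_kernelH_le {N : ℕ} {t : ℝ} (ht : 0 < t) (x : Sp N) :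
    ENNReal.ofReal (kernelH N t x) ≤
      ENNReal.ofReal (1 / ((4 * Real.pi) ^ ((N : ℝ) / 2) * Real.Gamma t)) *
        ∫⁻ s in Ioi (0 : ℝ), ENNReal.ofReal (heatWeight N t s x) := by
  rw [kernelH_eq, ENNReal.ofReal_mul (kernelH_const_pos N ht).le]
  gcongr
  refine ofReal_integral_le_lintegral ?_
  filter_upwards [ae_restrict_mem measurableSet_Ioi] with s hs using heatWeight_nonneg N t hs x

theorem lintegral_exp_neg_mul_rpow_lt_top {a : ℝ} (ha : 0 < a) :
    ∫⁻ s in Ioi (0 : ℝ), ENNReal.ofReal (Real.exp (-s) * s ^ (a - 1)) < ⊤ :=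
  (Real.GammaIntegral_convergent ha).lintegral_lt_top

/-- `H_t` is dominated by the Riesz kernels of order `α ≤ 2t`, `0 < α < N`. -/
theorem exists_kernelH_le_riesz {N : ℕ} {t α : ℝ} (hα : 0 < α) (hα' : α ≤ 2 * t)
    (hαN : α < N) : ∃ C : ℝ≥0∞, C ≠ ⊤ ∧ ∀ x : Sp N, x ≠ 0 →
      ENNReal.ofReal (kernelH N t x) ≤ C * ENNReal.ofReal (‖x‖ ^ (α - N)) := by
  have ht : 0 < t := by linarith
  have hN' : (0 : ℝ) < N := hα.trans hαN
  suffices h : ∃ C : ℝ≥0∞, C ≠ ⊤ ∧ ∀ x : Sp N, x ≠ 0 →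
      ∫⁻ s in Ioi (0 : ℝ), ENNReal.ofReal (heatWeight N t s x) ≤
        C * ENNReal.ofReal (‖x‖ ^ (α - N)) by
    obtain ⟨C, hC, h⟩ := h
    refine ⟨ENNReal.ofReal (1 / ((4 * Real.pi) ^ ((N : ℝ) / 2) * Real.Gamma t)) * C,
      ENNReal.mul_ne_top ENNReal.ofReal_ne_top hC, fun x hx =>
      (ofReal_kernelH_le ht x).trans ?_⟩
    rw [mul_assoc]
    gcongr
    exact h x hx
  rcases lt_or_eq_of_le hα' with hlt | heq
  -- Chosen so that `2γ = N - α`. The remaining integral over `s` is then `Γ(t - α/2)`, finite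
  -- because `α < 2t`.
  · set γ := ((N : ℝ) - α) / 2 with hγ
    have hγ0 : 0 < γ := by simp only [hγ]; linarith
    refine ⟨ENNReal.ofReal ((4 * γ) ^ γ) *
      ∫⁻ s in Ioi (0 : ℝ), ENNReal.ofReal (Real.exp (-s) * s ^ (t - (N : ℝ) / 2 + γ - 1)),
      ENNReal.mul_ne_top ENNReal.ofReal_ne_top (lintegral_exp_neg_mul_rpow_lt_top
        (by simp only [hγ]; linarith)).ne, fun x hx => ?_⟩
    calc _ ≤ ∫⁻ s in Ioi (0 : ℝ), ENNReal.ofReal ((4 * γ) ^ γ * ‖x‖ ^ (-(2 * γ))) *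
          ENNReal.ofReal (Real.exp (-s) * s ^ (t - (N : ℝ) / 2 + γ - 1)) := by
          refine setLIntegral_mono' measurableSet_Ioi fun s hs => ?_
          rw [← ENNReal.ofReal_mul (by positivity)]
          exact ENNReal.ofReal_le_ofReal (heatWeight_le hγ0 hs hx)
      _ = _ := by
          rw [lintegral_const_mul' _ _ ENNReal.ofReal_ne_top, ENNReal.ofReal_mul (by positivity),
            show -(2 * γ) = α - N by simp only [hγ]; ring]
          ring
  -- At the endpoint `α = 2t` that Gamma integral diverges. The integral is cut at `s = ‖x‖²`
  -- instead: below, the choice `γ = N/2` leaves `s ^ (t-1)`; above, both exponentials are bounded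
  -- by `1` and `t < N/2` gives convergence.
  · set K := (4 * ((N : ℝ) / 2)) ^ ((N : ℝ) / 2)
    refine ⟨ENNReal.ofReal (K / t) + ENNReal.ofReal (1 / ((N : ℝ) / 2 - t)),
      ENNReal.add_ne_top.2 ⟨ENNReal.ofReal_ne_top, ENNReal.ofReal_ne_top⟩, fun x hx => ?_⟩
    have hx0 : 0 < ‖x‖ := norm_pos_iff.2 hx
    have hx2 : 0 < ‖x‖ ^ 2 := by positivity
    rw [← Ioc_union_Ioi_eq_Ioi hx2.le,
      lintegral_union measurableSet_Ioi (Ioc_disjoint_Ioi le_rfl), add_mul]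
    refine add_le_add ?_ ?_
    · calc _ ≤ ∫⁻ s in Ioc 0 (‖x‖ ^ 2), ENNReal.ofReal (K * ‖x‖ ^ (-(N : ℝ))) *
            ENNReal.ofReal (s ^ (t - 1)) := by
            refine setLIntegral_mono' measurableSet_Ioc fun s hs => ?_
            have hs0 := hs.1
            rw [← ENNReal.ofReal_mul (by positivity)]
            refine ENNReal.ofReal_le_ofReal
              ((heatWeight_le (γ := (N : ℝ) / 2) (by positivity) hs.1 hx).trans ?_)
            rw [sub_add_cancel, show -(2 * ((N : ℝ) / 2)) = -(N : ℝ) by ring]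
            gcongr
            have : Real.exp (-s) ≤ 1 := Real.exp_le_one_iff.2 (by linarith)
            exact mul_le_of_le_one_left (by positivity) this
        _ = _ := by
            rw [lintegral_const_mul' _ _ ENNReal.ofReal_ne_top, lintegral_Ioc_rpow ht hx2,
              ← ENNReal.ofReal_mul (by positivity), ← ENNReal.ofReal_mul (by positivity)]
            congr 1
            rw [← Real.rpow_natCast, ← Real.rpow_mul hx0.le, sub_eq_add_neg α,
              Real.rpow_add hx0, heq]
            push_cast
            ring
    · calc _ ≤ ∫⁻ s in Ioi (‖x‖ ^ 2), ENNReal.ofReal (s ^ (t - (N : ℝ) / 2 - 1)) := by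
            refine setLIntegral_mono' measurableSet_Ioi fun s (hs : _ < s) => ?_
            have hs0 : 0 < s := hx2.trans hs
            refine ENNReal.ofReal_le_ofReal ?_
            unfold heatWeight
            have h1 : Real.exp (-s) ≤ 1 := Real.exp_le_one_iff.2 (by linarith)
            have h2 : Real.exp (-‖x‖ ^ 2 / (4 * s)) ≤ 1 :=
              Real.exp_le_one_iff.2 (div_nonpos_of_nonpos_of_nonneg (by linarith) (by linarith))
            rw [mul_assoc]
            exact mul_le_of_le_one_right (by positivity)
              (mul_le_one₀ h1 (Real.exp_pos _).le h2)
        _ = _ := by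
            have : (0 : ℝ) < (N : ℝ) / 2 - t := by linarith
            rw [lintegral_Ioi_rpow (by linarith) hx2, ← ENNReal.ofReal_mul (by positivity)]
            congr 1
            rw [← Real.rpow_natCast, ← Real.rpow_mul hx0.le, heq]
            push_cast
            rw [show 2 * (t - (N : ℝ) / 2) = 2 * t - N by ring, neg_sub]
            ring

/-- Near the origin `H_t` is bounded below by the Riesz kernel of order `2t < N`. -/
theorem exists_riesz_le_kernelH {N : ℕ} {t : ℝ} (ht : 0 < t) (htN : 2 * t < N) :
    ∃ c : ℝ, 0 < c ∧ ∀ x : Sp N, x ≠ 0 → ‖x‖ ≤ 1 → c * ‖x‖ ^ (2 * t - N) ≤ kernelH N t x := by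
  have hN : 0 < N := by
    rcases Nat.eq_zero_or_pos N with h | h
    · subst h; norm_num at htN; linarith
    · exact h
  have hc := kernelH_const_pos N ht
  set c := 1 / ((4 * Real.pi) ^ ((N : ℝ) / 2) * Real.Gamma t) with hcdef
  set κ : ℝ := 2 ^ (t - (N : ℝ) / 2 - 1) * Real.exp (-2) * Real.exp (-(1 / 4))
  refine ⟨c * κ, by positivity, fun x hx hx1 => ?_⟩
  have hx0 : 0 < ‖x‖ := norm_pos_iff.2 hx
  set R := ‖x‖ ^ 2 with hR
  have hR0 : 0 < R := by positivity
  have hR1 : R ≤ 1 := by simp only [hR]; nlinarith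
  have hint := integrableOn_heatWeight hN ht hx
  -- The window `s ∼ ‖x‖²` already gives the right size. In `κ`, `exp (-2)` comes from `s ≤ 2R ≤ 2`
  -- and `exp (-1/4)` from `R ≤ s`.
  have h1 : κ * R ^ (t - (N : ℝ) / 2 - 1) * R ≤ ∫ s in Ioc R (2 * R), heatWeight N t s x := by
    have hvol : volume.real (Ioc R (2 * R)) = R := by
      rw [Real.volume_real_Ioc_of_le (by linarith)]; ring
    have h := setIntegral_ge_of_const_le_real (μ := volume) (s := Ioc R (2 * R))
      (f := fun s => heatWeight N t s x) (c := κ * R ^ (t - (N : ℝ) / 2 - 1)) measurableSet_Ioc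
      (by simp) (fun s hs => ?_) (hint.mono_set fun s hs => hR0.trans hs.1)
    · rwa [hvol] at h
    · have hs0 : 0 < s := hR0.trans hs.1
      unfold heatWeight
      have e1 : (2 * R) ^ (t - (N : ℝ) / 2 - 1) ≤ s ^ (t - (N : ℝ) / 2 - 1) :=
        Real.rpow_le_rpow_of_nonpos hs0 hs.2 (by linarith)
      have e2 : Real.exp (-2) ≤ Real.exp (-s) := Real.exp_le_exp.2 (by linarith [hs.2])
      have e3 : Real.exp (-(1 / 4)) ≤ Real.exp (-‖x‖ ^ 2 / (4 * s)) := by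
        refine Real.exp_le_exp.2 ?_
        rw [neg_div, neg_le_neg_iff, div_le_div_iff₀ (by positivity) (by norm_num), ← hR]
        linarith [hs.1]
      rw [Real.mul_rpow (by norm_num) hR0.le] at e1
      calc _ = 2 ^ (t - (N : ℝ) / 2 - 1) * R ^ (t - (N : ℝ) / 2 - 1) * Real.exp (-2) *
            Real.exp (-(1 / 4)) := by simp only [κ]; ring
        _ ≤ _ := by gcongr
  have h2 : ∫ s in Ioc R (2 * R), heatWeight N t s x ≤ ∫ s in Ioi (0 : ℝ), heatWeight N t s x :=
    setIntegral_mono_set hint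
      (by filter_upwards [ae_restrict_mem measurableSet_Ioi] with s hs
          using heatWeight_nonneg N t hs x)
      (LE.le.eventuallyLE fun s hs => hR0.trans hs.1)
  have h3 : R ^ (t - (N : ℝ) / 2 - 1) * R = ‖x‖ ^ (2 * t - N) := by
    nth_rewrite 2 [← Real.rpow_one R]
    rw [← Real.rpow_add hR0, hR, ← Real.rpow_natCast, ← Real.rpow_mul hx0.le]
    congr 1; push_cast; ring
  rw [kernelH_eq, ← hcdef, mul_assoc]
  gcongr
  rw [← h3, ← mul_assoc]
  exact h1.trans h2

/-- Convolution with `H_t` maps `L^p` into `L^∞` for `t > N/(2p)`. -/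
theorem exists_lintegral_kernelH_mul_le {N : ℕ} {t p : ℝ} (hp : 1 < p) (ht : N / (2 * p) < t) :
    ∃ C : ℝ≥0∞, C ≠ ⊤ ∧ ∀ (f : Sp N → ℝ≥0∞), Measurable f → ∀ x,
      ∫⁻ y, ENNReal.ofReal (kernelH N t y) * f (x - y) ≤ C * (∫⁻ y, f y ^ p) ^ (1 / p) := by
  have hp0 : 0 < p := by linarith
  have ht0 : 0 < t := lt_of_le_of_lt (by positivity) ht
  have hpi := Real.pi_pos
  have hpq := Real.HolderConjugate.conjExponent hp
  set q := p.conjExponent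
  have hq0 : 0 < q := hpq.symm.pos
  have hq1 : 1 ≤ q := hpq.symm.lt.le
  have hqp : 1 / q = 1 - 1 / p := by simpa using hpq.one_sub_inv.symm
  -- After Hölder on each Gaussian, the integrand in `s` is a multiple of `e^{-s} s ^ (a-1)`; it is
  -- integrable exactly because `a > 0`.
  set a := t - N / (2 * p)
  have ha : 0 < a := by simp only [a]; linarith
  set c := ENNReal.ofReal (1 / ((4 * Real.pi) ^ ((N : ℝ) / 2) * Real.Gamma t))
  set K := ENNReal.ofReal ((4 * Real.pi) ^ ((N : ℝ) / 2 * (1 / q)))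
  set G := ∫⁻ s in Ioi (0 : ℝ), ENNReal.ofReal (Real.exp (-s) * s ^ (a - 1))
  have hG : G ≠ ⊤ := (lintegral_exp_neg_mul_rpow_lt_top ha).ne
  refine ⟨c * (K * G), ENNReal.mul_ne_top ENNReal.ofReal_ne_top
    (ENNReal.mul_ne_top ENNReal.ofReal_ne_top hG), fun f hf x => ?_⟩
  set A := (∫⁻ y, f y ^ p) ^ (1 / p)
  have hA : (∫⁻ y, f (x - y) ^ p) ^ (1 / p) = A := by
    rw [lintegral_sub_left_eq_self (fun y => f y ^ p) x]
  have hgauss : ∀ s ∈ Ioi (0 : ℝ), ∫⁻ y : Sp N, ENNReal.ofReal (Real.exp (-‖y‖ ^ 2 / (4 * s))) *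
      f (x - y) ≤ ENNReal.ofReal ((4 * Real.pi * s) ^ ((N : ℝ) / 2 * (1 / q))) * A := by
    intro s hs
    have hs : 0 < s := hs
    have h := ENNReal.lintegral_mul_le_Lp_mul_Lq volume hpq.symm
      (f := fun y : Sp N => ENNReal.ofReal (Real.exp (-‖y‖ ^ 2 / (4 * s))))
      (g := fun y => f (x - y)) (by fun_prop) (by fun_prop)
    rw [hA] at h
    refine h.trans ?_
    gcongr
    rw [Real.rpow_mul (by positivity), ← ENNReal.ofReal_rpow_of_nonneg (by positivity)
      (by positivity)]
    gcongr
    -- The Gaussian is at most `1` and `q ≥ 1`, so its `q`-th power is bounded by itself; the sharp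
    -- constant is not needed.
    calc _ ≤ ∫⁻ y : Sp N, ENNReal.ofReal (Real.exp (-‖y‖ ^ 2 / (4 * s))) := by
          refine lintegral_mono fun y => ?_
          have h1 : ENNReal.ofReal (Real.exp (-‖y‖ ^ 2 / (4 * s))) ≤ 1 := by
            rw [ENNReal.ofReal_le_one, Real.exp_le_one_iff]
            exact div_nonpos_of_nonpos_of_nonneg (by nlinarith [sq_nonneg ‖y‖]) (by linarith)
          exact ENNReal.rpow_le_self_of_le_one h1 hq1
      _ = _ := by
          rw [← ofReal_integral_eq_lintegral_ofReal (integrable_gaussian_heat N hs)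
            (ae_of_all _ fun y => (Real.exp_pos _).le), integral_gaussian_heat N hs]
  calc _ ≤ ∫⁻ y : Sp N, (c * ∫⁻ s in Ioi (0 : ℝ), ENNReal.ofReal (heatWeight N t s y)) *
        f (x - y) := by
        gcongr with y
        exact ofReal_kernelH_le ht0 y
    _ = c * ∫⁻ y : Sp N, ∫⁻ s in Ioi (0 : ℝ), ENNReal.ofReal (heatWeight N t s y) *
        f (x - y) := by
        rw [← lintegral_const_mul' _ _ ENNReal.ofReal_ne_top]
        refine lintegral_congr fun y => ?_
        rw [lintegral_mul_const, mul_assoc]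
        exact ((measurable_heatWeight N t).comp
          (by fun_prop : Measurable fun s => (s, y))).ennreal_ofReal
    _ = c * ∫⁻ s in Ioi (0 : ℝ), ∫⁻ y : Sp N, ENNReal.ofReal (heatWeight N t s y) *
        f (x - y) := by
        congr 1
        refine lintegral_lintegral_swap (Measurable.aemeasurable ?_)
        exact ((measurable_heatWeight N t).comp measurable_swap).ennreal_ofReal.mul
          (hf.comp (by fun_prop))
    _ ≤ c * ∫⁻ s in Ioi (0 : ℝ), K * ENNReal.ofReal (Real.exp (-s) * s ^ (a - 1)) * A := by
        gcongr c * ?_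
        refine setLIntegral_mono' measurableSet_Ioi fun s hs => ?_
        have hs0 : 0 < s := hs
        calc _ = ENNReal.ofReal (s ^ (t - (N : ℝ) / 2 - 1) * Real.exp (-s)) *
              ∫⁻ y : Sp N, ENNReal.ofReal (Real.exp (-‖y‖ ^ 2 / (4 * s))) * f (x - y) := by
              rw [← lintegral_const_mul' _ _ ENNReal.ofReal_ne_top]
              refine lintegral_congr fun y => ?_
              rw [heatWeight, ENNReal.ofReal_mul (by positivity), mul_assoc]
          _ ≤ ENNReal.ofReal (s ^ (t - (N : ℝ) / 2 - 1) * Real.exp (-s)) *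
              (ENNReal.ofReal ((4 * Real.pi * s) ^ ((N : ℝ) / 2 * (1 / q))) * A) := by
              gcongr; exact hgauss s hs
          _ = _ := by
              rw [← mul_assoc]
              congr 1
              rw [← ENNReal.ofReal_mul (by positivity), ← ENNReal.ofReal_mul (by positivity),
                Real.mul_rpow (by positivity) hs0.le, hqp,
                show a - 1 = (t - (N : ℝ) / 2 - 1) + (N : ℝ) / 2 * (1 - 1 / p) by
                  simp only [a]; field_simp; ring, Real.rpow_add hs0]
              congr 1; ring
    _ = _ := by
        rw [lintegral_mul_const _ (by fun_prop), lintegral_const_mul' _ _ ENNReal.ofReal_ne_top]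
        ring

end Kernel

/-! ### Convolution with `H_t` as the operator `(I - Δ)^{-t}` on `L^p` -/

section Operator

theorem besselSymbol_neg_eq (N : ℕ) (t : ℝ) (ξ : Sp N) :
    besselSymbol N (-(2 * t)) ξ = ((Real.exp (-t * logSymbol N ξ) : ℝ) : ℂ) := by
  rw [besselSymbol, logSymbol, Real.rpow_def_of_pos (by positivity)]
  congr 2
  ring

/-- A Fourier multiplier whose symbol is the Fourier transform of an integrable `K` acts on Schwartz
functions as the convolution with `K`. -/
theorem fourierMultiplierCLM_apply_eq_integral {E : Type*} [NormedAddCommGroup E]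
    [InnerProductSpace ℝ E] [FiniteDimensional ℝ E] [MeasurableSpace E] [BorelSpace E]
    {K m : E → ℂ} (hK : Integrable K) (hm : m.HasTemperateGrowth) (hKm : 𝓕 K = m)
    (ψ : 𝓢(E, ℂ)) (x : E) :
    SchwartzMap.fourierMultiplierCLM ℂ m ψ x = ∫ y, K y * ψ (x - y) := by
  set g : E → ℂ := fun ξ => Complex.exp (↑(2 * Real.pi * inner ℝ ξ x) * Complex.I) * 𝓕 ψ ξ with hg
  have hgint : Integrable g := by
    refine (𝓕 ψ).integrable.bdd_mul (c := 1) (Continuous.aestronglyMeasurable (by fun_prop))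
      (ae_of_all _ fun ξ => ?_)
    rw [Complex.norm_exp_ofReal_mul_I]
  have h1 : SchwartzMap.fourierMultiplierCLM ℂ m ψ x = ∫ ξ, 𝓕 K ξ • g ξ := by
    rw [SchwartzMap.fourierMultiplierCLM_apply, SchwartzMap.fourierInv_coe, Real.fourierInv_eq']
    refine integral_congr_ae (ae_of_all _ fun ξ => ?_)
    simp only [hg, SchwartzMap.smulLeftCLM_apply_apply hm, smul_eq_mul, hKm]
    ring
  -- The multiplication formula moves the transform from `K` to the modulated function `g`, and the
  -- modulation becomes the translation by `x`.
  have h2 : ∫ ξ, 𝓕 K ξ • g ξ = ∫ y, K y • 𝓕 g y :=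
    VectorFourier.integral_fourierIntegral_smul_eq_flip (L := innerₗ E)
      Real.continuous_fourierChar continuous_inner hK hgint |>.trans (by
        rw [flip_innerₗ]; rfl)
  have h3 : ∀ y, 𝓕 g y = ψ (x - y) := by
    intro y
    have h4 : 𝓕⁻ (𝓕 ψ) (x - y) = ψ (x - y) := by simp
    rw [← h4, SchwartzMap.fourierInv_coe, Real.fourierInv_eq', Real.fourier_eq']
    refine integral_congr_ae (ae_of_all _ fun ξ => ?_)
    simp only [hg, smul_eq_mul, ← mul_assoc]
    rw [← Complex.exp_add, inner_sub_right]
    congr 2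
    push_cast
    ring
  rw [h1, h2]
  simp_rw [h3, smul_eq_mul]

variable {N : ℕ}

/-- The convolution `H_t * f`. -/
def heatConv (N : ℕ) (t : ℝ) (f : Sp N → ℂ) : Sp N → ℂ :=
  (kernelH N t) ⋆[ContinuousLinearMap.lsmul ℝ ℝ, volume] f

theorem heatConv_apply (t : ℝ) (f : Sp N → ℂ) (x : Sp N) :
    heatConv N t f x = ∫ y, (kernelH N t y : ℂ) * f (x - y) := by
  simp [heatConv, convolution_def]

theorem heatConv_congr {t : ℝ} {f g : Sp N → ℂ} (h : f =ᵐ[volume] g) :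
    heatConv N t f = heatConv N t g :=
  convolution_congr _ (ae_eq_refl _) h

/-- On Schwartz functions the convolution with `H_t` is the multiplier with symbol
`(1+|ξ|²)^{-t}`. -/
theorem fourierMultiplierCLM_besselSymbol_apply {t : ℝ} (ht : 0 < t) (ψ : 𝓢(Sp N, ℂ)) (x : Sp N) :
    SchwartzMap.fourierMultiplierCLM ℂ (besselSymbol N (-(2 * t))) ψ x = heatConv N t ψ x := by
  rw [heatConv_apply]
  refine fourierMultiplierCLM_apply_eq_integral (integrable_kernelH N ht).ofReal
    (besselSymbol_hasTemperateGrowth N _) (funext fun ξ => ?_) ψ x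
  rw [besselSymbol_neg_eq, ← fourier_kernelH N ht]
  rfl

/-- The convolution of `H_t` and `|f|`. -/
def absHeatConv (N : ℕ) (t : ℝ) (f : Sp N → ℂ) (x : Sp N) : ℝ≥0∞ :=
  ∫⁻ y, ENNReal.ofReal (kernelH N t y) * ‖f (x - y)‖ₑ

theorem enorm_heatConv_le {t : ℝ} (ht : 0 < t) (f : Sp N → ℂ) (x : Sp N) :
    ‖heatConv N t f x‖ₑ ≤ absHeatConv N t f x := by
  rw [heatConv_apply]
  refine (enorm_integral_le_lintegral_enorm _).trans_eq (lintegral_congr fun y => ?_)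
  rw [enorm_mul, ← Complex.ofRealCLM_apply, ← ofReal_norm, Complex.ofRealCLM_apply,
    Complex.norm_of_nonneg (kernelH_nonneg ht y)]

theorem lintegral_absHeatConv_rpow_le {t : ℝ} (ht : 0 < t) {f : Sp N → ℂ} (hf : Measurable f)
    {r : ℝ} (hr : 1 < r) : ∫⁻ x, absHeatConv N t f x ^ r ≤ ∫⁻ x, ‖f x‖ₑ ^ r := by
  have h := lintegral_conv_rpow_le (μ := (volume : Measure (Sp N)))
    (measurable_kernelH N t).ennreal_ofReal hf.enorm hr
  rwa [lintegral_kernelH N ht, ENNReal.one_rpow, one_mul] at h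

theorem measurable_absHeatConv (t : ℝ) {f : Sp N → ℂ} (hf : Measurable f) :
    Measurable (absHeatConv N t f) := by
  have := measurable_kernelH N t
  refine Measurable.lintegral_prod_right' (f := fun z : Sp N × Sp N =>
    ENNReal.ofReal (kernelH N t z.2) * ‖f (z.1 - z.2)‖ₑ) ?_
  fun_prop

theorem stronglyMeasurable_heatConv (t : ℝ) {f : Sp N → ℂ} (hf : Measurable f) :
    StronglyMeasurable (heatConv N t f) := by
  have := measurable_kernelH N t
  have h : heatConv N t f = fun x => ∫ y, (kernelH N t y : ℂ) * f (x - y) :=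
    funext (heatConv_apply t f)
  rw [h]
  refine StronglyMeasurable.integral_prod_right' (f := fun z : Sp N × Sp N =>
    (kernelH N t z.2 : ℂ) * f (z.1 - z.2)) (Measurable.stronglyMeasurable ?_)
  fun_prop

variable {p : ℝ≥0∞}

theorem one_lt_toReal (hp1 : 1 < p) (hp : p < ⊤) : 1 < p.toReal := by
  rwa [← ENNReal.toReal_one, ENNReal.toReal_lt_toReal ENNReal.one_ne_top hp.ne]

theorem lintegral_rpow_enorm_lt_top (hp1 : 1 < p) (hp : p < ⊤) {f : Sp N → ℂ}
    (hf : MemLp f p volume) : ∫⁻ x, ‖f x‖ₑ ^ p.toReal < ⊤ :=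
  lintegral_rpow_enorm_lt_top_of_eLpNorm_lt_top (by positivity) hp.ne hf.eLpNorm_lt_top

theorem ae_convolutionExistsAt_kernelH (hp1 : 1 < p) (hp : p < ⊤) {t : ℝ} (ht : 0 < t)
    {f : Sp N → ℂ} (hfm : Measurable f) (hf : MemLp f p volume) :
    ∀ᵐ x, ConvolutionExistsAt (kernelH N t) f x (ContinuousLinearMap.lsmul ℝ ℝ) volume := by
  have hr := one_lt_toReal hp1 hp
  have hfin : ∫⁻ x, absHeatConv N t f x ^ p.toReal < ⊤ :=
    (lintegral_absHeatConv_rpow_le ht hfm hr).trans_lt (lintegral_rpow_enorm_lt_top hp1 hp hf)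
  have := measurable_kernelH N t
  filter_upwards [ae_lt_top ((measurable_absHeatConv t hfm).pow_const _) hfin.ne] with x hx
  have hx' : absHeatConv N t f x < ⊤ := by
    rwa [ENNReal.rpow_lt_top_iff_of_pos (by linarith)] at hx
  refine ⟨Measurable.aestronglyMeasurable ?_, ?_⟩
  · simp only [ContinuousLinearMap.lsmul_apply]
    fun_prop
  · refine lt_of_le_of_lt (lintegral_mono fun y => le_of_eq ?_) hx'
    simp only [ContinuousLinearMap.lsmul_apply]
    rw [enorm_smul, Real.enorm_of_nonneg (kernelH_nonneg ht y)]

theorem eLpNorm_heatConv_le (hp1 : 1 < p) (hp : p < ⊤) {t : ℝ} (ht : 0 < t)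
    {f : Sp N → ℂ} (hfm : Measurable f) :
    eLpNorm (heatConv N t f) p volume ≤ eLpNorm f p volume := by
  have hr := one_lt_toReal hp1 hp
  have h0 : p ≠ 0 := (zero_lt_one.trans hp1).ne'
  rw [eLpNorm_eq_lintegral_rpow_enorm_toReal h0 hp.ne,
    eLpNorm_eq_lintegral_rpow_enorm_toReal h0 hp.ne]
  gcongr ?_ ^ _
  refine (lintegral_mono fun x => ?_).trans (lintegral_absHeatConv_rpow_le ht hfm hr)
  gcongr
  exact enorm_heatConv_le ht f x

theorem memLp_heatConv (hp1 : 1 < p) (hp : p < ⊤) {t : ℝ} (ht : 0 < t)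
    {f : Sp N → ℂ} (hfm : Measurable f) (hf : MemLp f p volume) :
    MemLp (heatConv N t f) p volume :=
  ⟨(stronglyMeasurable_heatConv t hfm).aestronglyMeasurable,
    (eLpNorm_heatConv_le hp1 hp ht hfm).trans_lt hf.eLpNorm_lt_top⟩

theorem memLp_heatConv_Lp (hp1 : 1 < p) (hp : p < ⊤) {t : ℝ} (ht : 0 < t) (f : LpSp N p) :
    MemLp (heatConv N t f) p volume :=
  memLp_heatConv hp1 hp ht (Lp.stronglyMeasurable f).measurable (Lp.memLp f)

variable [Fact (1 ≤ p)]

/-- Young's inequality applied to differences; the convolution is additive at almost every point,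
where both integrals converge. The continuity lets identities pass from Schwartz functions to `L^p`.
-/
theorem lipschitzWith_heatConv (hp1 : 1 < p) (hp : p < ⊤) {t : ℝ} (ht : 0 < t) :
    LipschitzWith 1 fun f : LpSp N p => (memLp_heatConv_Lp hp1 hp ht f).toLp := by
  refine LipschitzWith.of_edist_le fun f g => ?_
  rw [Lp.edist_toLp_toLp, Lp.edist_def]
  have h1 : heatConv N t f - heatConv N t g =ᵐ[volume] heatConv N t (f - g : LpSp N p) := by
    filter_upwards [ae_convolutionExistsAt_kernelH hp1 hp ht
      (Lp.stronglyMeasurable f).measurable (Lp.memLp f), ae_convolutionExistsAt_kernelH hp1 hp ht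
      (Lp.stronglyMeasurable g).measurable (Lp.memLp g)] with x hf hg
    rw [heatConv_congr (Lp.coeFn_sub f g), Pi.sub_apply, heatConv_apply, heatConv_apply,
      heatConv_apply, ← integral_sub]
    · refine integral_congr_ae (ae_of_all _ fun y => ?_)
      simp [mul_sub]
    · simpa [ConvolutionExistsAt] using hf
    · simpa [ConvolutionExistsAt] using hg
  rw [eLpNorm_congr_ae h1, ← eLpNorm_congr_ae (Lp.coeFn_sub f g)]
  exact eLpNorm_heatConv_le hp1 hp ht (Lp.stronglyMeasurable _).measurable

/-- `H_t * f = (I - Δ)^{-t} f` for `f ∈ L^p`. -/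
theorem coe_toLp_heatConv (hp1 : 1 < p) (hp : p < ⊤) {t : ℝ} (ht : 0 < t) (f : LpSp N p) :
    ((memLp_heatConv_Lp hp1 hp ht f).toLp : 𝓢'(Sp N, ℂ)) =
      besselOp N (-(2 * t)) (f : 𝓢'(Sp N, ℂ)) := by
  have hc := (Lp.toTemperedDistributionCLM ℂ (volume : Measure (Sp N)) p).continuous
  have h1 : Continuous fun f : LpSp N p => Lp.toTemperedDistributionCLM ℂ volume p
      (memLp_heatConv_Lp hp1 hp ht f).toLp :=
    hc.comp (lipschitzWith_heatConv hp1 hp ht).continuous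
  have h2 : Continuous fun f : LpSp N p =>
      besselOp N (-(2 * t)) (Lp.toTemperedDistributionCLM ℂ volume p f) :=
    (besselOp N (-(2 * t))).continuous.comp hc
  have hd : DenseRange (SchwartzMap.toLpCLM ℝ ℂ p (volume : Measure (Sp N))) :=
    SchwartzMap.denseRange_toLpCLM hp.ne
  -- Both sides are continuous from `L^p` into tempered distributions, so comparing them on Schwartz
  -- functions suffices.
  refine congrFun (hd.equalizer h1 h2 (funext fun ψ => ?_)) f
  simp only [Function.comp_apply, SchwartzMap.toLpCLM_apply, Lp.toTemperedDistributionCLM_apply]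
  have h3 : (memLp_heatConv_Lp hp1 hp ht (ψ.toLp p)).toLp =
      (SchwartzMap.fourierMultiplierCLM ℂ (besselSymbol N (-(2 * t))) ψ).toLp p volume := by
    refine MemLp.toLp_congr _ _ (ae_of_all _ fun x => ?_)
    rw [fourierMultiplierCLM_besselSymbol_apply ht, heatConv_congr (ψ.coeFn_toLp p)]
  rw [h3, Lp.toTemperedDistribution_toLp_eq, Lp.toTemperedDistribution_toLp_eq, besselOp,
    TemperedDistribution.fourierMultiplierCLM_toTemperedDistributionCLM_eq
      (besselSymbol_hasTemperateGrowth N _)]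

theorem toTemperedDistribution_injective {f g : LpSp N p}
    (h : (f : 𝓢'(Sp N, ℂ)) = (g : 𝓢'(Sp N, ℂ))) : f = g :=
  LinearMap.ker_eq_bot.1 (Lp.ker_toTemperedDistributionCLM_eq_bot (F := ℂ)
    (μ := (volume : Measure (Sp N))) (p := p)) h

theorem besselOp_zero (u : 𝓢'(Sp N, ℂ)) : besselOp N 0 u = u := by
  have : besselSymbol N 0 = fun _ => 1 := by ext ξ; simp [besselSymbol]
  rw [besselOp, this, TemperedDistribution.fourierMultiplierCLM_const]
  simp

theorem besselOp_besselOp (σ τ : ℝ) (u : 𝓢'(Sp N, ℂ)) :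
    besselOp N σ (besselOp N τ u) = besselOp N (τ + σ) u := by
  rw [besselOp, besselOp, TemperedDistribution.fourierMultiplierCLM_fourierMultiplierCLM_apply
    (besselSymbol_hasTemperateGrowth N _) (besselSymbol_hasTemperateGrowth N _), besselOp]
  congr 2
  ext ξ
  simp only [besselSymbol, Pi.mul_apply]
  rw [← Complex.ofReal_mul, ← Real.rpow_add (by positivity)]
  congr 2; ring

/-- The semigroup `e^{-t log(I-Δ)} = (I-Δ)^{-t}` on `L^p`. -/
def logSemigroup (N : ℕ) {p : ℝ≥0∞} [Fact (1 ≤ p)] (t : ℝ) (f : LpSp N p) : LpSp N p :=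
  Classical.epsilon fun g : LpSp N p =>
    (g : 𝓢'(Sp N, ℂ)) = besselOp N (-(2 * t)) (f : 𝓢'(Sp N, ℂ))

/-- Since `L^p` embeds in the tempered distributions, the choice in `logSemigroup` has at most one
admissible value. Any function with the right distribution is that value, which covers `t = 0`
together with `t > 0`. -/
theorem logSemigroup_eq_of_coe_eq {t : ℝ} {f g : LpSp N p}
    (h : (g : 𝓢'(Sp N, ℂ)) = besselOp N (-(2 * t)) (f : 𝓢'(Sp N, ℂ))) :
    logSemigroup N t f = g := by
  refine toTemperedDistribution_injective (Eq.trans ?_ h.symm)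
  exact Classical.epsilon_spec (p := fun g : LpSp N p =>
    (g : 𝓢'(Sp N, ℂ)) = besselOp N (-(2 * t)) (f : 𝓢'(Sp N, ℂ))) ⟨g, h⟩

theorem logSemigroup_zero (f : LpSp N p) : logSemigroup N 0 f = f :=
  logSemigroup_eq_of_coe_eq (by rw [mul_zero, neg_zero, besselOp_zero])

theorem logSemigroup_eq_toLp (hp1 : 1 < p) (hp : p < ⊤) {t : ℝ} (ht : 0 < t) (f : LpSp N p) :
    logSemigroup N t f = (memLp_heatConv_Lp hp1 hp ht f).toLp :=
  logSemigroup_eq_of_coe_eq (coe_toLp_heatConv hp1 hp ht f)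

theorem coe_logSemigroup (hp1 : 1 < p) (hp : p < ⊤) {t : ℝ} (ht : 0 ≤ t) (f : LpSp N p) :
    (logSemigroup N t f : 𝓢'(Sp N, ℂ)) = besselOp N (-(2 * t)) (f : 𝓢'(Sp N, ℂ)) := by
  rcases ht.eq_or_lt with rfl | ht
  · rw [logSemigroup_zero, mul_zero, neg_zero, besselOp_zero]
  · rw [logSemigroup_eq_toLp hp1 hp ht, coe_toLp_heatConv hp1 hp ht]

theorem logSemigroup_coeFn (hp1 : 1 < p) (hp : p < ⊤) {t : ℝ} (ht : 0 < t) (f : LpSp N p) :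
    logSemigroup N t f =ᵐ[volume] heatConv N t f := by
  rw [logSemigroup_eq_toLp hp1 hp ht]
  exact MemLp.coeFn_toLp _

theorem norm_logSemigroup_le (hp1 : 1 < p) (hp : p < ⊤) {t : ℝ} (ht : 0 ≤ t) (f : LpSp N p) :
    ‖logSemigroup N t f‖ ≤ ‖f‖ := by
  rcases ht.eq_or_lt with rfl | ht
  · rw [logSemigroup_zero]
  · rw [logSemigroup_eq_toLp hp1 hp ht, Lp.norm_toLp, Lp.norm_def]
    exact ENNReal.toReal_mono (Lp.eLpNorm_ne_top f)
      (eLpNorm_heatConv_le hp1 hp ht (Lp.stronglyMeasurable f).measurable)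

theorem logSemigroup_sub (hp1 : 1 < p) (hp : p < ⊤) {t : ℝ} (ht : 0 ≤ t) (f g : LpSp N p) :
    logSemigroup N t (f - g) = logSemigroup N t f - logSemigroup N t g := by
  refine logSemigroup_eq_of_coe_eq ?_
  have h1 := coe_logSemigroup hp1 hp ht f
  have h2 := coe_logSemigroup hp1 hp ht g
  rw [← Lp.toTemperedDistributionCLM_apply] at h1 h2 ⊢
  rw [map_sub, h1, h2, ← map_sub, ← Lp.toTemperedDistributionCLM_apply (f := f),
    ← Lp.toTemperedDistributionCLM_apply (f := g), ← map_sub, Lp.toTemperedDistributionCLM_apply]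

/-- On Schwartz data the value is represented by one Schwartz function, the same for every exponent.
This permits interpolation between exponents and use of the evolution on the dual side. -/
theorem logSemigroup_toLp (t : ℝ) (ψ : 𝓢(Sp N, ℂ)) :
    logSemigroup N t (ψ.toLp p volume) =
      (SchwartzMap.fourierMultiplierCLM ℂ (besselSymbol N (-(2 * t))) ψ).toLp p volume := by
  refine logSemigroup_eq_of_coe_eq ?_
  rw [Lp.toTemperedDistribution_toLp_eq, Lp.toTemperedDistribution_toLp_eq, besselOp,
    TemperedDistribution.fourierMultiplierCLM_toTemperedDistributionCLM_eq
      (besselSymbol_hasTemperateGrowth N _)]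

theorem memBessel_logSemigroup (hp1 : 1 < p) (hp : p < ⊤) {t : ℝ} (ht : 0 ≤ t) (f : LpSp N p) :
    besselOp N (2 * t) (logSemigroup N t f : 𝓢'(Sp N, ℂ)) = (f : 𝓢'(Sp N, ℂ)) := by
  rw [coe_logSemigroup hp1 hp ht, besselOp_besselOp, neg_add_cancel, besselOp_zero]

theorem besselNorm_eq {σ : ℝ} {f g : LpSp N p}
    (h : besselOp N σ (f : 𝓢'(Sp N, ℂ)) = (g : 𝓢'(Sp N, ℂ))) : besselNorm N σ f = ‖g‖ₑ := by
  refine le_antisymm (iInf₂_le g h) (le_iInf₂ fun g' h' => ?_)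
  rw [toTemperedDistribution_injective (h.symm.trans h')]

end Operator

/-! ### The operator `log(I - Δ)` on Schwartz functions -/

section LogOperator

/-- The derivative is `2x / (1 + ‖x‖²)`, a product of functions of temperate growth, and the
function itself is at most `‖x‖²`. -/
theorem hasTemperateGrowth_log_one_add_norm_sq (E : Type*) [NormedAddCommGroup E]
    [InnerProductSpace ℝ E] : (fun x : E => Real.log (1 + ‖x‖ ^ 2)).HasTemperateGrowth := by
  have hpos : ∀ x : E, 0 < 1 + ‖x‖ ^ 2 := fun x => by positivity
  have hd : ∀ x : E, HasFDerivAt (fun x : E => Real.log (1 + ‖x‖ ^ 2))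
      ((1 + ‖x‖ ^ 2) ^ (-1 : ℝ) • (2 : ℝ) • innerSL ℝ x) x := fun x => by
    have h := ((hasStrictFDerivAt_norm_sq x).hasFDerivAt.const_add 1).log (hpos x).ne'
    rw [Real.rpow_neg_one]
    convert h using 2
    ext y
    simp [two_smul]
  refine Function.HasTemperateGrowth.of_fderiv (k := 2) (C := 1) ?_
    (fun x => (hd x).differentiableAt) fun x => ?_
  · have h : fderiv ℝ (fun x : E => Real.log (1 + ‖x‖ ^ 2)) =
        fun x => (1 + ‖x‖ ^ 2) ^ (-1 : ℝ) • ((2 : ℝ) • innerSL ℝ) x :=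
      funext fun x => (hd x).fderiv
    rw [h]
    exact (Function.hasTemperateGrowth_one_add_norm_sq_rpow E (-1)).smul
      (ContinuousLinearMap.hasTemperateGrowth ((2 : ℝ) • innerSL ℝ))
  · rw [Real.norm_of_nonneg (Real.log_nonneg (by nlinarith [sq_nonneg ‖x‖]))]
    have := Real.log_le_sub_one_of_pos (hpos x)
    nlinarith [norm_nonneg x]

theorem logSymbol_nonneg (N : ℕ) (ξ : Sp N) : 0 ≤ logSymbol N ξ :=
  Real.log_nonneg (by nlinarith [sq_nonneg (2 * Real.pi * ‖ξ‖)])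

theorem logSymbol_hasTemperateGrowth (N : ℕ) :
    (fun ξ : Sp N => (logSymbol N ξ : ℂ)).HasTemperateGrowth := by
  have h2 : (fun ξ : Sp N => (2 * Real.pi) • ξ).HasTemperateGrowth :=
    ((2 * Real.pi) • ContinuousLinearMap.id ℝ (Sp N)).hasTemperateGrowth
  have h3 := Function.HasTemperateGrowth.comp Function.Complex.hasTemperateGrowth_ofReal
    (Function.HasTemperateGrowth.comp (hasTemperateGrowth_log_one_add_norm_sq (Sp N)) h2)
  have h4 : (fun ξ : Sp N => (logSymbol N ξ : ℂ)) = Complex.ofReal ∘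
      (fun x : Sp N => Real.log (1 + ‖x‖ ^ 2)) ∘ fun ξ : Sp N => (2 * Real.pi) • ξ := by
    funext ξ
    simp [logSymbol, Function.comp_def, norm_smul, mul_pow, abs_of_pos Real.pi_pos]
  rw [h4]
  exact h3

/-- `log(I - Δ)` on Schwartz functions. -/
def logCLM (N : ℕ) : 𝓢(Sp N, ℂ) →L[ℂ] 𝓢(Sp N, ℂ) :=
  SchwartzMap.fourierMultiplierCLM ℂ fun ξ : Sp N => (logSymbol N ξ : ℂ)

theorem logOp_eq_logCLM {N : ℕ} (ψ : 𝓢(Sp N, ℂ)) : logOp N ψ = logCLM N ψ := by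
  rw [logCLM, SchwartzMap.fourierMultiplierCLM_apply, SchwartzMap.fourierInv_coe, logOp]
  congr 1
  ext ξ
  rw [SchwartzMap.smulLeftCLM_apply_apply (logSymbol_hasTemperateGrowth N), smul_eq_mul]
  rfl

theorem fourier_logCLM_apply {N : ℕ} (ψ : 𝓢(Sp N, ℂ)) (ξ : Sp N) :
    𝓕 (logCLM N ψ) ξ = logSymbol N ξ * 𝓕 ψ ξ := by
  rw [logCLM, SchwartzMap.fourierMultiplierCLM_apply, FourierTransform.fourier_fourierInv_eq,
    SchwartzMap.smulLeftCLM_apply_apply (logSymbol_hasTemperateGrowth N), smul_eq_mul]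

theorem fourierInv_apply_eq_fourier_neg {N : ℕ} (ψ : 𝓢(Sp N, ℂ)) (ξ : Sp N) :
    𝓕⁻ ψ ξ = 𝓕 ψ (-ξ) := by
  rw [SchwartzMap.fourierInv_coe, SchwartzMap.fourier_coe, Real.fourierInv_eq_fourier_neg]

theorem fourierInv_logCLM_apply {N : ℕ} (ψ : 𝓢(Sp N, ℂ)) (ξ : Sp N) :
    𝓕⁻ (logCLM N ψ) ξ = logSymbol N ξ * 𝓕⁻ ψ ξ := by
  rw [fourierInv_apply_eq_fourier_neg, fourier_logCLM_apply, fourierInv_apply_eq_fourier_neg]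
  simp [logSymbol]

end LogOperator

/-! ### Strong continuity of the semigroup -/

section Continuity

variable {N : ℕ}

theorem norm_exp_neg_mul_sub_le {a s t : ℝ} (ha : 0 ≤ a) (hs : 0 ≤ s) (ht : 0 ≤ t) :
    |Real.exp (-t * a) - Real.exp (-s * a)| ≤ |t - s| * a := by
  have key : ∀ s t : ℝ, 0 ≤ s → s ≤ t → |Real.exp (-t * a) - Real.exp (-s * a)| ≤ |t - s| * a := by
    intro s t hs hst
    have h1 : Real.exp (-t * a) = Real.exp (-s * a) * Real.exp (-(t - s) * a) := by
      rw [← Real.exp_add]; congr 1; ring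
    have h2 : Real.exp (-s * a) ≤ 1 := Real.exp_le_one_iff.2 (by nlinarith)
    have h3 : Real.exp (-(t - s) * a) ≤ 1 := Real.exp_le_one_iff.2 (by nlinarith)
    have h4 := Real.add_one_le_exp (-(t - s) * a)
    have h5 := Real.exp_pos (-s * a)
    rw [h1, abs_sub_comm, abs_of_nonneg (by nlinarith), abs_of_nonneg (by linarith)]
    nlinarith
  rcases le_total s t with h | h
  · exact key s t hs h
  · rw [abs_sub_comm, abs_sub_comm t]
    exact key t s ht h

/-- The semigroup on Schwartz functions is Lipschitz in time for the uniform norm. -/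
theorem exists_norm_besselMultiplier_sub_le (ψ : 𝓢(Sp N, ℂ)) : ∃ A : ℝ, 0 ≤ A ∧
    ∀ s t : ℝ, 0 ≤ s → 0 ≤ t → ∀ x,
      ‖SchwartzMap.fourierMultiplierCLM ℂ (besselSymbol N (-(2 * t))) ψ x -
        SchwartzMap.fourierMultiplierCLM ℂ (besselSymbol N (-(2 * s))) ψ x‖ ≤ |t - s| * A := by
  -- By Fourier inversion the sup norm is at most the `L^1` norm on the Fourier side; the Lipschitz
  -- bound on the symbol produces one factor `log(1+|ξ|²)`.
  refine ⟨∫ ξ, ‖𝓕 (logCLM N ψ) ξ‖, by positivity, fun s t hs ht x => ?_⟩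
  have hform : ∀ r, SchwartzMap.fourierMultiplierCLM ℂ (besselSymbol N (-(2 * r))) ψ x =
      ∫ ξ, Complex.exp (↑(2 * Real.pi * inner ℝ ξ x) * Complex.I) •
        SchwartzMap.smulLeftCLM ℂ (besselSymbol N (-(2 * r))) (𝓕 ψ) ξ := fun r => by
    rw [SchwartzMap.fourierMultiplierCLM_apply, SchwartzMap.fourierInv_coe, Real.fourierInv_eq']
  have hint : ∀ r, Integrable fun ξ => Complex.exp (↑(2 * Real.pi * inner ℝ ξ x) * Complex.I) •
        SchwartzMap.smulLeftCLM ℂ (besselSymbol N (-(2 * r))) (𝓕 ψ) ξ := fun r => by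
    refine (SchwartzMap.integrable _).bdd_mul (c := 1)
      (Continuous.aestronglyMeasurable (by fun_prop)) (ae_of_all _ fun ξ => ?_)
    rw [Complex.norm_exp_ofReal_mul_I]
  rw [hform, hform, ← integral_sub (hint t) (hint s), ← integral_const_mul]
  refine norm_integral_le_of_norm_le ((SchwartzMap.integrable _).norm.const_mul _)
    (ae_of_all _ fun ξ => ?_)
  rw [← smul_sub, norm_smul, Complex.norm_exp_ofReal_mul_I, one_mul,
    SchwartzMap.smulLeftCLM_apply_apply (besselSymbol_hasTemperateGrowth N _),
    SchwartzMap.smulLeftCLM_apply_apply (besselSymbol_hasTemperateGrowth N _), ← sub_smul,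
    norm_smul,
    besselSymbol_neg_eq, besselSymbol_neg_eq, ← Complex.ofReal_sub, Complex.norm_real,
    fourier_logCLM_apply, norm_mul, Complex.norm_of_nonneg (logSymbol_nonneg N ξ), ← mul_assoc]
  gcongr
  exact norm_exp_neg_mul_sub_le (logSymbol_nonneg N ξ) hs ht

theorem lintegral_rpow_le_of_norm_le {α : Type*} [MeasurableSpace α] {μ : Measure α} {g : α → ℂ}
    {M r p : ℝ} (hM : ∀ x, ‖g x‖ ≤ M) (hr : 0 ≤ r) (hrp : r ≤ p) :
    ∫⁻ x, ‖g x‖ₑ ^ p ∂μ ≤ ENNReal.ofReal M ^ (p - r) * ∫⁻ x, ‖g x‖ₑ ^ r ∂μ := by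
  rw [← lintegral_const_mul' _ _
    (ENNReal.rpow_ne_top_of_nonneg (by linarith) ENNReal.ofReal_ne_top)]
  refine lintegral_mono fun x => ?_
  calc ‖g x‖ₑ ^ p = ‖g x‖ₑ ^ (p - r) * ‖g x‖ₑ ^ r := by
        rw [← ENNReal.rpow_add_of_nonneg _ _ (by linarith) hr, sub_add_cancel]
    _ ≤ _ := by
        gcongr ?_ * _
        refine ENNReal.rpow_le_rpow ?_ (by linarith)
        rw [← ofReal_norm]
        exact ENNReal.ofReal_le_ofReal (hM x)

variable {p : ℝ≥0∞} [Fact (1 ≤ p)]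

/-- Interpolation: differences in time are `O(|t - s|)` in sup norm and bounded in `L^r` for some `1
< r < p`, so they tend to zero in `L^p`. Taking `r > 1` makes the contraction estimate available. -/
theorem continuousOn_logSemigroup_toLp (hp1 : 1 < p) (hp : p < ⊤) (ψ : 𝓢(Sp N, ℂ)) :
    ContinuousOn (fun t => logSemigroup N t (ψ.toLp p volume)) (Ici 0) := by
  obtain ⟨r, hr1, hrp⟩ := exists_between hp1
  have hr : r < ⊤ := hrp.trans hp
  have : Fact (1 ≤ r) := ⟨hr1.le⟩
  have hR := one_lt_toReal hr1 hr
  have hP := one_lt_toReal hp1 hp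
  have hRP : r.toReal < p.toReal := (ENNReal.toReal_lt_toReal hr.ne hp.ne).2 hrp
  have hr0 : r ≠ 0 := (zero_lt_one.trans hr1).ne'
  have hp0 : p ≠ 0 := (zero_lt_one.trans hp1).ne'
  obtain ⟨A, hA, hle⟩ := exists_norm_besselMultiplier_sub_le ψ
  set C : ℝ≥0∞ := (2 * ‖ψ.toLp r volume‖ₑ) ^ r.toReal
  have hC : C ≠ ⊤ := ENNReal.rpow_ne_top_of_nonneg (by linarith)
    (ENNReal.mul_ne_top (by simp) (by simp))
  intro s hs
  have hs : 0 ≤ s := hs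
  have hbound : ∀ t ∈ Ici (0 : ℝ),
      edist (logSemigroup N t (ψ.toLp p volume)) (logSemigroup N s (ψ.toLp p volume)) ≤
      (ENNReal.ofReal (|t - s| * A) ^ (p.toReal - r.toReal) * C) ^ (1 / p.toReal) := by
    intro t ht
    have ht : 0 ≤ t := ht
    set g := SchwartzMap.fourierMultiplierCLM ℂ (besselSymbol N (-(2 * t))) ψ -
        SchwartzMap.fourierMultiplierCLM ℂ (besselSymbol N (-(2 * s))) ψ with hg
    have h1 : logSemigroup N t (ψ.toLp p volume) - logSemigroup N s (ψ.toLp p volume) =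
        g.toLp p volume := by
      rw [logSemigroup_toLp, logSemigroup_toLp]; rfl
    have h2 : logSemigroup N t (ψ.toLp r volume) - logSemigroup N s (ψ.toLp r volume) =
        g.toLp r volume := by
      rw [logSemigroup_toLp, logSemigroup_toLp]; rfl
    have h3 : ‖g.toLp r volume‖ₑ ≤ 2 * ‖ψ.toLp r volume‖ₑ := by
      rw [← h2, two_mul]
      refine enorm_sub_le.trans (add_le_add ?_ ?_)
      · exact enorm_le_iff_norm_le.2 (norm_logSemigroup_le hr1 hr ht _)
      · exact enorm_le_iff_norm_le.2 (norm_logSemigroup_le hr1 hr hs _)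
    have h4 : ∫⁻ x, ‖g x‖ₑ ^ r.toReal ≤ C := by
      rw [Lp.enorm_def, eLpNorm_congr_ae (g.coeFn_toLp r volume),
        eLpNorm_eq_lintegral_rpow_enorm_toReal hr0 hr.ne] at h3
      calc _ = ((∫⁻ x, ‖g x‖ₑ ^ r.toReal) ^ (1 / r.toReal)) ^ r.toReal := by
            rw [← ENNReal.rpow_mul, one_div_mul_cancel (by linarith), ENNReal.rpow_one]
        _ ≤ C := ENNReal.rpow_le_rpow h3 (by linarith)
    rw [edist_eq_enorm_sub, h1, Lp.enorm_def, eLpNorm_congr_ae (g.coeFn_toLp p volume),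
      eLpNorm_eq_lintegral_rpow_enorm_toReal hp0 hp.ne]
    gcongr
    refine (lintegral_rpow_le_of_norm_le (M := |t - s| * A) (hle s t hs ht) (by linarith)
      hRP.le).trans ?_
    exact mul_le_mul_right h4 _
  refine tendsto_iff_edist_tendsto_0.2 (tendsto_of_tendsto_of_tendsto_of_le_of_le'
    tendsto_const_nhds ?_ (Eventually.of_forall fun _ => zero_le)
    (eventually_nhdsWithin_of_forall hbound))
  have hlim : Tendsto (fun t => ENNReal.ofReal (|t - s| * A)) (𝓝[Ici 0] s) (𝓝 0) := by
    have : Continuous fun t => ENNReal.ofReal (|t - s| * A) :=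
      ENNReal.continuous_ofReal.comp (by fun_prop)
    have h := (this.tendsto s).mono_left (nhdsWithin_le_nhds (s := Ici 0))
    simpa using h
  have h1 := (ENNReal.continuous_rpow_const (y := p.toReal - r.toReal)).continuousAt.tendsto.comp
    hlim
  rw [ENNReal.zero_rpow_of_pos (by linarith)] at h1
  have h2 := ENNReal.Tendsto.mul_const h1 (.inr hC)
  rw [zero_mul] at h2
  have h3 := (ENNReal.continuous_rpow_const (y := 1 / p.toReal)).continuousAt.tendsto.comp h2
  rw [ENNReal.zero_rpow_of_pos (by positivity)] at h3
  exact h3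

theorem exists_seq_schwartz_tendsto (hp : p < ⊤) (f : LpSp N p) :
    ∃ ψ : ℕ → 𝓢(Sp N, ℂ), Tendsto (fun n => (ψ n).toLp p volume) atTop (𝓝 f) := by
  have hd : DenseRange (SchwartzMap.toLpCLM ℝ ℂ p (volume : Measure (Sp N))) :=
    SchwartzMap.denseRange_toLpCLM hp.ne
  obtain ⟨x, hx, hlim⟩ := mem_closure_iff_seq_limit.1 (hd f)
  choose ψ hψ using hx
  have h : x = fun n => (ψ n).toLp p volume := funext fun n => (hψ n).symm
  exact ⟨ψ, h ▸ hlim⟩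

/-- The contraction bound does not depend on `t`, so convergence of the data is uniform over all
times. -/
theorem tendstoUniformlyOn_logSemigroup (hp1 : 1 < p) (hp : p < ⊤) {f : LpSp N p}
    {F : ℕ → LpSp N p} (hF : Tendsto F atTop (𝓝 f)) :
    TendstoUniformlyOn (fun n t => logSemigroup N t (F n)) (fun t => logSemigroup N t f) atTop
      (Ici 0) := by
  rw [Metric.tendstoUniformlyOn_iff]
  intro ε hε
  filter_upwards [Metric.tendsto_nhds.1 hF ε hε] with n hn t ht
  rw [dist_comm, dist_eq_norm, ← logSemigroup_sub hp1 hp ht]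
  exact (norm_logSemigroup_le hp1 hp ht _).trans_lt (by rwa [← dist_eq_norm])

/-- The semigroup is strongly continuous on `L^p`. -/
theorem continuousOn_logSemigroup (hp1 : 1 < p) (hp : p < ⊤) (f : LpSp N p) :
    ContinuousOn (fun t => logSemigroup N t f) (Ici 0) := by
  obtain ⟨ψ, hψ⟩ := exists_seq_schwartz_tendsto hp f
  exact (tendstoUniformlyOn_logSemigroup hp1 hp hψ).continuousOn
    (Frequently.of_forall fun n => continuousOn_logSemigroup_toLp hp1 hp (ψ n))

end Continuity

/-! ### The equation for the semigroup, tested with Schwartz functions -/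

section WeakDerivative

variable {N : ℕ}

/-- On the Fourier side only the factor `exp (-r * logSymbol)` depends on time. Its derivative
brings out the symbol, which is attached to `ψ`; the bound `exp ≤ 1` for `r > 0` dominates. -/
theorem hasDerivAt_besselMultiplier (φ ψ : 𝓢(Sp N, ℂ)) {t : ℝ} (ht : 0 < t) :
    HasDerivAt (fun r => ∫ x, ψ x •
        SchwartzMap.fourierMultiplierCLM ℂ (besselSymbol N (-(2 * r))) φ x)
      (-∫ x, logCLM N ψ x •
        SchwartzMap.fourierMultiplierCLM ℂ (besselSymbol N (-(2 * t))) φ x) t := by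
  have hform : ∀ (η : 𝓢(Sp N, ℂ)) r, ∫ x, η x •
      SchwartzMap.fourierMultiplierCLM ℂ (besselSymbol N (-(2 * r))) φ x =
      ∫ ξ, 𝓕⁻ η ξ * (((Real.exp (-r * logSymbol N ξ) : ℝ) : ℂ) * 𝓕 φ ξ) := fun η r => by
    simp only [SchwartzMap.fourierMultiplierCLM_apply]
    rw [← SchwartzMap.integral_fourierInv_smul_eq]
    refine integral_congr_ae (ae_of_all _ fun ξ => ?_)
    simp only [SchwartzMap.smulLeftCLM_apply_apply (besselSymbol_hasTemperateGrowth N _),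
      besselSymbol_neg_eq, smul_eq_mul]
  have hcont : ∀ r, Continuous fun ξ : Sp N => ((Real.exp (-r * logSymbol N ξ) : ℝ) : ℂ) :=
    fun r => by
    have h := (besselSymbol_hasTemperateGrowth N (-(2 * r))).1.continuous
    simpa only [← besselSymbol_neg_eq] using h
  have hbdd : ∀ r, 0 ≤ r → ∀ ξ : Sp N, ‖((Real.exp (-r * logSymbol N ξ) : ℝ) : ℂ)‖ ≤ 1 := by
    intro r hr ξ
    rw [Complex.norm_of_nonneg (Real.exp_pos _).le, Real.exp_le_one_iff]
    nlinarith [logSymbol_nonneg N ξ]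
  obtain ⟨B, hB⟩ : ∃ B, ∀ ξ, ‖𝓕⁻ (logCLM N ψ) ξ‖ ≤ B :=
    ⟨_, fun ξ => SchwartzMap.norm_le_seminorm ℂ _ ξ⟩
  have hF' : ∀ ξ r, HasDerivAt (fun r : ℝ => 𝓕⁻ ψ ξ * (((Real.exp (-r * logSymbol N ξ) : ℝ) : ℂ) *
      𝓕 φ ξ)) (-(𝓕⁻ (logCLM N ψ) ξ * (((Real.exp (-r * logSymbol N ξ) : ℝ) : ℂ) * 𝓕 φ ξ))) r := by
    intro ξ r
    have h1 : HasDerivAt (fun r : ℝ => Real.exp (-r * logSymbol N ξ))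
        (Real.exp (-r * logSymbol N ξ) * (-1 * logSymbol N ξ)) r :=
      ((hasDerivAt_id r).neg.mul_const _).exp
    refine ((h1.ofReal_comp.mul_const (𝓕 φ ξ)).const_mul (𝓕⁻ ψ ξ)).congr_deriv ?_
    rw [fourierInv_logCLM_apply]
    push_cast
    ring
  simp_rw [hform]
  rw [← integral_neg]
  refine (hasDerivAt_integral_of_dominated_loc_of_deriv_le (s := Ioi 0)
    (bound := fun ξ => B * ‖𝓕 φ ξ‖) (Ioi_mem_nhds ht) (.of_forall fun r => ?_) ?_ ?_
    (ae_of_all _ fun ξ r hr => ?_) ((𝓕 φ).integrable.norm.const_mul _)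
    (ae_of_all _ fun ξ r _ => hF' ξ r)).2
  · exact ((𝓕⁻ ψ).continuous.mul ((hcont r).mul (𝓕 φ).continuous)).aestronglyMeasurable
  · refine Integrable.mono' ((𝓕 φ).integrable.norm.const_mul (SchwartzMap.seminorm ℂ 0 0 (𝓕⁻ ψ)))
      ((𝓕⁻ ψ).continuous.mul ((hcont t).mul (𝓕 φ).continuous)).aestronglyMeasurable
      (ae_of_all _ fun ξ => ?_)
    rw [norm_mul, norm_mul]
    have h1 := SchwartzMap.norm_le_seminorm ℂ (𝓕⁻ ψ) ξ
    have h2 := hbdd t ht.le ξ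
    gcongr
    exact mul_le_of_le_one_left (norm_nonneg _) h2
  · exact ((𝓕⁻ (logCLM N ψ)).continuous.mul
      ((hcont t).mul (𝓕 φ).continuous)).neg.aestronglyMeasurable
  · rw [norm_neg, norm_mul, norm_mul]
    have h2 := hbdd r (le_of_lt hr) ξ
    have hB0 := (norm_nonneg _).trans (hB ξ)
    gcongr
    · exact hB ξ
    · exact mul_le_of_le_one_left (norm_nonneg _) h2

variable {p : ℝ≥0∞} [Fact (1 ≤ p)]

/-- The pairing of `L^p` with a Schwartz function. -/
def pairingCLM (p : ℝ≥0∞) [Fact (1 ≤ p)] (ψ : 𝓢(Sp N, ℂ)) : LpSp N p →L[ℂ] ℂ where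
  toFun f := (f : 𝓢'(Sp N, ℂ)) ψ
  map_add' f g := by simp [← Lp.toTemperedDistributionCLM_apply]
  map_smul' c f := by simp [← Lp.toTemperedDistributionCLM_apply]
  cont := (PointwiseConvergenceCLM.evalCLM _ _ ψ).continuous.comp
    (Lp.toTemperedDistributionCLM ℂ (volume : Measure (Sp N)) p).continuous

theorem pairingCLM_apply (ψ : 𝓢(Sp N, ℂ)) (f : LpSp N p) :
    pairingCLM p ψ f = ∫ x, ψ x • f x := Lp.toTemperedDistribution_apply f ψ

/-- The semigroup solves the equation, tested with Schwartz functions. -/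
theorem hasDerivAt_pairing_logSemigroup (hp1 : 1 < p) (hp : p < ⊤) (f : LpSp N p)
    (ψ : 𝓢(Sp N, ℂ)) {t : ℝ} (ht : 0 < t) :
    HasDerivAt (fun r => pairingCLM p ψ (logSemigroup N r f))
      (-pairingCLM p (logCLM N ψ) (logSemigroup N t f)) t := by
  obtain ⟨φ, hφ⟩ := exists_seq_schwartz_tendsto hp f
  have hunif := (tendstoUniformlyOn_logSemigroup hp1 hp hφ).mono (Ioi_subset_Ici_self)
  refine hasDerivAt_of_tendstoUniformlyOn (l := atTop) (s := Ioi 0)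
    (f := fun n r => pairingCLM p ψ (logSemigroup N r ((φ n).toLp p volume)))
    (f' := fun n r => -pairingCLM p (logCLM N ψ) (logSemigroup N r ((φ n).toLp p volume)))
    (g' := fun r => -pairingCLM p (logCLM N ψ) (logSemigroup N r f))
    isOpen_Ioi ?_ (.of_forall fun n r hr => ?_) (fun r hr => ?_) ht
  · exact (-pairingCLM p (logCLM N ψ)).uniformContinuous.comp_tendstoUniformlyOn hunif
  · have h := hasDerivAt_besselMultiplier (φ n) ψ hr
    have hcoe : ∀ (η : 𝓢(Sp N, ℂ)) r, pairingCLM p η (logSemigroup N r ((φ n).toLp p volume)) =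
        ∫ x, η x • SchwartzMap.fourierMultiplierCLM ℂ (besselSymbol N (-(2 * r))) (φ n) x := by
      intro η r
      rw [logSemigroup_toLp, pairingCLM_apply]
      refine integral_congr_ae ?_
      filter_upwards [SchwartzMap.coeFn_toLp (SchwartzMap.fourierMultiplierCLM ℂ
        (besselSymbol N (-(2 * r))) (φ n)) p volume] with x hx
      rw [hx]
    simp_rw [hcoe]
    exact h
  · exact ((pairingCLM p ψ).continuous.tendsto _).comp (hunif.tendsto_at hr)

end WeakDerivative

/-! ### Test functions on space-time as curves of Schwartz functions -/

section Slices

variable {E : Type*} [NormedAddCommGroup E] [NormedSpace ℝ E] {Φ : ℝ × E → ℂ}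

theorem hasCompactSupport_slice {E : Type*} [TopologicalSpace E] {Φ : ℝ × E → ℂ} [T2Space E]
    (h : HasCompactSupport Φ) (t : ℝ) :
    HasCompactSupport fun x => Φ (t, x) := by
  refine HasCompactSupport.intro (K := Prod.snd '' tsupport Φ) (h.image continuous_snd)
    fun x hx => ?_
  by_contra hne
  exact hx ⟨(t, x), subset_tsupport _ hne, rfl⟩

/-- The time slice `Φ(t, ·)` of a test function, as a Schwartz function. -/
def slice (hΦ : ContDiff ℝ ∞ Φ) (hc : HasCompactSupport Φ) (t : ℝ) : 𝓢(E, ℂ) :=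
  (hasCompactSupport_slice hc t).toSchwartzMap (hΦ.comp (contDiff_prodMk_right t))

theorem slice_apply (hΦ : ContDiff ℝ ∞ Φ) (hc : HasCompactSupport Φ) (t : ℝ) (x : E) :
    slice hΦ hc t x = Φ (t, x) := rfl

theorem iteratedFDeriv_slice (hΦ : ContDiff ℝ ∞ Φ) (t : ℝ) (n : ℕ) (x : E) :
    iteratedFDeriv ℝ n (fun x => Φ (t, x)) x =
      (iteratedFDeriv ℝ n Φ (t, x)).compContinuousLinearMap
        fun _ => ContinuousLinearMap.inr ℝ ℝ E := by
  have h1 : (fun x => Φ (t, x)) = (fun w => Φ ((t, 0) + w)) ∘ ContinuousLinearMap.inr ℝ ℝ E := by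
    ext x; simp
  have h2 : ContDiff ℝ ∞ fun w => Φ ((t, 0) + w) := hΦ.comp (contDiff_const.add contDiff_id)
  rw [h1, ContinuousLinearMap.iteratedFDeriv_comp_right _ h2 x (by exact_mod_cast le_top),
    iteratedFDeriv_comp_add_left]
  simp

theorem norm_iteratedFDeriv_slice_sub_le (hΦ : ContDiff ℝ ∞ Φ) (hc : HasCompactSupport Φ) (s t : ℝ)
    (n : ℕ) (x : E) : ‖iteratedFDeriv ℝ n (slice hΦ hc s - slice hΦ hc t : 𝓢(E, ℂ)) x‖ ≤
      ‖iteratedFDeriv ℝ n Φ (s, x) - iteratedFDeriv ℝ n Φ (t, x)‖ := by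
  have h1 : (⇑(slice hΦ hc s - slice hΦ hc t) : E → ℂ) =
      (fun x => Φ (s, x)) - fun x => Φ (t, x) := rfl
  have hcd : ∀ r, ContDiffAt ℝ n (fun x => Φ (r, x)) x := fun r =>
    ((hΦ.comp (contDiff_prodMk_right r)).of_le (by exact_mod_cast le_top)).contDiffAt
  rw [h1, iteratedFDeriv_sub_apply (hcd s) (hcd t), iteratedFDeriv_slice hΦ,
    iteratedFDeriv_slice hΦ]
  have h3 := ContinuousMultilinearMap.norm_compContinuousLinearMap_le
    (iteratedFDeriv ℝ n Φ (s, x) - iteratedFDeriv ℝ n Φ (t, x))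
    (fun _ => ContinuousLinearMap.inr ℝ ℝ E)
  refine h3.trans (mul_le_of_le_one_right (norm_nonneg _) ?_)
  rw [Finset.prod_const]
  exact pow_le_one₀ (norm_nonneg _) (ContinuousLinearMap.norm_inr_le_one ℝ ℝ E)

/-- The weighted derivative is continuous with compact support, hence uniformly continuous: `δ` does
not depend on `x`. -/
theorem exists_norm_pow_mul_iteratedFDeriv_sub_lt (hΦ : ContDiff ℝ ∞ Φ) (hc : HasCompactSupport Φ)
    (k n : ℕ) {ε : ℝ} (hε : 0 < ε) : ∃ δ > 0, ∀ s t : ℝ, dist s t < δ → ∀ x : E,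
      ‖x‖ ^ k * ‖iteratedFDeriv ℝ n Φ (s, x) - iteratedFDeriv ℝ n Φ (t, x)‖ < ε := by
  have h1 : Continuous (iteratedFDeriv ℝ n Φ) :=
    hΦ.continuous_iteratedFDeriv (by exact_mod_cast le_top)
  have h2 : Continuous fun z : ℝ × E => ‖z.2‖ ^ k • iteratedFDeriv ℝ n Φ z :=
    ((continuous_norm.comp continuous_snd).pow k).smul h1
  have h3 : HasCompactSupport fun z : ℝ × E => ‖z.2‖ ^ k • iteratedFDeriv ℝ n Φ z := by
    refine (hc.iteratedFDeriv (𝕜 := ℝ) n).mono fun z hz hz' => hz ?_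
    simp only [hz', smul_zero]
  obtain ⟨δ, hδ, hδ'⟩ := Metric.uniformContinuous_iff.1
    (h3.uniformContinuous_of_continuous h2) ε hε
  refine ⟨δ, hδ, fun s t hst x => ?_⟩
  have h4 := @hδ' (s, x) (t, x) (by rw [Prod.dist_eq, dist_self]; exact max_lt hst hδ)
  rwa [dist_eq_norm, ← smul_sub, norm_smul, norm_pow, norm_norm] at h4

theorem continuous_slice (hΦ : ContDiff ℝ ∞ Φ) (hc : HasCompactSupport Φ) :
    Continuous (slice hΦ hc) := by
  refine continuous_iff_continuousAt.2 fun t => ?_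
  refine ((schwartz_withSeminorms ℝ E ℂ).tendsto_nhds _ _).2 ?_
  rintro ⟨k, n⟩ ε hε
  obtain ⟨δ, hδ, hδ'⟩ := exists_norm_pow_mul_iteratedFDeriv_sub_lt hΦ hc k n (half_pos hε)
  refine Filter.eventually_of_mem (Metric.ball_mem_nhds t hδ) fun s hs => ?_
  refine lt_of_le_of_lt ?_ (half_lt_self hε)
  refine SchwartzMap.seminorm_le_bound ℝ k n _ (half_pos hε).le fun x => ?_
  exact (mul_le_mul_of_nonneg_left (norm_iteratedFDeriv_slice_sub_le hΦ hc s t n x)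
    (by positivity)).trans (hδ' s t hs x).le

/-- The time derivative of a test function. -/
def timeDeriv (Φ : ℝ × E → ℂ) (z : ℝ × E) : ℂ := fderiv ℝ Φ z (1, 0)

theorem contDiff_timeDeriv (hΦ : ContDiff ℝ ∞ Φ) : ContDiff ℝ ∞ (timeDeriv Φ) :=
  (hΦ.fderiv_right (m := ∞) (by simp)).clm_apply contDiff_const

theorem hasCompactSupport_timeDeriv (hc : HasCompactSupport Φ) :
    HasCompactSupport (timeDeriv Φ) :=
  (hc.fderiv ℝ).comp_left (g := fun L : ℝ × E →L[ℝ] ℂ => L (1, 0)) rfl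

theorem hasDerivAt_timeDeriv (hΦ : ContDiff ℝ ∞ Φ) (t : ℝ) (x : E) :
    HasDerivAt (fun s => Φ (s, x)) (timeDeriv Φ (t, x)) t := by
  have h1 : HasFDerivAt Φ (fderiv ℝ Φ (t, x)) (t, x) :=
    (hΦ.differentiable (by simp)).differentiableAt.hasFDerivAt
  exact h1.comp_hasDerivAt t ((hasDerivAt_id t).prodMk (hasDerivAt_const t x))

theorem hasDerivAt_slice_toLp [MeasurableSpace E] [BorelSpace E] [SecondCountableTopology E]
    {μ : Measure E} [μ.HasTemperateGrowth] {q : ℝ≥0∞} [Fact (1 ≤ q)]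
    (hΦ : ContDiff ℝ ∞ Φ) (hc : HasCompactSupport Φ) (t : ℝ) :
    HasDerivAt (fun s => (slice hΦ hc s).toLp q μ)
      ((slice (contDiff_timeDeriv hΦ) (hasCompactSupport_timeDeriv hc) t).toLp q μ) t := by
  set Ψ := slice (contDiff_timeDeriv hΦ) (hasCompactSupport_timeDeriv hc) with hΨ
  -- The `L^q` norm is controlled by seminorms without derivatives, so only orders `(j, 0)` are
  -- estimated. The later `C + 1` covers `C = 0`.
  obtain ⟨k, C, hC, hle⟩ := SchwartzMap.norm_toLp_le_seminorm ℝ ℂ (E := E) q μ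
  rw [hasDerivAt_iff_isLittleO, Asymptotics.isLittleO_iff]
  intro c hcpos
  set ε := c / (C + 1)
  have hε : 0 < ε := by positivity
  have hev := ((schwartz_withSeminorms ℝ E ℂ).tendsto_nhds' _ _).1
    ((continuous_slice (contDiff_timeDeriv hΦ) (hasCompactSupport_timeDeriv hc)).tendsto t)
    (Finset.Iic (k, 0)) ε hε
  obtain ⟨δ, hδ, hδ'⟩ := Metric.eventually_nhds_iff_ball.1 hev
  filter_upwards [Metric.ball_mem_nhds t hδ] with s hs
  have h1 : (slice hΦ hc s).toLp q μ - (slice hΦ hc t).toLp q μ - (s - t) • (Ψ t).toLp q μ =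
      (slice hΦ hc s - slice hΦ hc t - (s - t) • Ψ t).toLp q μ := rfl
  rw [h1]
  refine (hle _).trans ?_
  have h2 : (Finset.Iic (k, 0)).sup (schwartzSeminormFamily ℝ E ℂ)
      (slice hΦ hc s - slice hΦ hc t - (s - t) • Ψ t) ≤ ε * ‖s - t‖ := by
    refine Seminorm.finset_sup_apply_le (by positivity) ?_
    rintro ⟨j, m⟩ hjm
    obtain rfl : m = 0 := by
      have := (Finset.mem_Iic.1 hjm).2
      simpa using this
    refine SchwartzMap.seminorm_le_bound ℝ j 0 _ (by positivity) fun x => ?_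
    rw [norm_iteratedFDeriv_zero]
    -- Mean value inequality for the remainder `Φ(r, x) - r Ψ(t, x)`, whose derivative is small near
    -- `t` uniformly in `x` by continuity of the derivative slices.
    have h3 := Convex.norm_image_sub_le_of_norm_hasDerivWithin_le (𝕜 := ℝ)
      (f := fun r : ℝ => ‖x‖ ^ j • (Φ (r, x) - r • Ψ t x))
      (f' := fun r => ‖x‖ ^ j • (timeDeriv Φ (r, x) - Ψ t x)) (C := ε) (s := Metric.ball t δ)
      (fun r _ => ?_) (fun r hr => ?_) (convex_ball t δ) (Metric.mem_ball_self hδ) hs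
    · rw [← smul_sub, norm_smul, norm_pow, norm_norm] at h3
      refine (le_of_eq ?_).trans h3
      congr 2
      change Φ (s, x) - Φ (t, x) - (s - t) • Ψ t x = _
      rw [sub_smul]
      ring
    · have h4 : HasDerivAt (fun r : ℝ => ‖x‖ ^ j • (Φ (r, x) - r • Ψ t x))
          (‖x‖ ^ j • (timeDeriv Φ (r, x) - (1 : ℝ) • Ψ t x)) r :=
        ((hasDerivAt_timeDeriv hΦ r x).sub
          ((hasDerivAt_id r).smul_const (Ψ t x))).const_smul (‖x‖ ^ j)
      rw [one_smul] at h4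
      exact h4.hasDerivWithinAt
    · have h5 : SchwartzMap.seminorm ℝ j 0 (Ψ r - Ψ t) ≤ ε := by
        have h6 := Seminorm.le_finset_sup_apply (p := schwartzSeminormFamily ℝ E ℂ) hjm
          (x := Ψ r - Ψ t)
        exact h6.trans (hδ' r hr).le
      have h7 := SchwartzMap.le_seminorm ℝ j 0 (Ψ r - Ψ t) x
      rw [norm_iteratedFDeriv_zero] at h7
      rw [norm_smul, norm_pow, norm_norm]
      exact h7.trans h5
  calc _ ≤ C * (ε * ‖s - t‖) := by gcongr
    _ = C / (C + 1) * c * ‖s - t‖ := by simp only [ε]; ring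
    _ ≤ _ := by
      gcongr
      refine mul_le_of_le_one_left hcpos.le ?_
      rw [div_le_one (by positivity)]
      linarith

end Slices

/-! ### The semigroup is a very weak solution -/

section Existence

variable {N : ℕ} {p q : ℝ≥0∞} [Fact (1 ≤ p)] [Fact (1 ≤ q)] [p.HolderConjugate q]

/-- The duality pairing of `L^p` and `L^q`. -/
def lpDual (N : ℕ) (p q : ℝ≥0∞) [Fact (1 ≤ p)] [Fact (1 ≤ q)] [p.HolderConjugate q] :
    LpSp N p →L[ℂ] LpSp N q →L[ℂ] ℂ :=
  (ContinuousLinearMap.lsmul ℂ ℂ).flip.lpPairing volume p q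

theorem lpDual_toLp (f : LpSp N p) (ψ : 𝓢(Sp N, ℂ)) :
    lpDual N p q f (ψ.toLp q volume) = pairingCLM p ψ f := by
  rw [pairingCLM_apply, lpDual, ContinuousLinearMap.lpPairing_eq_integral]
  refine integral_congr_ae ?_
  filter_upwards [ψ.coeFn_toLp q volume] with x hx
  simp [hx]

theorem continuousOn_pairing {u : ℝ → LpSp N p} {s : Set ℝ} (hu : ContinuousOn u s)
    {Ψ : ℝ → 𝓢(Sp N, ℂ)} (hΨ : Continuous Ψ) :
    ContinuousOn (fun t => pairingCLM p (Ψ t) (u t)) s := by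
  have : Fact (1 ≤ (1 - p⁻¹)⁻¹) := by simp [fact_iff]
  have : p.HolderConjugate (1 - p⁻¹)⁻¹ := ENNReal.HolderConjugate.inv_one_sub_inv' Fact.out
  simp_rw [← lpDual_toLp (q := (1 - p⁻¹)⁻¹)]
  exact ((lpDual N p (1 - p⁻¹)⁻¹).continuous.comp_continuousOn hu).clm_apply
    (SchwartzMap.continuous_toLp.comp hΨ).continuousOn

/-- A product rule with one factor merely continuous: since `f t = 0`, the slope of the product is
`c s` applied to the slope of `f`. It serves where the `L^p` curve is not known to be differentiable
in norm. -/
theorem hasDerivAt_clm_apply_of_eq_zero {F G : Type*} [NormedAddCommGroup F] [NormedSpace ℝ F]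
    [NormedAddCommGroup G] [NormedSpace ℝ G] {c : ℝ → F →L[ℝ] G} {f : ℝ → F} {f' : F} {t : ℝ}
    (hc : ContinuousAt c t) (hf : HasDerivAt f f' t) (h0 : f t = 0) :
    HasDerivAt (fun s => c s (f s)) (c t f') t := by
  rw [hasDerivAt_iff_tendsto_slope] at hf ⊢
  have h : Tendsto c (𝓝[≠] t) (𝓝 (c t)) := hc.tendsto.mono_left nhdsWithin_le_nhds
  have h2 := ((isBoundedBilinearMap_apply (𝕜 := ℝ) (E := F) (F := G)).continuous.tendsto
    (c t, f')).comp (h.prodMk_nhds hf)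
  refine h2.congr fun s => ?_
  simp [slope, h0]

/-- The derivative of the pairing of the semigroup with a time-dependent test function. -/
theorem hasDerivAt_pairing_slice (hp1 : 1 < p) (hp : p < ⊤) (f : LpSp N p) {Φ : ℝ × Sp N → ℂ}
    (hΦ : ContDiff ℝ ∞ Φ) (hc : HasCompactSupport Φ) {t : ℝ} (ht : 0 < t) :
    HasDerivAt (fun s => pairingCLM p (slice hΦ hc s) (logSemigroup N s f))
      (pairingCLM p (slice (contDiff_timeDeriv hΦ) (hasCompactSupport_timeDeriv hc) t)
        (logSemigroup N t f) - pairingCLM p (logCLM N (slice hΦ hc t)) (logSemigroup N t f)) t := by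
  have : Fact (1 ≤ (1 - p⁻¹)⁻¹) := by simp [fact_iff]
  have : p.HolderConjugate (1 - p⁻¹)⁻¹ := ENNReal.HolderConjugate.inv_one_sub_inv' Fact.out
  set q := (1 - p⁻¹)⁻¹
  -- The pairing at time `s` is split into the pairing with the frozen slice at `t`, handled here,
  -- and the pairing with the difference of slices, which vanishes at `s = t`.
  have h1 := hasDerivAt_pairing_logSemigroup hp1 hp f (slice hΦ hc t) ht
  have h2 : HasDerivAt (fun s => (slice hΦ hc s).toLp q volume - (slice hΦ hc t).toLp q volume)
      ((slice (contDiff_timeDeriv hΦ) (hasCompactSupport_timeDeriv hc) t).toLp q volume) t :=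
    (hasDerivAt_slice_toLp hΦ hc t).sub_const _
  have h3 : ContinuousAt (fun s =>
      (lpDual N p q (logSemigroup N s f)).restrictScalars ℝ) t := by
    have h4 : ContinuousAt (fun s => logSemigroup N s f) t :=
      (continuousOn_logSemigroup hp1 hp f).continuousAt (Ici_mem_nhds ht)
    exact ((ContinuousLinearMap.restrictScalarsL ℂ (LpSp N q) ℂ ℝ ℝ).continuous.comp
      (lpDual N p q).continuous).continuousAt.comp h4
  have h5 := hasDerivAt_clm_apply_of_eq_zero h3 h2 (sub_self _)
  have h6 := h5.add h1
  refine (h6.congr_deriv ?_).congr_of_eventuallyEq (.of_forall fun s => ?_)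
  · simp only [ContinuousLinearMap.coe_restrictScalars', lpDual_toLp]
    ring
  · simp [map_sub, lpDual_toLp]

theorem exists_subset_Ioo_of_isCompact {K : Set ℝ} (hK : IsCompact K) (h : K ⊆ Ioi 0) :
    ∃ a b : ℝ, 0 < a ∧ a ≤ b ∧ K ⊆ Ioo a b := by
  rcases K.eq_empty_or_nonempty with rfl | hne
  · exact ⟨1, 1, one_pos, le_rfl, empty_subset _⟩
  obtain ⟨z, hz, hmin⟩ := hK.exists_isMinOn hne continuousOn_id
  obtain ⟨w, hw, hmax⟩ := hK.exists_isMaxOn hne continuousOn_id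
  have hz0 : 0 < z := h hz
  have hzw : z ≤ w := hmin hw
  exact ⟨z / 2, w + 1, by positivity, by linarith, fun v hv =>
    ⟨by have : z ≤ v := hmin hv; linarith, by have : v ≤ w := hmax hv; linarith⟩⟩

theorem setIntegral_eq_intervalIntegral_of_eq_zero {F : Type*} [NormedAddCommGroup F]
    [NormedSpace ℝ F] {a b : ℝ} (hab : a ≤ b) {s : Set ℝ} (hs : MeasurableSet s)
    (hsub : Ioc a b ⊆ s) {G : ℝ → F} (hG : ∀ t, t ∉ Ioo a b → G t = 0) :
    ∫ t in s, G t = ∫ t in a..b, G t := by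
  rw [intervalIntegral.integral_of_le hab]
  exact setIntegral_eq_of_subset_of_forall_sdiff_eq_zero hs hsub
    fun t ht => hG t fun h => ht.2 ⟨h.1, h.2.le⟩

theorem tsupport_timeDeriv_subset {E : Type*} [NormedAddCommGroup E] [NormedSpace ℝ E]
    (Φ : ℝ × E → ℂ) : tsupport (timeDeriv Φ) ⊆ tsupport Φ :=
  (closure_mono fun z hz => by
    have : fderiv ℝ Φ z ≠ 0 := fun h => hz (by simp [timeDeriv, h])
    exact this).trans (tsupport_fderiv_subset ℝ)

theorem slice_eq_zero {E : Type*} [NormedAddCommGroup E] [NormedSpace ℝ E] {Φ : ℝ × E → ℂ}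
    (hΦ : ContDiff ℝ ∞ Φ) (hc : HasCompactSupport Φ) {t : ℝ}
    (h : ∀ x, (t, x) ∉ tsupport Φ) : slice hΦ hc t = 0 := by
  ext x
  exact image_eq_zero_of_notMem_tsupport (f := Φ) (h x)

theorem veryWeak_integrands_eq (u : ℝ → LpSp N p) {φ : ℝ → Sp N → ℂ}
    (hΦ : ContDiff ℝ ∞ fun z : ℝ × Sp N => φ z.1 z.2)
    (hc : HasCompactSupport fun z : ℝ × Sp N => φ z.1 z.2) (t : ℝ) :
    ∫ x, u t x * deriv (fun s => φ s x) t =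
      pairingCLM p (slice (contDiff_timeDeriv hΦ) (hasCompactSupport_timeDeriv hc) t) (u t) ∧
    ∫ x, u t x * logOp N (φ t) x = pairingCLM p (logCLM N (slice hΦ hc t)) (u t) := by
  rw [pairingCLM_apply, pairingCLM_apply]
  constructor
  · refine integral_congr_ae (ae_of_all _ fun x => ?_)
    simp only [(hasDerivAt_timeDeriv hΦ t x).deriv, slice_apply, smul_eq_mul]
    ring
  · refine integral_congr_ae (ae_of_all _ fun x => ?_)
    rw [← logOp_eq_logCLM]
    simp only [smul_eq_mul]
    rw [mul_comm]
    rfl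

/-- The semigroup solves the equation. -/
theorem isSolution_logSemigroup (hp1 : 1 < p) (hp : p < ⊤) (f : LpSp N p) :
    IsSolution f fun t => logSemigroup N t f where
  continuousOn := continuousOn_logSemigroup hp1 hp f
  initial := logSemigroup_zero f
  veryWeak := by
    intro φ hΦ hc hs
    obtain ⟨a, b, ha, hab, hsupp⟩ := exists_subset_Ioo_of_isCompact (hc.image continuous_fst)
      (image_subset_iff.2 fun z hz => (hs hz).1)
    rw [image_subset_iff] at hsupp
    simp_rw [(veryWeak_integrands_eq (fun t => logSemigroup N t f) hΦ hc _).1,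
      (veryWeak_integrands_eq (fun t => logSemigroup N t f) hΦ hc _).2]
    set Ψ' := slice (contDiff_timeDeriv hΦ) (hasCompactSupport_timeDeriv hc)
    set Ψ := slice hΦ hc
    have hout : ∀ t, t ∉ Ioo a b → Ψ t = 0 ∧ Ψ' t = 0 := fun t ht =>
      ⟨slice_eq_zero hΦ hc fun x hx => ht (hsupp hx),
        slice_eq_zero _ _ fun x hx => ht (hsupp (tsupport_timeDeriv_subset _ hx))⟩
    have hred : ∀ G : ℝ → ℂ, (∀ t, t ∉ Ioo a b → G t = 0) →
        ∫ t in Ioi (0 : ℝ), G t = ∫ t in a..b, G t :=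
      fun _ => setIntegral_eq_intervalIntegral_of_eq_zero hab measurableSet_Ioi
        fun t ht => ha.trans ht.1
    have hsub : uIcc a b ⊆ Ici 0 := fun t ht => by
      rw [uIcc_of_le hab] at ht
      exact ha.le.trans ht.1
    have hS := (continuousOn_logSemigroup hp1 hp f).mono hsub
    have hc1 : ContinuousOn (fun t => pairingCLM p (Ψ' t) (logSemigroup N t f)) (uIcc a b) :=
      continuousOn_pairing hS (continuous_slice _ _)
    have hc2 : ContinuousOn (fun t => pairingCLM p (logCLM N (Ψ t)) (logSemigroup N t f))
        (uIcc a b) :=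
      continuousOn_pairing hS ((logCLM N).continuous.comp (continuous_slice _ _))
    have hz : ∀ g : LpSp N p, pairingCLM p (0 : 𝓢(Sp N, ℂ)) g = 0 := fun g => by
      rw [pairingCLM_apply]; simp
    rw [hred _ fun t ht => by rw [(hout t ht).2, hz],
      hred _ fun t ht => by rw [(hout t ht).1, map_zero, hz]]
    -- The test function vanishes at both ends `a` and `b`, so the integrated derivative is zero,
    -- which is the very weak equation.
    have hftc := intervalIntegral.integral_eq_sub_of_hasDerivAt (a := a) (b := b)
      (fun t ht => hasDerivAt_pairing_slice hp1 hp f hΦ hc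
        (show 0 < t by rw [uIcc_of_le hab] at ht; exact ha.trans_le ht.1))
      (hc1.sub hc2).intervalIntegrable
    rw [intervalIntegral.integral_sub hc1.intervalIntegrable hc2.intervalIntegrable,
      show slice hΦ hc b = 0 from (hout b (by simp)).1,
      show slice hΦ hc a = 0 from (hout a (by simp)).1, hz, hz, sub_zero] at hftc
    rw [neg_add_eq_sub, ← neg_sub, hftc, neg_zero]

end Existence

/-! ### Density of compactly supported functions in the Schwartz space -/

section Density

variable {E : Type*} [NormedAddCommGroup E] [NormedSpace ℝ E]

theorem norm_iteratedFDeriv_comp_smul_le {χ : E → ℝ} (hχ : ContDiff ℝ ∞ χ) {c : ℝ} (hc0 : 0 ≤ c)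
    (hc : c ≤ 1) {i : ℕ} {B : ℝ} (hB : ∀ x, ‖iteratedFDeriv ℝ i χ x‖ ≤ B) (x : E) :
    ‖iteratedFDeriv ℝ i (fun x => χ (c • x)) x‖ ≤ B := by
  have h1 : (fun x => χ (c • x)) = χ ∘ (c • ContinuousLinearMap.id ℝ E) := by ext x; simp
  rw [h1, ContinuousLinearMap.iteratedFDeriv_comp_right _ hχ x (by exact_mod_cast le_top)]
  refine (ContinuousMultilinearMap.norm_compContinuousLinearMap_le _ _).trans
    ((mul_le_of_le_one_right (norm_nonneg _) ?_).trans (hB _))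
  rw [Finset.prod_const]
  refine pow_le_one₀ (norm_nonneg _) ((norm_smul_le _ _).trans ?_)
  rw [Real.norm_of_nonneg hc0]
  exact mul_le_one₀ hc (norm_nonneg _) ContinuousLinearMap.norm_id_le

variable [HasContDiffBump E] [FiniteDimensional ℝ E]

/-- Smooth functions with compact support are dense in the Schwartz space. -/
theorem exists_seq_hasCompactSupport_tendsto (ψ : 𝓢(E, ℂ)) :
    ∃ φ : ℕ → 𝓢(E, ℂ), (∀ n, HasCompactSupport (φ n)) ∧ Tendsto φ atTop (𝓝 ψ) := by
  let χ : ContDiffBump (0 : E) := ⟨1, 2, one_pos, one_lt_two⟩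
  have hχ : ContDiff ℝ ∞ χ := χ.contDiff
  have hpos : ∀ n : ℕ, 0 < ((n : ℝ) + 1)⁻¹ := fun n => by positivity
  have hcs : ∀ n : ℕ, HasCompactSupport fun x => χ (((n : ℝ) + 1)⁻¹ • x) • ψ x := fun n =>
    (χ.hasCompactSupport.comp_smul (hpos n).ne').smul_right
  have hcd0 : ∀ n : ℕ, ContDiff ℝ ∞ fun x => χ (((n : ℝ) + 1)⁻¹ • x) := fun n =>
    hχ.comp (contDiff_const_smul _)
  have hcd : ∀ n : ℕ, ContDiff ℝ ∞ fun x => χ (((n : ℝ) + 1)⁻¹ • x) • ψ x := fun n =>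
    (hcd0 n).smul (ψ.smooth ⊤)
  refine ⟨fun n => (hcs n).toSchwartzMap (hcd n), hcs, ?_⟩
  refine ((schwartz_withSeminorms ℝ E ℂ).tendsto_nhds _ _).2 ?_
  rintro ⟨k, m⟩ ε hε
  have hB : ∀ i : ℕ, ∃ B : ℝ, ∀ x, ‖iteratedFDeriv ℝ i χ x‖ ≤ B := fun i =>
    (hχ.continuous_iteratedFDeriv (by exact_mod_cast le_top)).bounded_above_of_compact_support
      (χ.hasCompactSupport.iteratedFDeriv i)
  choose B hB using hB
  -- The Leibniz bound for the cutoff error `(χ(cx) - 1) ψ`; the `+ 1` in `B i + 1` accounts for the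
  -- subtracted constant when `i = 0`.
  set C : ℝ := ∑ i ∈ Finset.range (m + 1), (m.choose i : ℝ) * (B i + 1) *
    SchwartzMap.seminorm ℝ (k + 1) (m - i) ψ with hC
  have hB0 : ∀ i, 0 ≤ B i := fun i => (norm_nonneg _).trans (hB i 0)
  have hC0 : 0 ≤ C := Finset.sum_nonneg fun i _ => by have := hB0 i; positivity
  have hlim : ∀ᶠ n : ℕ in atTop, C * ((n : ℝ) + 1)⁻¹ < ε := by
    have h : Tendsto (fun n : ℕ => C * ((n : ℝ) + 1)⁻¹) atTop (𝓝 (C * 0)) :=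
      (tendsto_inv_atTop_zero.comp
        (tendsto_atTop_add_const_right _ _ tendsto_natCast_atTop_atTop)).const_mul C
    rw [mul_zero] at h
    exact h.eventually_lt_const hε
  filter_upwards [hlim] with n hn
  refine lt_of_le_of_lt ?_ hn
  refine SchwartzMap.seminorm_le_bound ℝ k m _ (mul_nonneg hC0 (hpos n).le) fun x => ?_
  set c := ((n : ℝ) + 1)⁻¹ with hc
  have hc1 : c ≤ 1 := inv_le_one_of_one_le₀ (by linarith [Nat.cast_nonneg (α := ℝ) n])
  set g : E → ℝ := fun x => χ (c • x) - 1 with hg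
  have hgd : ContDiff ℝ ∞ g := (hcd0 n).sub contDiff_const
  have hcoe : (⇑((hcs n).toSchwartzMap (hcd n) - ψ) : E → ℂ) = fun x => g x • ψ x := by
    ext y
    change χ (c • y) • ψ y - ψ y = (χ (c • y) - 1) • ψ y
    rw [sub_smul, one_smul]
  rw [hcoe]
  -- Inside the ball of radius `n + 1` the cutoff is `1` and the error vanishes with its
  -- derivatives. Outside, `1 ≤ ‖x‖ / (n + 1)`: one more power of `‖x‖` buys the small factor.
  rcases lt_or_ge ‖x‖ ((n : ℝ) + 1) with hx | hx
  · have hzero : iteratedFDeriv ℝ m (fun x => g x • ψ x) x = 0 := by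
      by_contra hne
      have h1 : x ∈ tsupport fun x => g x • ψ x := support_iteratedFDeriv_subset m hne
      have h2 : tsupport (fun x => g x • ψ x) ⊆ {x | (n : ℝ) + 1 ≤ ‖x‖} := by
        refine closure_minimal (fun y hy => ?_) (isClosed_le continuous_const continuous_norm)
        by_contra hlt
        simp only [mem_ofPred_eq, not_le] at hlt
        refine hy ?_
        have h3 : χ (c • y) = 1 := χ.one_of_mem_closedBall (by
          rw [mem_closedBall_zero_iff, norm_smul, Real.norm_of_nonneg (hpos n).le,
            inv_mul_le_iff₀ (by positivity)]
          linarith [show χ.rIn = 1 from rfl])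
        simp [hg, h3]
      exact absurd (h2 h1) (not_le.2 hx)
    rw [hzero, norm_zero, mul_zero]
    exact mul_nonneg hC0 (hpos n).le
  · have hDg : ∀ i, ‖iteratedFDeriv ℝ i g x‖ ≤ B i + 1 := fun i => by
      have h1 : g = (fun x => χ (c • x)) - fun _ => 1 := rfl
      rw [h1, iteratedFDeriv_sub_apply (((hcd0 n).of_le (by exact_mod_cast le_top)).contDiffAt)
        contDiffAt_const]
      refine (norm_sub_le _ _).trans (add_le_add
        (norm_iteratedFDeriv_comp_smul_le hχ (hpos n).le hc1 (hB i) x) ?_)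
      rcases i with _ | i
      · simp
      · simp [iteratedFDeriv_const_of_ne (Nat.succ_ne_zero i)]
    have hL := norm_iteratedFDeriv_smul_le (𝕜 := ℝ) (N := ∞) hgd (ψ.smooth ⊤) x (n := m)
      (by exact_mod_cast le_top)
    have hxk : ‖x‖ ^ k ≤ ‖x‖ ^ (k + 1) * c := by
      rw [pow_succ, mul_assoc]
      refine le_mul_of_one_le_right (by positivity) ?_
      rwa [hc, ← div_eq_mul_inv, one_le_div (by positivity)]
    calc ‖x‖ ^ k * ‖iteratedFDeriv ℝ m (fun x => g x • ψ x) x‖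
        ≤ (‖x‖ ^ (k + 1) * c) * ∑ i ∈ Finset.range (m + 1), (m.choose i : ℝ) *
            ‖iteratedFDeriv ℝ i g x‖ * ‖iteratedFDeriv ℝ (m - i) ψ x‖ := by gcongr
      _ = (∑ i ∈ Finset.range (m + 1), (m.choose i : ℝ) * ‖iteratedFDeriv ℝ i g x‖ *
            (‖x‖ ^ (k + 1) * ‖iteratedFDeriv ℝ (m - i) ψ x‖)) * c := by
          rw [Finset.mul_sum, Finset.sum_mul]
          exact Finset.sum_congr rfl fun i _ => by ring
      _ ≤ C * c := by
          rw [hC]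
          refine mul_le_mul_of_nonneg_right (Finset.sum_le_sum fun i _ => ?_) (hpos n).le
          refine mul_le_mul (mul_le_mul_of_nonneg_left (hDg i) (by positivity))
            (SchwartzMap.le_seminorm ℝ (k + 1) (m - i) ψ x) (by positivity) ?_
          have := hB0 i
          positivity

end Density

/-! ### From weak to classical derivatives in time -/

section DuBoisReymond

/-- A smooth function on the line with compact support in `(a, b)` and integral zero is the
derivative of a smooth function with compact support in `[a, b]`. -/
theorem exists_hasDerivAt_of_integral_eq_zero {ζ : ℝ → ℝ} (hζ : ContDiff ℝ ∞ ζ) {a b : ℝ}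
    (hsupp : ∀ t, t ∉ Ioo a b → ζ t = 0) (hint : ∫ t in a..b, ζ t = 0) :
    ∃ θ : ℝ → ℝ, ContDiff ℝ ∞ θ ∧ tsupport θ ⊆ Icc a b ∧ ∀ t, HasDerivAt θ (ζ t) t := by
  have hd : ∀ t, HasDerivAt (fun t => ∫ s in a..t, ζ s) (ζ t) t := fun t =>
    hζ.continuous.integral_hasStrictDerivAt a t |>.hasDerivAt
  refine ⟨fun t => ∫ s in a..t, ζ s, ?_, ?_, hd⟩
  · refine contDiff_infty_iff_deriv.2 ⟨fun t => (hd t).differentiableAt, ?_⟩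
    rwa [show deriv (fun t => ∫ s in a..t, ζ s) = ζ from funext fun t => (hd t).deriv]
  · refine closure_minimal (fun t ht => ?_) isClosed_Icc
    by_contra hout
    refine ht ?_
    have hz : ∀ c d : ℝ, (∀ s ∈ uIcc c d, s ∉ Ioo a b) → ∫ s in c..d, ζ s = 0 := fun c d h =>
      (intervalIntegral.integral_congr fun s hs => hsupp s (h s hs)).trans
        intervalIntegral.integral_zero
    have hii : ∀ c d : ℝ, IntervalIntegrable ζ volume c d := fun c d =>
      hζ.continuous.intervalIntegrable c d
    rcases lt_or_ge t a with h | h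
    · refine hz a t fun s hs hs' => ?_
      rw [uIcc_of_ge h.le] at hs
      exact absurd hs'.1 (not_lt.2 hs.2)
    · have hb : b < t := lt_of_not_ge fun h' => hout ⟨h, h'⟩
      change ∫ s in a..t, ζ s = 0
      rw [← intervalIntegral.integral_add_adjacent_intervals (hii a b) (hii b t), hint, zero_add]
      refine hz b t fun s hs hs' => ?_
      rw [uIcc_of_le hb.le] at hs
      exact absurd hs'.2 (not_lt.2 hs.1)

/-- The fundamental lemma of du Bois-Reymond on `(0, ∞)`. -/
theorem exists_forall_eq_of_setIntegral_deriv_smul_eq_zero {A : ℝ → ℂ} (hA : ContinuousOn A (Ioi 0))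
    (h : ∀ θ : ℝ → ℝ, ContDiff ℝ ∞ θ → HasCompactSupport θ → tsupport θ ⊆ Ioi 0 →
      ∫ t in Ioi (0 : ℝ), deriv θ t • A t = 0) : ∃ k : ℂ, ∀ t, 0 < t → A t = k := by
  let f : ContDiffBump (2 : ℝ) := ⟨1 / 2, 1, by norm_num, by norm_num⟩
  -- A fixed bump of mass one supported in `[1, 3]`; its average of `A` is the constant `k`.
  set ρ : ℝ → ℝ := f.normed volume with hρ
  have hρd : ContDiff ℝ ∞ ρ := f.contDiff_normed
  have hρc : HasCompactSupport ρ := f.hasCompactSupport_normed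
  have hρs : tsupport ρ ⊆ Ioi 0 := by
    rw [hρ, f.tsupport_normed_eq, Real.closedBall_eq_Icc]
    intro t ht
    have : (2 : ℝ) - 1 ≤ t := ht.1
    exact mem_Ioi.2 (by linarith)
  set k := ∫ t in Ioi (0 : ℝ), ρ t • A t with hk
  have key : ∀ᵐ t : ℝ, t ∈ Ioi (0 : ℝ) → A t - k = 0 := by
    refine isOpen_Ioi.ae_eq_zero_of_integral_contDiff_smul_eq_zero
      ((hA.sub continuousOn_const).locallyIntegrableOn measurableSet_Ioi) fun g hg hgc hgs => ?_
    obtain ⟨a, b, ha, hab, hK⟩ := exists_subset_Ioo_of_isCompact (hgc.isCompact.union hρc.isCompact)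
      (union_subset hgs hρs)
    have hg0 : ∀ t, t ∉ Ioo a b → g t = 0 := fun t ht =>
      image_eq_zero_of_notMem_tsupport fun h' => ht (hK (Or.inl h'))
    have hρ0 : ∀ t, t ∉ Ioo a b → ρ t = 0 := fun t ht =>
      image_eq_zero_of_notMem_tsupport fun h' => ht (hK (Or.inr h'))
    have hsub : Ioc a b ⊆ Ioi 0 := fun t ht => ha.trans ht.1
    have hIoi : ∀ G : ℝ → ℂ, (∀ t, t ∉ Ioo a b → G t = 0) →
        ∫ t in Ioi (0 : ℝ), G t = ∫ t in a..b, G t := fun G =>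
      setIntegral_eq_intervalIntegral_of_eq_zero hab measurableSet_Ioi hsub
    have hρ1 : ∫ t in a..b, ρ t = 1 := by
      rw [← setIntegral_eq_intervalIntegral_of_eq_zero hab MeasurableSet.univ (subset_univ _) hρ0,
        setIntegral_univ]
      exact f.integral_normed
    have hAi : ∀ {w : ℝ → ℝ}, Continuous w → IntervalIntegrable (fun t => w t • A t) volume a b :=
      fun {w} hw => ContinuousOn.intervalIntegrable (hw.continuousOn.smul (hA.mono fun t ht => by
        rw [uIcc_of_le hab] at ht
        exact ha.trans_le ht.1))
    set c := ∫ t in a..b, g t with hc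
    -- Subtracting `c * ρ`, with `c` the mass of `g`, makes the integral zero, so the result is the
    -- derivative of an admissible test function.
    have hζd : ContDiff ℝ ∞ fun t => g t - c * ρ t := hg.sub (contDiff_const.mul hρd)
    obtain ⟨θ, hθ, hθs, hθd⟩ := exists_hasDerivAt_of_integral_eq_zero hζd
      (fun t ht => by simp [hg0 t ht, hρ0 t ht]) (by
        rw [intervalIntegral.integral_sub (hg.continuous.intervalIntegrable _ _)
          ((hρd.continuous.intervalIntegrable _ _).const_mul c),
          intervalIntegral.integral_const_mul, hρ1, mul_one, sub_self])
    have h1 := h θ hθ (isCompact_Icc.of_isClosed_subset (isClosed_tsupport _) hθs)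
      (hθs.trans fun t ht => ha.trans_le ht.1)
    simp_rw [(hθd _).deriv] at h1
    rw [hIoi _ fun t ht => by simp [hg0 t ht, hρ0 t ht]] at h1
    have h2 : ∀ t, (g t - c * ρ t) • A t = g t • A t - c • (ρ t • A t) := fun t => by
      rw [sub_smul, mul_smul]
    simp_rw [h2] at h1
    have i1 : IntervalIntegrable (fun t => c • (ρ t • A t)) volume a b :=
      (hAi hρd.continuous).smul c
    rw [intervalIntegral.integral_sub (hAi hg.continuous) i1, intervalIntegral.integral_smul,
      ← hIoi (fun t => ρ t • A t) fun t ht => by simp [hρ0 t ht], ← hk] at h1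
    rw [← setIntegral_univ, setIntegral_eq_intervalIntegral_of_eq_zero hab MeasurableSet.univ
      (subset_univ _) fun t ht => by simp [hg0 t ht]]
    have i2 : IntervalIntegrable (fun t => g t • k) volume a b :=
      (hg.continuous.smul continuous_const).intervalIntegrable _ _
    simp_rw [smul_sub]
    rw [intervalIntegral.integral_sub (hAi hg.continuous) i2,
      intervalIntegral.integral_smul_const, ← hc]
    exact h1
  refine ⟨k, fun t ht => ?_⟩
  have h3 : A =ᵐ[volume.restrict (Ioi 0)] fun _ => k := by
    rw [EventuallyEq, ae_restrict_iff' measurableSet_Ioi]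
    filter_upwards [key] with t ht h0
    exact sub_eq_zero.1 (ht h0)
  exact Measure.eqOn_open_of_ae_eq h3 isOpen_Ioi hA continuousOn_const ht

/-- A continuous function with continuous weak derivative on `(0, ∞)` is differentiable. -/
theorem hasDerivAt_of_setIntegral_deriv_smul_eq {a b : ℝ → ℂ} (ha : ContinuousOn a (Ioi 0))
    (hb : ContinuousOn b (Ioi 0))
    (h : ∀ θ : ℝ → ℝ, ContDiff ℝ ∞ θ → HasCompactSupport θ → tsupport θ ⊆ Ioi 0 →
      ∫ t in Ioi (0 : ℝ), deriv θ t • a t = ∫ t in Ioi (0 : ℝ), θ t • b t) {t : ℝ} (ht : 0 < t) :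
    HasDerivAt a (-b t) t := by
  have hB : ∀ t, 0 < t → HasDerivAt (fun t => ∫ s in (1 : ℝ)..t, b s) (b t) t := fun t ht =>
    intervalIntegral.integral_hasDerivAt_right
      (hb.mono fun s hs => (lt_min one_pos ht).trans_le hs.1).intervalIntegrable
      (hb.stronglyMeasurableAtFilter isOpen_Ioi t ht) (hb.continuousAt (Ioi_mem_nhds ht))
  have hBc : ContinuousOn (fun t => ∫ s in (1 : ℝ)..t, b s) (Ioi 0) := fun t ht =>
    (hB t ht).continuousAt.continuousWithinAt
  -- The hypothesis says `a' = -b` weakly, so `a` plus a primitive of `b` has weak derivative zero;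
  -- integrating `(θ B)'` verifies it.
  obtain ⟨k, hk⟩ := exists_forall_eq_of_setIntegral_deriv_smul_eq_zero (ha.add hBc)
    fun θ hθ hθc hθs => by
    obtain ⟨α, β, hα, hαβ, hK⟩ := exists_subset_Ioo_of_isCompact hθc.isCompact hθs
    have hθ0 : ∀ t, t ∉ Ioo α β → θ t = 0 := fun t ht =>
      image_eq_zero_of_notMem_tsupport fun h' => ht (hK h')
    have hθ'0 : ∀ t, t ∉ Ioo α β → deriv θ t = 0 := fun t ht => by
      by_contra hne
      exact ht (hK (support_deriv_subset hne))
    have hpos : ∀ t ∈ uIcc α β, 0 < t := fun t ht => by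
      rw [uIcc_of_le hαβ] at ht
      exact hα.trans_le ht.1
    have hIoi : ∀ G : ℝ → ℂ, (∀ t, t ∉ Ioo α β → G t = 0) →
        ∫ t in Ioi (0 : ℝ), G t = ∫ t in α..β, G t := fun G =>
      setIntegral_eq_intervalIntegral_of_eq_zero hαβ measurableSet_Ioi fun t ht => hα.trans ht.1
    have hθc' : Continuous (deriv θ) := hθ.continuous_deriv (by simp)
    have i1 : IntervalIntegrable (fun t => deriv θ t • a t) volume α β :=
      ((hθc'.continuousOn (s := uIcc α β)).smul (ha.mono hpos)).intervalIntegrable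
    have i2 : IntervalIntegrable (fun t => deriv θ t • ∫ s in (1 : ℝ)..t, b s) volume α β :=
      ((hθc'.continuousOn (s := uIcc α β)).smul (hBc.mono hpos)).intervalIntegrable
    have i3 : IntervalIntegrable (fun t => θ t • b t) volume α β :=
      ((hθ.continuous.continuousOn (s := uIcc α β)).smul (hb.mono hpos)).intervalIntegrable
    have hftc := intervalIntegral.integral_eq_sub_of_hasDerivAt (a := α) (b := β)
      (fun t ht => ((hθ.differentiable (by simp)) t).hasDerivAt.smul (hB t (hpos t ht)))
      (i3.add i2)
    have h1 := h θ hθ hθc hθs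
    rw [hIoi _ fun t ht => by rw [hθ'0 t ht, zero_smul],
      hIoi _ fun t ht => by rw [hθ0 t ht, zero_smul]] at h1
    rw [intervalIntegral.integral_add i3 i2, Pi.smul_apply', Pi.smul_apply',
      hθ0 β (by simp), hθ0 α (by simp), zero_smul,
      zero_smul, sub_zero, ← h1] at hftc
    rw [hIoi _ fun t ht => by rw [hθ'0 t ht, zero_smul], ← hftc,
      ← intervalIntegral.integral_add i1 i2]
    simp_rw [← smul_add]
    rfl
  have h2 : HasDerivAt (fun t => k - ∫ s in (1 : ℝ)..t, b s) (-b t) t := (hB t ht).const_sub k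
  refine h2.congr_of_eventuallyEq ?_
  filter_upwards [Ioi_mem_nhds ht] with s hs
  exact eq_sub_of_add_eq (hk s hs)

end DuBoisReymond

/-! ### The equation satisfied by an arbitrary solution -/

section Uniqueness

variable {N : ℕ} {p : ℝ≥0∞} [Fact (1 ≤ p)]

/-- The very weak formulation with the product test function `θ(t) ψ(x)`, which reduces the equation
to a scalar weak derivative in time. -/
theorem IsSolution.setIntegral_deriv_smul_pairing {u₀ : LpSp N p} {u : ℝ → LpSp N p}
    (hu : IsSolution u₀ u) {ψ : 𝓢(Sp N, ℂ)} (hψ : HasCompactSupport ψ) {θ : ℝ → ℝ}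
    (hθ : ContDiff ℝ ∞ θ) (hθc : HasCompactSupport θ) (hθs : tsupport θ ⊆ Ioi 0) :
    ∫ t in Ioi (0 : ℝ), deriv θ t • pairingCLM p ψ (u t) =
      ∫ t in Ioi (0 : ℝ), θ t • pairingCLM p (logCLM N ψ) (u t) := by
  have hsupp : ∀ z : ℝ × Sp N, z ∉ tsupport θ ×ˢ tsupport ψ → θ z.1 • ψ z.2 = 0 := fun z hz => by
    rcases not_and_or.1 hz with h | h
    · rw [image_eq_zero_of_notMem_tsupport h, zero_smul]
    · rw [image_eq_zero_of_notMem_tsupport h, smul_zero]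
  have hts : tsupport (fun z : ℝ × Sp N => θ z.1 • ψ z.2) ⊆ tsupport θ ×ˢ tsupport ψ :=
    closure_minimal (fun z hz => by_contra fun h => hz (hsupp z h))
      ((isClosed_tsupport _).prod (isClosed_tsupport _))
  have h := hu.veryWeak (fun t x => θ t • ψ x)
    ((hθ.comp contDiff_fst).smul ((ψ.smooth ⊤).comp contDiff_snd))
    (HasCompactSupport.intro (hθc.isCompact.prod hψ.isCompact) fun z hz => hsupp z hz)
    (hts.trans (prod_mono hθs (subset_univ _)))
  have h1 : ∀ t, ∫ x, u t x * deriv (fun s => θ s • ψ x) t =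
      deriv θ t • pairingCLM p ψ (u t) := fun t => by
    rw [pairingCLM_apply, ← integral_smul]
    refine integral_congr_ae (ae_of_all _ fun x => ?_)
    have hd : HasDerivAt (fun s => θ s • ψ x) (deriv θ t • ψ x) t :=
      ((hθ.differentiable (by simp)) t).hasDerivAt.smul_const _
    beta_reduce
    rw [hd.deriv]
    simp only [smul_eq_mul, Complex.real_smul]
    ring
  have h2 : ∀ t, ∫ x, u t x * logOp N (fun x => θ t • ψ x) x =
      θ t • pairingCLM p (logCLM N ψ) (u t) := fun t => by
    rw [pairingCLM_apply, ← integral_smul]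
    refine integral_congr_ae (ae_of_all _ fun x => ?_)
    have hl : logOp N (fun x => θ t • ψ x) = fun x => (θ t : ℂ) • logCLM N ψ x := by
      have h3 := logOp_eq_logCLM ((θ t : ℂ) • ψ)
      rw [map_smul] at h3
      exact h3
    beta_reduce
    rw [hl]
    simp only [smul_eq_mul, Complex.real_smul]
    ring
  simp_rw [h1, h2] at h
  linear_combination -h

theorem IsSolution.continuousOn_pairing {u₀ : LpSp N p} {u : ℝ → LpSp N p}
    (hu : IsSolution u₀ u) (ψ : 𝓢(Sp N, ℂ)) :
    ContinuousOn (fun t => pairingCLM p ψ (u t)) (Ioi 0) :=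
  (pairingCLM p ψ).continuous.comp_continuousOn (hu.continuousOn.mono Ioi_subset_Ici_self)

/-- The equation satisfied by a solution, tested with Schwartz functions. -/
theorem IsSolution.hasDerivAt_pairing {u₀ : LpSp N p} {u : ℝ → LpSp N p}
    (hu : IsSolution u₀ u) (ψ : 𝓢(Sp N, ℂ)) {t : ℝ} (ht : 0 < t) :
    HasDerivAt (fun t => pairingCLM p ψ (u t)) (-pairingCLM p (logCLM N ψ) (u t)) t := by
  have : Fact (1 ≤ (1 - p⁻¹)⁻¹) := by simp [fact_iff]
  have : p.HolderConjugate (1 - p⁻¹)⁻¹ := ENNReal.HolderConjugate.inv_one_sub_inv' Fact.out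
  set q := (1 - p⁻¹)⁻¹
  obtain ⟨φ, hφc, hφ⟩ := exists_seq_hasCompactSupport_tendsto ψ
  have hct : ∀ {φ' : ℕ → 𝓢(Sp N, ℂ)} {ψ' : 𝓢(Sp N, ℂ)}, Tendsto φ' atTop (𝓝 ψ') →
      Tendsto (fun n => (φ' n).toLp q volume) atTop (𝓝 (ψ'.toLp q volume)) := fun h' =>
    (SchwartzMap.continuous_toLp.tendsto _).comp h'
  have hut : ContinuousAt u t := hu.continuousOn.continuousAt (Ici_mem_nhds ht)
  -- Compactly supported approximations `φ n` are admissible in space; `ψ` is reached by convergence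
  -- of the derivatives uniformly near `t`, from joint continuity of the duality pairing.
  refine hasDerivAt_of_tendstoUniformlyOnFilter (l := atTop)
    (f := fun n t => pairingCLM p (φ n) (u t))
    (f' := fun n t => -pairingCLM p (logCLM N (φ n)) (u t)) (g' := fun t =>
      -pairingCLM p (logCLM N ψ) (u t)) ?_ ?_ ?_
  · rw [Metric.tendstoUniformlyOnFilter_iff]
    intro ε hε
    have h1 : Tendsto (fun z : ℕ × ℝ => lpDual N p q (u z.2)
        ((logCLM N (φ z.1)).toLp q volume - (logCLM N ψ).toLp q volume)) (atTop ×ˢ 𝓝 t) (𝓝 0) := by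
      have h2 := ((lpDual N p q).continuous.tendsto _).comp (hut.tendsto.comp
        (tendsto_snd (f := atTop (α := ℕ)) (g := 𝓝 t)))
      have h3 := ((hct ((logCLM N).continuous.tendsto _ |>.comp hφ)).sub_const
        ((logCLM N ψ).toLp q volume)).comp (tendsto_fst (f := atTop (α := ℕ)) (g := 𝓝 t))
      have h4 := ((isBoundedBilinearMap_apply (𝕜 := ℂ) (E := LpSp N q) (F := ℂ)).continuous.tendsto
        _).comp (h2.prodMk_nhds h3)
      simpa [Function.comp_def] using h4
    filter_upwards [Metric.tendsto_nhds.1 h1 ε hε] with z hz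
    rw [dist_zero_right, map_sub, lpDual_toLp, lpDual_toLp] at hz
    rwa [dist_eq_norm, neg_sub_neg]
  · filter_upwards [(tendsto_snd (f := atTop (α := ℕ)) (g := 𝓝 t)).eventually (Ioi_mem_nhds ht)]
      with z hz
    exact hasDerivAt_of_setIntegral_deriv_smul_eq (hu.continuousOn_pairing _)
      (hu.continuousOn_pairing _)
      (fun θ hθ hθc hθs => hu.setIntegral_deriv_smul_pairing (hφc z.1) hθ hθc hθs) hz
  · refine Filter.Eventually.of_forall fun s => ?_
    have h1 := (((lpDual N p q (u s))).continuous.tendsto _).comp (hct hφ)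
    simpa [Function.comp_def, lpDual_toLp] using h1

end Uniqueness

/-! ### Uniqueness by duality with the backward evolution -/

section Duality

variable {N : ℕ} {p : ℝ≥0∞} [Fact (1 ≤ p)]

/-- A multiplier with an even symbol is its own transpose. -/
theorem fourierMultiplierCLM_apply_of_even {m : Sp N → ℂ} (hm : m.HasTemperateGrowth)
    (hev : ∀ ξ, m (-ξ) = m ξ) (T : 𝓢'(Sp N, ℂ)) (η : 𝓢(Sp N, ℂ)) :
    TemperedDistribution.fourierMultiplierCLM ℂ m T η =
      T (SchwartzMap.fourierMultiplierCLM ℂ m η) := by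
  rw [TemperedDistribution.fourierMultiplierCLM_apply_apply]
  congr 1
  have h : SchwartzMap.smulLeftCLM ℂ m (𝓕⁻ η) =
      𝓕⁻ (SchwartzMap.fourierMultiplierCLM ℂ m η) := by
    ext ξ
    rw [SchwartzMap.smulLeftCLM_apply_apply hm, fourierInv_apply_eq_fourier_neg,
      fourierInv_apply_eq_fourier_neg, SchwartzMap.fourierMultiplierCLM_apply,
      FourierTransform.fourier_fourierInv_eq, SchwartzMap.smulLeftCLM_apply_apply hm, hev]
  rw [h, FourierTransform.fourier_fourierInv_eq]

theorem pairing_logCLM_toLp (η ψ : 𝓢(Sp N, ℂ)) :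
    pairingCLM p (logCLM N η) (ψ.toLp p volume) = pairingCLM p η ((logCLM N ψ).toLp p volume) := by
  change (ψ.toLp p volume : 𝓢'(Sp N, ℂ)) (logCLM N η) =
    ((logCLM N ψ).toLp p volume : 𝓢'(Sp N, ℂ)) η
  rw [logCLM, ← fourierMultiplierCLM_apply_of_even (logSymbol_hasTemperateGrowth N)
      (fun ξ => by simp [logSymbol]), Lp.toTemperedDistribution_toLp_eq,
    Lp.toTemperedDistribution_toLp_eq,
    TemperedDistribution.fourierMultiplierCLM_toTemperedDistributionCLM_eq
      (logSymbol_hasTemperateGrowth N)]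

theorem logCLM_besselMultiplier (σ : ℝ) (ψ : 𝓢(Sp N, ℂ)) :
    logCLM N (SchwartzMap.fourierMultiplierCLM ℂ (besselSymbol N σ) ψ) =
      SchwartzMap.fourierMultiplierCLM ℂ (besselSymbol N σ) (logCLM N ψ) := by
  rw [logCLM, SchwartzMap.fourierMultiplierCLM_fourierMultiplierCLM_apply
      (logSymbol_hasTemperateGrowth N) (besselSymbol_hasTemperateGrowth N σ),
    SchwartzMap.fourierMultiplierCLM_fourierMultiplierCLM_apply
      (besselSymbol_hasTemperateGrowth N σ) (logSymbol_hasTemperateGrowth N), mul_comm]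

theorem pairing_logCLM_logSemigroup_toLp (η ψ : 𝓢(Sp N, ℂ)) (t : ℝ) :
    pairingCLM p (logCLM N η) (logSemigroup N t (ψ.toLp p volume)) =
      pairingCLM p η (logSemigroup N t ((logCLM N ψ).toLp p volume)) := by
  rw [logSemigroup_toLp, logSemigroup_toLp, pairing_logCLM_toLp, logCLM_besselMultiplier]

/-- On Schwartz functions the semigroup is differentiable in norm. -/
theorem hasDerivAt_logSemigroup_toLp (hp1 : 1 < p) (hp : p < ⊤) (ψ : 𝓢(Sp N, ℂ)) {t : ℝ}
    (ht : 0 < t) :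
    HasDerivAt (fun r => logSemigroup N r (ψ.toLp p volume))
      (-logSemigroup N t ((logCLM N ψ).toLp p volume)) t := by
  -- The integral of the continuous curve `G` is differentiable in norm. It coincides with the
  -- increment of the semigroup because both have the same pairings with Schwartz functions.
  set G : ℝ → LpSp N p := fun r => -logSemigroup N r ((logCLM N ψ).toLp p volume) with hG
  have hGc : ContinuousOn G (Ioi 0) :=
    ((continuousOn_logSemigroup hp1 hp _).mono Ioi_subset_Ici_self).neg
  have hGi : ∀ r, 0 < r → IntervalIntegrable G volume t r := fun r hr =>
    (hGc.mono fun s hs => (lt_min ht hr).trans_le hs.1).intervalIntegrable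
  have hI : HasDerivAt (fun r => ∫ s in t..r, G s) (G t) t :=
    intervalIntegral.integral_hasDerivAt_right (hGi t ht)
      (hGc.stronglyMeasurableAtFilter isOpen_Ioi t ht) (hGc.continuousAt (Ioi_mem_nhds ht))
  refine (hI.const_add (logSemigroup N t (ψ.toLp p volume))).congr_of_eventuallyEq ?_
  filter_upwards [Ioi_mem_nhds ht] with r hr
  refine toTemperedDistribution_injective (ContinuousLinearMap.ext fun η => ?_)
  change pairingCLM p η _ = pairingCLM p η _
  rw [map_add]
  have h1 : pairingCLM p η (∫ s in t..r, G s) = ∫ s in t..r, pairingCLM p η (G s) :=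
    ((pairingCLM p η).intervalIntegral_comp_comm (hGi r hr)).symm
  rw [h1, intervalIntegral.integral_eq_sub_of_hasDerivAt
    (f := fun r => pairingCLM p η (logSemigroup N r (ψ.toLp p volume)))
    (f' := fun s => pairingCLM p η (G s)) ?_ ?_]
  · ring
  · intro s hs
    have h2 := hasDerivAt_pairing_logSemigroup hp1 hp (ψ.toLp p volume) η
      ((lt_min ht hr).trans_le hs.1)
    rwa [pairing_logCLM_logSemigroup_toLp, ← map_neg] at h2
  · exact ((pairingCLM p η).continuous.comp_continuousOn
      (hGc.mono fun s hs => (lt_min ht hr).trans_le hs.1)).intervalIntegrable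

/-- Every solution is given by the semigroup. -/
theorem IsSolution.eq_logSemigroup (hp1 : 1 < p) (hp : p < ⊤) {u₀ : LpSp N p}
    {u : ℝ → LpSp N p} (hu : IsSolution u₀ u) {T : ℝ} (hT : 0 < T) :
    u T = logSemigroup N T u₀ := by
  have hq : Fact (1 ≤ (1 - p⁻¹)⁻¹) := by simp [fact_iff]
  have hpq : p.HolderConjugate (1 - p⁻¹)⁻¹ := ENNReal.HolderConjugate.inv_one_sub_inv' Fact.out
  -- The conjugate exponent lies strictly between `1` and `⊤`, so the semigroup theory applies on
  -- the dual side too.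
  set q := (1 - p⁻¹)⁻¹ with hqdef
  have hinv : p⁻¹ < 1 := ENNReal.inv_lt_one.2 hp1
  have hq1 : 1 < q := by
    rw [hqdef, ENNReal.one_lt_inv]
    exact ENNReal.sub_lt_self ENNReal.one_ne_top one_ne_zero (ENNReal.inv_ne_zero.2 hp.ne)
  have hqt : q < ⊤ := by
    rw [hqdef, ENNReal.inv_lt_top]
    exact tsub_pos_of_lt hinv
  refine toTemperedDistribution_injective (ContinuousLinearMap.ext fun ψ => ?_)
  set v : ℝ → LpSp N q := fun s => logSemigroup N (T - s) (ψ.toLp q volume) with hv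
  set M : ℝ → 𝓢(Sp N, ℂ) := fun s =>
    SchwartzMap.fourierMultiplierCLM ℂ (besselSymbol N (-(2 * (T - s)))) ψ with hM
  have hvM : ∀ s, v s = (M s).toLp q volume := fun s => logSemigroup_toLp _ _
  -- Formally `F' = -⟨log(I-Δ)u, v⟩ + ⟨u, log(I-Δ)v⟩ = 0`. The difference `v r - v s` carries the
  -- derivative of `v`, the frozen `v s` that of `u`, which is only continuous in norm.
  set F : ℝ → ℂ := fun s => lpDual N p q (u s) (v s) with hF
  have hFM : ∀ s, F s = pairingCLM p (M s) (u s) := fun s => by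
    rw [hF]
    beta_reduce
    rw [hvM, lpDual_toLp]
  have hcont : ContinuousOn F (Icc 0 T) := by
    refine ((lpDual N p q).continuous.comp_continuousOn
      (hu.continuousOn.mono Icc_subset_Ici_self)).clm_apply ?_
    exact (continuousOn_logSemigroup hq1 hqt _).comp (by fun_prop) fun s hs => sub_nonneg.2 hs.2
  have hder : ∀ s ∈ Ioo 0 T, HasDerivAt F 0 s := fun s hs => by
    have h1 : HasDerivAt (fun r => v r - v s) ((logCLM N (M s)).toLp q volume) s := by
      have h2 := (hasDerivAt_logSemigroup_toLp hq1 hqt ψ (sub_pos.2 hs.2)).scomp s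
        ((hasDerivAt_id s).const_sub T)
      rw [logSemigroup_toLp, ← logCLM_besselMultiplier, neg_smul_neg, one_smul] at h2
      exact h2.sub_const _
    have h3 : ContinuousAt (fun s => (lpDual N p q (u s)).restrictScalars ℝ) s :=
      ((ContinuousLinearMap.restrictScalarsL ℂ (LpSp N q) ℂ ℝ ℝ).continuous.comp
        (lpDual N p q).continuous).continuousAt.comp
        (hu.continuousOn.continuousAt (Ici_mem_nhds hs.1))
    have h5 := (hasDerivAt_clm_apply_of_eq_zero h3 h1 (sub_self _)).add
      (hu.hasDerivAt_pairing (M s) hs.1)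
    refine (h5.congr_deriv ?_).congr_of_eventuallyEq (.of_forall fun r => ?_)
    · simp only [ContinuousLinearMap.coe_restrictScalars', lpDual_toLp]
      ring
    · rw [hF]
      simp [map_sub, hvM, lpDual_toLp]
  have hconst : F T - F 0 = 0 := by
    rw [← intervalIntegral.integral_eq_sub_of_hasDerivAt_of_le hT.le hcont hder
      intervalIntegrable_const]
    simp
  have h0 : F 0 = (logSemigroup N T u₀ : 𝓢'(Sp N, ℂ)) ψ := by
    rw [hFM, hu.initial, coe_logSemigroup hp1 hp hT.le]
    rw [besselOp, fourierMultiplierCLM_apply_of_even (besselSymbol_hasTemperateGrowth N _)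
      (fun ξ => by simp [besselSymbol]), hM]
    beta_reduce
    rw [sub_zero]
    rfl
  have hTT : F T = (u T : 𝓢'(Sp N, ℂ)) ψ := by
    rw [hF]
    beta_reduce
    rw [hv]
    beta_reduce
    rw [sub_self, logSemigroup_zero, lpDual_toLp]
    rfl
  exact hTT.symm.trans ((sub_eq_zero.1 hconst).trans h0)

end Duality

/-! ### Smoothing into `L^q` and into `C₀` -/

section Regularity

variable {N : ℕ} {p : ℝ≥0∞} [Fact (1 ≤ p)]

theorem toReal_timeFromTo (N : ℕ) (p q : ℝ≥0∞) :
    timeFromTo N p q = (N : ℝ) / 2 * (p.toReal⁻¹ - q.toReal⁻¹) := by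
  rw [timeFromTo, ENNReal.toReal_inv, ENNReal.toReal_inv]

/-- The smoothing of the semigroup from `L^p` into `L^q`, through the Hardy-Littlewood-Sobolev
inequality. -/
theorem memLp_logSemigroup (hN : 0 < N) (hp1 : 1 < p) (hp : p < ⊤) {q : ℝ≥0∞} (hpq : p ≤ q)
    (hq : q < ⊤) {t : ℝ} (ht : 0 < t) (htq : timeFromTo N p q ≤ t) (f : LpSp N p) :
    MemLp (logSemigroup N t f) q volume := by
  rcases hpq.eq_or_lt with rfl | hpq
  · exact Lp.memLp _
  have hP := one_lt_toReal hp1 hp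
  have hPQ : p.toReal < q.toReal := (ENNReal.toReal_lt_toReal hp.ne hq.ne).2 hpq
  set P := p.toReal with hPdef
  set Q := q.toReal with hQdef
  have hP0 : 0 < P := zero_lt_one.trans hP
  have hQ0 : 0 < Q := hP0.trans hPQ
  have hN' : (0 : ℝ) < N := by exact_mod_cast hN
  have : Nonempty (Fin N) := ⟨⟨0, hN⟩⟩
  have hdim : (Module.finrank ℝ (Sp N) : ℝ) = N := by rw [finrank_euclideanSpace_fin]
  -- The order for which the Riesz potential maps `L^p` into `L^q`; the condition `α ≤ 2t` is the
  -- condition `t_p^q ≤ t`.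
  set α : ℝ := N * (P⁻¹ - Q⁻¹) with hα
  have hα0 : 0 < α := mul_pos hN' (sub_pos.2 (inv_strictAnti₀ hP0 hPQ))
  have hα2 : α ≤ 2 * t := by
    rw [toReal_timeFromTo] at htq
    linarith
  have hαP : α * P = N * (1 - P / Q) := by
    rw [hα]
    field_simp
  have hPQ1 : 0 < P / Q := by positivity
  have hαPN : α * P < N := by
    rw [hαP]
    nlinarith
  have hαN : α < N := by nlinarith
  obtain ⟨C, hC, hle⟩ := exists_kernelH_le_riesz hα0 hα2 hαN
  refine ⟨Lp.aestronglyMeasurable _, ?_⟩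
  rw [eLpNorm_congr_ae (logSemigroup_coeFn hp1 hp ht f),
    eLpNorm_lt_top_iff_lintegral_rpow_enorm_lt_top (zero_lt_one.trans (hp1.trans hpq)).ne' hq.ne]
  have hfm : Measurable f := (Lp.stronglyMeasurable f).measurable
  have hfin : ∫⁻ x, ENNReal.ofReal ‖f x‖ ^ P < ⊤ := by
    simp_rw [ofReal_norm]
    exact lintegral_rpow_enorm_lt_top hp1 hp (Lp.memLp f)
  have hR := lintegral_riesz_rpow_lt_top (μ := (volume : Measure (Sp N))) (F := fun x => ‖f x‖)
    hfm.norm (fun x => norm_nonneg _) hP hQ0 hfin hα0 (by rwa [hdim])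
    (by rw [hdim, hαP]; field_simp; ring)
  have hpt : ∀ x, ‖heatConv N t f x‖ₑ ≤ C * ∫⁻ y, ENNReal.ofReal (‖y‖ ^ (α - N)) *
      ENNReal.ofReal ‖f (x - y)‖ := fun x => by
    refine (enorm_heatConv_le ht f x).trans ?_
    rw [← lintegral_const_mul' _ _ hC, absHeatConv]
    refine lintegral_mono_ae ?_
    filter_upwards [compl_mem_ae_iff.2 (measure_singleton (0 : Sp N))] with y hy
    rw [ofReal_norm, ← mul_assoc]
    gcongr
    exact hle y hy
  rw [hdim] at hR
  calc ∫⁻ x, ‖heatConv N t f x‖ₑ ^ Q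
      ≤ ∫⁻ x, C ^ Q * (∫⁻ y, ENNReal.ofReal (‖y‖ ^ (α - N)) *
          ENNReal.ofReal ‖f (x - y)‖) ^ Q := by
        refine lintegral_mono fun x => ?_
        rw [← ENNReal.mul_rpow_of_nonneg _ _ hQ0.le]
        exact ENNReal.rpow_le_rpow (hpt x) hQ0.le
    _ = C ^ Q * ∫⁻ x, (∫⁻ y, ENNReal.ofReal (‖y‖ ^ (α - N)) *
          ENNReal.ofReal ‖f (x - y)‖) ^ Q :=
        lintegral_const_mul' _ _ (ENNReal.rpow_ne_top_of_nonneg hQ0.le hC)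
    _ < ⊤ := ENNReal.mul_lt_top (ENNReal.rpow_lt_top_of_nonneg hQ0.le hC) hR

/-- For large times the semigroup maps `L^p` into the functions vanishing at infinity. -/
theorem exists_zeroAtInfty_eq_logSemigroup (hp1 : 1 < p) (hp : p < ⊤) {t : ℝ}
    (ht : N / (2 * p.toReal) < t) (f : LpSp N p) :
    ∃ g : C₀(Sp N, ℂ), logSemigroup N t f =ᵐ[volume] g := by
  have hP := one_lt_toReal hp1 hp
  have ht0 : 0 < t := lt_of_le_of_lt (by positivity) ht
  obtain ⟨C, hC, hle⟩ := exists_lintegral_kernelH_mul_le hP ht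
  set M : 𝓢(Sp N, ℂ) →L[ℂ] 𝓢(Sp N, ℂ) :=
    SchwartzMap.fourierMultiplierCLM ℂ (besselSymbol N (-(2 * t))) with hM
  -- On Schwartz data the image is Schwartz, hence in `C₀`. This bound makes the images of an
  -- approximating sequence Cauchy there, and an almost everywhere convergent subsequence identifies
  -- the limit.
  have hbd : ∀ ψ : 𝓢(Sp N, ℂ), ‖(M ψ).toZeroAtInfty‖ ≤ C.toReal * ‖ψ.toLp p volume‖ := fun ψ => by
    rw [SchwartzMap.norm_toZeroAtInfty, BoundedContinuousFunction.norm_le (by positivity)]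
    intro x
    change ‖M ψ x‖ ≤ _
    have h1 : ‖M ψ x‖ₑ ≤ C * ‖ψ.toLp p volume‖ₑ := by
      rw [hM, fourierMultiplierCLM_besselSymbol_apply ht0]
      refine (enorm_heatConv_le ht0 ψ x).trans
        ((hle (fun x => ‖ψ x‖ₑ) ψ.continuous.measurable.enorm x).trans_eq ?_)
      rw [Lp.enorm_def, eLpNorm_congr_ae (ψ.coeFn_toLp p volume),
        eLpNorm_eq_lintegral_rpow_enorm_toReal (zero_lt_one.trans hp1).ne' hp.ne]
    have h2 := ENNReal.toReal_mono (ENNReal.mul_ne_top hC enorm_ne_top) h1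
    rwa [ENNReal.toReal_mul, toReal_enorm, toReal_enorm] at h2
  obtain ⟨ψ, hψ⟩ := exists_seq_schwartz_tendsto hp f
  have hcauchy : CauchySeq fun n => (M (ψ n)).toZeroAtInfty := by
    refine Metric.cauchySeq_iff.2 fun ε hε => ?_
    obtain ⟨n₀, hn₀⟩ := Metric.cauchySeq_iff.1 hψ.cauchySeq (ε / (C.toReal + 1)) (by positivity)
    refine ⟨n₀, fun m hm n hn => ?_⟩
    have h1 := hn₀ m hm n hn
    rw [lt_div_iff₀ (by positivity), dist_eq_norm] at h1
    have h2 : (M (ψ m)).toZeroAtInfty - (M (ψ n)).toZeroAtInfty =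
        (M (ψ m - ψ n)).toZeroAtInfty := by
      rw [map_sub]
      rfl
    have h3 : (ψ m).toLp p volume - (ψ n).toLp p volume = (ψ m - ψ n).toLp p volume := rfl
    rw [dist_eq_norm, h2]
    rw [h3] at h1
    refine (hbd _).trans_lt (lt_of_le_of_lt ?_ h1)
    nlinarith [norm_nonneg ((ψ m - ψ n).toLp p volume)]
  obtain ⟨g, hg⟩ := cauchySeq_tendsto_of_complete hcauchy
  refine ⟨g, ?_⟩
  have hlim : Tendsto (fun n => logSemigroup N t ((ψ n).toLp p volume)) atTop
      (𝓝 (logSemigroup N t f)) :=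
    (tendstoUniformlyOn_logSemigroup hp1 hp hψ).tendsto_at (mem_Ici.2 ht0.le)
  obtain ⟨ns, hns, hae⟩ := (tendstoInMeasure_of_tendsto_Lp hlim).exists_seq_tendsto_ae
  have hcoe : ∀ᵐ x, ∀ n, logSemigroup N t ((ψ n).toLp p volume) x = M (ψ n) x :=
    ae_all_iff.2 fun n => by
      rw [logSemigroup_toLp]
      exact SchwartzMap.coeFn_toLp _ p volume
  filter_upwards [hae, hcoe] with x hx hxc
  simp only [hxc] at hx
  refine tendsto_nhds_unique hx ?_
  have h4 : Tendsto (fun n => (M (ψ n)).toZeroAtInfty x) atTop (𝓝 (g x)) := by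
    rw [tendsto_iff_dist_tendsto_zero] at hg ⊢
    refine squeeze_zero (fun _ => dist_nonneg) (fun n => ?_) hg
    rw [← ZeroAtInftyContinuousMap.dist_toBCF_eq_dist]
    exact BoundedContinuousFunction.dist_coe_le_dist (f := ((M (ψ n)).toZeroAtInfty).toBCF)
      (g := g.toBCF) x
  exact h4.comp hns.tendsto_atTop

end Regularity

/-! ### Data showing that the time `t_p^q` is optimal -/

section Sharpness

/-- A function that is at least `c ‖x‖^(-b)` near the origin is not in `L^q` when `b > N / q`. -/
theorem not_memLp_of_rpow_le {E F : Type*} [NormedAddCommGroup E] [NormedSpace ℝ E]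
    [FiniteDimensional ℝ E] [MeasurableSpace E] [BorelSpace E] [NormedAddCommGroup F]
    {μ : Measure E} [μ.IsAddHaarMeasure] {g : E → F} {q : ℝ≥0∞} (hq : q ≠ 0) {b c r₀ : ℝ}
    (hc : 0 < c) (hr₀ : 0 < r₀) (hb : Module.finrank ℝ E * q.toReal⁻¹ < b)
    (h : ∀ᵐ x ∂μ, ‖x‖ < r₀ → c * ‖x‖ ^ (-b) ≤ ‖g x‖) (hx0 : ∀ᵐ x ∂μ, x ≠ 0) :
    ¬ MemLp g q μ := by
  intro hg
  set d : ℝ := (Module.finrank ℝ E : ℝ)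
  set s := q.toReal⁻¹ with hs
  have hs0 : 0 ≤ s := by positivity
  have hb0 : 0 < b := lt_of_le_of_lt (by positivity) hb
  set V := μ (Metric.ball (0 : E) 1) with hV
  have hVpos : 0 < V.toReal :=
    ENNReal.toReal_pos (Metric.measure_ball_pos μ 0 one_pos).ne' measure_ball_lt_top.ne
  -- On the ball of radius `r` the function is at least `c * r ^ (-b)`. The norm of this constant
  -- scales with a negative power of `r`; for `q = ⊤` one has `s = 0` by the convention on `toReal`.
  have key : ∀ r : ℝ, 0 < r → r < r₀ → c * V.toReal ^ s * r ^ (d * s - b) ≤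
      (eLpNorm g q μ).toReal := by
    intro r hr hrr
    have h1 : eLpNorm ((Metric.ball (0 : E) r).indicator fun _ => c * r ^ (-b)) q μ ≤
        eLpNorm g q μ := by
      refine eLpNorm_mono_ae ?_
      filter_upwards [h, hx0] with x hx hx0
      by_cases hxr : x ∈ Metric.ball (0 : E) r
      · rw [indicator_of_mem hxr, Real.norm_of_nonneg (by positivity)]
        rw [mem_ball_zero_iff] at hxr
        refine le_trans ?_ (hx (hxr.trans hrr))
        exact mul_le_mul_of_nonneg_left (Real.rpow_le_rpow_of_nonpos (norm_pos_iff.2 hx0) hxr.le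
          (by linarith)) hc.le
      · rw [indicator_of_notMem hxr, norm_zero]
        exact norm_nonneg _
    have hball := Measure.addHaar_ball_of_pos μ (0 : E) hr
    have hne : μ (Metric.ball (0 : E) r) ≠ 0 := (Metric.measure_ball_pos μ 0 hr).ne'
    rw [eLpNorm_indicator_const' measurableSet_ball hne hq, hball, one_div, ← hs] at h1
    have h2 := ENNReal.toReal_mono hg.eLpNorm_lt_top.ne h1
    rw [ENNReal.toReal_mul, ← ENNReal.toReal_rpow, ENNReal.toReal_mul, toReal_enorm,
      Real.norm_of_nonneg (by positivity), ENNReal.toReal_ofReal (by positivity),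
      Real.mul_rpow (by positivity) hVpos.le, ← Real.rpow_natCast r, ← Real.rpow_mul hr.le] at h2
    calc c * V.toReal ^ s * r ^ (d * s - b) = c * r ^ (-b) * (r ^ (d * s) * V.toReal ^ s) := by
          rw [sub_eq_add_neg, Real.rpow_add hr]; ring
      _ ≤ _ := h2
  have hlim : Tendsto (fun r : ℝ => c * V.toReal ^ s * r ^ (d * s - b)) (𝓝[>] 0) atTop :=
    (tendsto_rpow_neg_nhdsGT_zero (by linarith)).const_mul_atTop (by positivity)
  obtain ⟨r, hr, hr0⟩ := ((hlim.eventually_gt_atTop (eLpNorm g q μ).toReal).and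
    (Ioo_mem_nhdsGT hr₀)).exists
  exact absurd (key r hr0.1 hr0.2) (not_le.2 hr)

/-- The power `‖x‖^(-a)` on the unit ball. -/
def truncatedPower (N : ℕ) (a : ℝ) (x : Sp N) : ℝ :=
  (Iio (1 : ℝ)).indicator (fun y => y ^ (-a)) ‖x‖

variable {N : ℕ}

theorem measurable_truncatedPower (a : ℝ) : Measurable (truncatedPower N a) := by
  have h : Measurable ((Iio (1 : ℝ)).indicator fun y => y ^ (-a)) :=
    (by fun_prop : Measurable fun y : ℝ => y ^ (-a)).indicator measurableSet_Iio
  exact h.comp measurable_norm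

theorem truncatedPower_nonneg (a : ℝ) (x : Sp N) : 0 ≤ truncatedPower N a x :=
  indicator_apply_nonneg (s := Iio 1) fun _ => Real.rpow_nonneg (norm_nonneg x) _

theorem truncatedPower_of_lt (a : ℝ) {x : Sp N} (hx : ‖x‖ < 1) :
    truncatedPower N a x = ‖x‖ ^ (-a) := indicator_of_mem (mem_Iio.2 hx) _

theorem memLp_truncatedPower (hN : 0 < N) {p : ℝ≥0∞} (hp1 : 1 < p) (hp : p < ⊤) {a : ℝ}
    (ha : a * p.toReal < N) :
    MemLp (fun x => (truncatedPower N a x : ℂ)) p (volume : Measure (Sp N)) := by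
  have hP : 0 < p.toReal := ENNReal.toReal_pos (zero_lt_one.trans hp1).ne' hp.ne
  have : Nonempty (Fin N) := ⟨⟨0, hN⟩⟩
  have hm : Measurable fun x => (truncatedPower N a x : ℂ) :=
    Complex.measurable_ofReal.comp (measurable_truncatedPower a)
  rw [← integrable_norm_rpow_iff hm.aestronglyMeasurable (zero_lt_one.trans hp1).ne' hp.ne]
  have h1 : (fun x : Sp N => ‖(truncatedPower N a x : ℂ)‖ ^ p.toReal) =
      fun x => (Iio (1 : ℝ)).indicator (fun y => y ^ (-(a * p.toReal))) ‖x‖ := by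
    ext x
    rw [Complex.norm_real, Real.norm_of_nonneg (truncatedPower_nonneg a x), truncatedPower]
    by_cases hx : ‖x‖ ∈ Iio (1 : ℝ)
    · rw [indicator_of_mem hx, indicator_of_mem hx, ← Real.rpow_mul (norm_nonneg _), neg_mul]
    · rw [indicator_of_notMem hx, indicator_of_notMem hx, Real.zero_rpow hP.ne']
  rw [h1, integrable_fun_norm_addHaar, finrank_euclideanSpace_fin]
  have h2 : IntegrableOn (fun y : ℝ => y ^ ((N : ℝ) - 1 - a * p.toReal)) (Ioo 0 1) :=
    (intervalIntegral.integrableOn_Ioo_rpow_iff one_pos).2 (by linarith)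
  have h3 := (integrable_indicator_iff measurableSet_Ioo).2 h2
  refine (integrableOn_congr_fun (fun y hy => ?_) measurableSet_Ioi).1 h3.integrableOn
  have hy0 : 0 < y := hy
  by_cases hy1 : y < 1
  · rw [indicator_of_mem (show y ∈ Ioo (0 : ℝ) 1 from ⟨hy0, hy1⟩),
      indicator_of_mem (mem_Iio.2 hy1), smul_eq_mul, ← Real.rpow_natCast, ← Real.rpow_add hy0,
      Nat.cast_sub hN, Nat.cast_one, sub_eq_add_neg _ (a * p.toReal)]
  · rw [indicator_of_notMem fun h => hy1 h.2, indicator_of_notMem (s := Iio 1) hy1,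
      smul_zero]

/-- Keep only `‖y‖ < ‖x‖ / 2` in the convolution: there the kernel is at least of order
`‖x‖^{2t-N}`, the datum of order `‖x‖^{-a}`, and the volume is of order `‖x‖^N`. The condition `‖x‖
< 1/2` keeps `x - y` in the unit ball. -/
theorem exists_rpow_le_norm_heatConv (hN : 0 < N) {p : ℝ≥0∞} (hp1 : 1 < p) (hp : p < ⊤) {a t : ℝ}
    (ha0 : 0 ≤ a) (ha : a * p.toReal < N) (ht : 0 < t) (htN : 2 * t < N) :
    ∃ c : ℝ, 0 < c ∧ ∀ᵐ x : Sp N, ‖x‖ < 1 / 2 →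
      c * ‖x‖ ^ (-(a - 2 * t)) ≤ ‖heatConv N t (fun x => (truncatedPower N a x : ℂ)) x‖ := by
  have : Nonempty (Fin N) := ⟨⟨0, hN⟩⟩
  obtain ⟨c, hc, hle⟩ := exists_riesz_le_kernelH ht htN
  have hm : Measurable fun x => (truncatedPower N a x : ℂ) :=
    Complex.measurable_ofReal.comp (measurable_truncatedPower a)
  set V := (volume : Measure (Sp N)).real (Metric.ball 0 1) with hV
  have hVpos : 0 < V :=
    ENNReal.toReal_pos (Metric.measure_ball_pos _ 0 one_pos).ne' measure_ball_lt_top.ne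
  refine ⟨c * (1 / 2) ^ (2 * t - N) * (3 / 2) ^ (-a) * ((1 / 2) ^ (N : ℝ) * V), by positivity, ?_⟩
  filter_upwards [ae_convolutionExistsAt_kernelH hp1 hp ht hm (memLp_truncatedPower hN hp1 hp ha),
    compl_mem_ae_iff.2 (measure_singleton (0 : Sp N))] with x hx hx0 hx2
  have hxpos : 0 < ‖x‖ := norm_pos_iff.2 hx0
  have hint : Integrable fun y => kernelH N t y * truncatedPower N a (x - y) := by
    have h1 := hx.integrable.re
    simpa using h1
  have h1 : ‖heatConv N t (fun x => (truncatedPower N a x : ℂ)) x‖ =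
      ∫ y, kernelH N t y * truncatedPower N a (x - y) := by
    rw [heatConv_apply]
    simp_rw [← Complex.ofReal_mul]
    rw [integral_complex_ofReal, Complex.norm_real, Real.norm_of_nonneg
      (integral_nonneg fun y => mul_nonneg (kernelH_nonneg ht y) (truncatedPower_nonneg a _))]
  set s : Set (Sp N) := Metric.ball 0 (‖x‖ / 2) \ {0} with hs
  have hsm : MeasurableSet s := measurableSet_ball.diff (measurableSet_singleton 0)
  have hsv : (volume : Measure (Sp N)).real s = (‖x‖ / 2) ^ (N : ℝ) * V := by
    rw [measureReal_def, hs, measure_sdiff_null (measure_singleton 0),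
      Measure.addHaar_ball_of_pos _ _ (by positivity), ENNReal.toReal_mul,
      ENNReal.toReal_ofReal (by positivity), finrank_euclideanSpace_fin, Real.rpow_natCast]
    rfl
  rw [h1]
  have hlow : ∀ y ∈ s, c * (‖x‖ / 2) ^ (2 * t - N) * (3 / 2 * ‖x‖) ^ (-a) ≤
      kernelH N t y * truncatedPower N a (x - y) := by
    intro y hy
    have hy1 : ‖y‖ < ‖x‖ / 2 := mem_ball_zero_iff.1 hy.1
    have hy0 : y ≠ 0 := hy.2
    have hxy : ‖x - y‖ ≤ 3 / 2 * ‖x‖ := (norm_sub_le _ _).trans (by linarith)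
    have hxy0 : 0 < ‖x - y‖ := by
      have := norm_sub_norm_le x y
      linarith
    rw [truncatedPower_of_lt a (by linarith)]
    refine mul_le_mul ((mul_le_mul_of_nonneg_left ?_ hc.le).trans (hle y hy0 (by linarith))) ?_
      (by positivity) (kernelH_nonneg ht y)
    · exact Real.rpow_le_rpow_of_nonpos (norm_pos_iff.2 hy0) hy1.le (by linarith)
    · exact Real.rpow_le_rpow_of_nonpos hxy0 hxy (by linarith)
  have h2 := setIntegral_ge_of_const_le_real hsm
    ((measure_mono sdiff_subset).trans_lt measure_ball_lt_top).ne hlow hint.integrableOn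
  refine le_trans (le_of_eq ?_) (h2.trans (setIntegral_le_integral hint (ae_of_all _ fun y =>
    mul_nonneg (kernelH_nonneg ht y) (truncatedPower_nonneg a _))))
  rw [hsv, Real.mul_rpow (by norm_num) hxpos.le, div_eq_mul_one_div ‖x‖ 2,
    Real.mul_rpow hxpos.le (by norm_num), Real.mul_rpow hxpos.le (by norm_num)]
  have h3 : ‖x‖ ^ (-(a - 2 * t)) = ‖x‖ ^ (2 * t - N) * ‖x‖ ^ (-a) * ‖x‖ ^ (N : ℝ) := by
    rw [← Real.rpow_add hxpos, ← Real.rpow_add hxpos]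
    congr 1
    ring
  rw [h3]
  ring

/-- Before the time `t_p^q` the semigroup does not map `L^p` into `L^q`. -/
theorem exists_not_memLp_logSemigroup (hN : 0 < N) {p : ℝ≥0∞} [Fact (1 ≤ p)] (hp1 : 1 < p)
    (hp : p < ⊤) {q : ℝ≥0∞} (hq : q ≠ 0) {t : ℝ} (ht : 0 ≤ t) (htq : t < timeFromTo N p q) :
    ∃ f : LpSp N p, ¬ MemLp (logSemigroup N t f) q volume := by
  have : Nonempty (Fin N) := ⟨⟨0, hN⟩⟩
  have hP := one_lt_toReal hp1 hp
  have hN' : (0 : ℝ) < N := by exact_mod_cast hN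
  rw [toReal_timeFromTo] at htq
  -- The upper bound `a < N/p` puts the datum in `L^p`; the lower bound leaves, after a gain of
  -- `2t`, a singularity stronger than `N/q`.
  obtain ⟨a, ha1, ha2⟩ := exists_between
    (show 2 * t + N * q.toReal⁻¹ < N * p.toReal⁻¹ by linarith)
  have hq0 : 0 ≤ N * q.toReal⁻¹ := by positivity
  have ha0 : 0 ≤ a := by linarith
  have haP : a * p.toReal < N := by
    rwa [← div_eq_mul_inv, lt_div_iff₀ (by linarith)] at ha2
  have hmem := memLp_truncatedPower hN hp1 hp haP
  have hdim : (Module.finrank ℝ (Sp N) : ℝ) = N := by rw [finrank_euclideanSpace_fin]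
  have hx0 : ∀ᵐ x : Sp N, x ≠ 0 := compl_mem_ae_iff.2 (measure_singleton (0 : Sp N))
  refine ⟨hmem.toLp, ?_⟩
  rcases ht.eq_or_lt with rfl | ht
  · rw [logSemigroup_zero]
    refine not_memLp_of_rpow_le hq one_pos one_pos (b := a) (by rw [hdim]; linarith) ?_ hx0
    filter_upwards [hmem.coeFn_toLp] with x hx hx1
    rw [hx, Complex.norm_real, Real.norm_of_nonneg (truncatedPower_nonneg a x),
      truncatedPower_of_lt a hx1, one_mul]
  · have htN : 2 * t < N := by
      have : (N : ℝ) * p.toReal⁻¹ < N := mul_lt_of_lt_one_right hN' (inv_lt_one_of_one_lt₀ hP)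
      linarith
    obtain ⟨c, hc, hle⟩ := exists_rpow_le_norm_heatConv hN hp1 hp ha0 haP ht htN
    refine not_memLp_of_rpow_le hq hc one_half_pos (b := a - 2 * t) (by rw [hdim]; linarith) ?_ hx0
    filter_upwards [hle, logSemigroup_coeFn hp1 hp ht hmem.toLp] with x hx hx1
    rwa [hx1, heatConv_congr hmem.coeFn_toLp]

end Sharpness

end

/-! ### The times required to reach `L^q`, and the main theorem -/

theorem timesInto_eq_Ici {N : ℕ} (hN : 0 < N) {p : ℝ≥0∞} [Fact (1 ≤ p)] (hp1 : 1 < p)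
    (hp : p < ⊤) {q : ℝ≥0∞} (hpq : p ≤ q) (hq : q < ⊤) :
    timesInto N p q = Ici (timeFromTo N p q) := by
  ext t
  refine ⟨fun ⟨ht0, ht⟩ => ?_, fun ht => ?_⟩
  · by_contra hlt
    obtain ⟨f, hf⟩ := exists_not_memLp_logSemigroup hN hp1 hp
      (zero_lt_one.trans (hp1.trans_le hpq)).ne' ht0 (not_le.1 hlt)
    exact hf (ht f _ (isSolution_logSemigroup hp1 hp f))
  · have h0 : 0 ≤ timeFromTo N p q := by
      rw [timeFromTo]
      have := ENNReal.toReal_mono (ENNReal.inv_ne_top.2 (zero_lt_one.trans hp1).ne')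
        (ENNReal.inv_le_inv.2 hpq)
      exact mul_nonneg (by positivity) (by linarith)
    refine ⟨h0.trans ht, fun u₀ u hu => ?_⟩
    -- At time `0` there is no smoothing; `t_p^q ≤ 0` forces `q = p`, where membership is trivial.
    rcases (h0.trans ht).eq_or_lt with rfl | ht0
    · rcases hpq.eq_or_lt with rfl | hlt
      · exact Lp.memLp _
      · refine absurd (mem_Ici.1 ht) (not_le.2 ?_)
        have := ENNReal.toReal_strict_mono (ENNReal.inv_ne_top.2 (zero_lt_one.trans hp1).ne')
          (ENNReal.inv_lt_inv.2 hlt)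
        rw [timeFromTo]
        exact mul_pos (by positivity) (by linarith)
    · rw [hu.eq_logSemigroup hp1 hp ht0]
      exact memLp_logSemigroup hN hp1 hp hpq hq ht0 ht u₀

/-- Earlier times fail by the singular data and later ones succeed through `C₀`; the endpoint
`N/(2p)` is left undecided, hence an infimum only. -/
theorem isGLB_timesInto_top {N : ℕ} (hN : 0 < N) {p : ℝ≥0∞} [Fact (1 ≤ p)] (hp1 : 1 < p)
    (hp : p < ⊤) : IsGLB (timesInto N p ⊤) (timeFromTo N p ⊤) := by
  refine ⟨fun t ⟨ht0, ht⟩ => ?_, fun a ha => ?_⟩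
  · by_contra hlt
    obtain ⟨f, hf⟩ := exists_not_memLp_logSemigroup hN hp1 hp ENNReal.top_ne_zero ht0 (not_le.1 hlt)
    exact hf (ht f _ (isSolution_logSemigroup hp1 hp f))
  · have heq : timeFromTo N p ⊤ = N / (2 * p.toReal) := by
      rw [toReal_timeFromTo, ENNReal.toReal_top, inv_zero, sub_zero]
      ring
    refine le_of_forall_gt_imp_ge_of_dense fun t ht => ha ?_
    rw [heq] at ht
    have ht0 : 0 < t := lt_of_le_of_lt (by positivity) ht
    refine ⟨ht0.le, fun u₀ u hu => ?_⟩
    rw [hu.eq_logSemigroup hp1 hp ht0]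
    obtain ⟨g, hg⟩ := exists_zeroAtInfty_eq_logSemigroup hp1 hp ht u₀
    refine (memLp_congr_ae hg).2 ?_
    exact memLp_top_of_bound g.continuous.aestronglyMeasurable ‖g‖
      (ae_of_all _ fun x => (g.toBCF.norm_coe_le_norm x).trans_eq
        ZeroAtInftyContinuousMap.norm_toBCF_eq_norm)

end LogHeat
theorem mainTheorem6 {N : ℕ} (hN : 0 < N) {p : ℝ≥0∞} [Fact (1 ≤ p)] (hp1 : 1 < p) (hp : p < ⊤) :
    -- the kernel is the fundamental solution: its Fourier transform is `e^{-t log(1+|ξ|²)}`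
    (∀ t : ℝ, 0 < t → Integrable (LogHeat.kernelH N t) volume ∧
      ∀ ξ : LogHeat.Sp N, 𝓕 (fun x : LogHeat.Sp N => (LogHeat.kernelH N t x : ℂ)) ξ =
        ((Real.exp (-t * LogHeat.logSymbol N ξ) : ℝ) : ℂ)) ∧
    -- the solution exists, and every solution has the stated form and regularity
    (∀ u₀ : LogHeat.LpSp N p,
      (∃ u : ℝ → LogHeat.LpSp N p, LogHeat.IsSolution u₀ u) ∧
      ∀ u : ℝ → LogHeat.LpSp N p, LogHeat.IsSolution u₀ u → ∀ t : ℝ, 0 < t →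
        (∀ᵐ x, ConvolutionExistsAt (LogHeat.kernelH N t) u₀ x
          (ContinuousLinearMap.lsmul ℝ ℝ) volume) ∧
        (∀ᵐ x, u t x =
          ((LogHeat.kernelH N t) ⋆[ContinuousLinearMap.lsmul ℝ ℝ, volume] u₀) x) ∧
        (u t : 𝓢'(LogHeat.Sp N, ℂ)) =
          LogHeat.besselOp N (-(2 * t)) (u₀ : 𝓢'(LogHeat.Sp N, ℂ)) ∧
        LogHeat.MemBessel N (2 * t) (u t) ∧
        LogHeat.besselNorm N (2 * t) (u t) = ‖u₀‖ₑ ∧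
        ‖u t‖ ≤ ‖u₀‖ ∧
        (t < N / (2 * p.toReal) →
          MemLp (u t) (ENNReal.ofReal (N * p.toReal / (N - 2 * p.toReal * t))) volume) ∧
        (t = N / (2 * p.toReal) → ∀ q : ℝ≥0∞, p ≤ q → q < ⊤ → MemLp (u t) q volume) ∧
        (N / (2 * p.toReal) < t → ∃ g : C₀(LogHeat.Sp N, ℂ), u t =ᵐ[volume] g)) ∧
    -- the time required to get from `L^p` into `L^q`
    (∀ q : ℝ≥0∞, p ≤ q → q < ⊤ →
      LogHeat.timesInto N p q = Ici (LogHeat.timeFromTo N p q)) ∧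
    IsGLB (LogHeat.timesInto N p ⊤) (LogHeat.timeFromTo N p ⊤) := by
  have hP := LogHeat.one_lt_toReal hp1 hp
  have hP0 : 0 < p.toReal := zero_lt_one.trans hP
  have hN' : (0 : ℝ) < N := by exact_mod_cast hN
  refine ⟨fun t ht => ⟨LogHeat.integrable_kernelH N ht, fun ξ => ?_⟩, fun u₀ =>
    ⟨⟨_, LogHeat.isSolution_logSemigroup hp1 hp u₀⟩, fun u hu t ht => ?_⟩,
    fun q hpq hq => LogHeat.timesInto_eq_Ici hN hp1 hp hpq hq,
    LogHeat.isGLB_timesInto_top hN hp1 hp⟩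
  · rw [LogHeat.fourier_kernelH N ht ξ]
  rw [hu.eq_logSemigroup hp1 hp ht]
  refine ⟨LogHeat.ae_convolutionExistsAt_kernelH hp1 hp ht (Lp.stronglyMeasurable u₀).measurable
    (Lp.memLp u₀), LogHeat.logSemigroup_coeFn hp1 hp ht u₀,
    LogHeat.coe_logSemigroup hp1 hp ht.le u₀,
    ⟨u₀, LogHeat.memBessel_logSemigroup hp1 hp ht.le u₀⟩,
    LogHeat.besselNorm_eq (LogHeat.memBessel_logSemigroup hp1 hp ht.le u₀),
    LogHeat.norm_logSemigroup_le hp1 hp ht.le u₀,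
    fun htN => ?_, fun htN q hpq hq => ?_,
    fun htN => LogHeat.exists_zeroAtInfty_eq_logSemigroup hp1 hp htN u₀⟩
  · rw [lt_div_iff₀ (by positivity)] at htN
    have hd : 0 < N - 2 * p.toReal * t := by linarith
    have hle : p.toReal ≤ N * p.toReal / (N - 2 * p.toReal * t) := by
      rw [le_div_iff₀ hd]
      nlinarith [mul_pos hP0 ht]
    -- The exponent `Np/(N - 2pt)` is the one for which `t_p^q` equals `t`, so the smoothing is used
    -- at its endpoint.
    refine LogHeat.memLp_logSemigroup hN hp1 hp ?_ ENNReal.ofReal_lt_top ht (le_of_eq ?_) u₀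
    · rw [← ENNReal.ofReal_toReal hp.ne]
      exact ENNReal.ofReal_le_ofReal (by rwa [ENNReal.ofReal_toReal hp.ne])
    · rw [LogHeat.toReal_timeFromTo, ENNReal.toReal_ofReal (hP0.le.trans hle)]
      field_simp
      ring
  · refine LogHeat.memLp_logSemigroup hN hp1 hp hpq hq ht ?_ u₀
    rw [LogHeat.toReal_timeFromTo, htN, mul_sub]
    have h1 : (N : ℝ) / 2 * p.toReal⁻¹ = N / (2 * p.toReal) := by ring
    have h2 : 0 ≤ (N : ℝ) / 2 * q.toReal⁻¹ := by positivity
    linarith
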